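/- There are absolute constants $C_1,C_2,C_3>0$ and $k_1,k_2\in\mathbb N$ such that the following holds. Write $\tilde O_m(t) := C_m\,t\,(1+|\log t|)^{k_m}$ for $t>0$ and $m\in\{1,2\}$, and $\tilde O_m(0):=0$. Let $d,n\in\mathbb N$, $\epsilon,\delta\in(0,1)$, let $\mu\in\mathbb R^d$, let $\Sigma\in\mathbb R^{d\times d}$ be positive definite, and let $x_1,\dots,x_n\sim\mathcal N(\mu,\Sigma)$ be i.i.d., where $$n\ \ge\ \tilde O_1\!\left(\frac{d^2\log^5(1/\delta)}{\epsilon^2}\right).$$ Write $\mathbb E_i$, $\mathbb E_{ij}$ for the uniform averages over $i\in[n]$ and $(i,j)\in[n]^2$, and let $\mu_0=\mathbb E_i x_i$, $\Sigma_0=\mathbb E_i (x_i-\mu_0)(x_i-\mu_0)^\top$, $X_{ij}=\tfrac12(x_i-x_j)(x_i-x_j)^\top$, $\langle A,B\rangle=\operatorname{tr}(A^\top B)$, and $\|\cdot\|_F$ the Frobenius norm. Then, with probability at least $1-C_3\delta$, the following holds simultaneously for all $v\in\mathbb R^d$, all symmetric $P\in\mathbb R^{d\times d}$, and all weights $a_i\in[0,1]$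 and $a_{ij}\in[0,1]$ ($i,j\in[n]$) that satisfy (i) $a_{ij}=a_{ji}$ for all $i,j$; (ii) $\mathbb E_{ij}a_{ij}\ge 1-4\epsilon$; (iii) $\mathbb E_j a_{ij}\ge a_i(1-2\epsilon)$ for all $i$, and $a_{ij}\le a_i$ for all $i,j$: 1. $|\langle \mu-\mu_0,v\rangle|\le \tilde O_2(\epsilon)\sqrt{v^\top\Sigma v}$; 2. $|\mathbb E_i a_i\langle x_i-\mu_0,v\rangle|\le \tilde O_2(\epsilon)\sqrt{v^\top\Sigma_0 v}$; 3. $|\mathbb E_i a_i[\langle x_i-\mu_0,v\rangle^2-v^\top\Sigma_0 v]|\le \tilde O_2(\epsilon)\, v^\top\Sigma_0 v$; 4. $|\langle\Sigma_0-\Sigma,P\rangle|\le\tilde O_2(\epsilon)\,\|\Sigma^{1/2}P\Sigma^{1/2}\|_F$; 5. $|\mathbb E_i[\langle (x_i-\mu_0)(x_i-\mu_0)^\top-\Sigma_0,P\rangle^2-2\|\Sigma^{1/2}P\Sigma^{1/2}\|_F^2]|\le\tilde O_2(\epsilon)\,\|\Sigma^{1/2}P\Sigma^{1/2}\|_F^2$;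 6. $|\mathbb E_{ij}a_{ij}\langle X_{ij}-\Sigma_0,P\rangle|\le\tilde O_2(\epsilon)\,\|\Sigma^{1/2}P\Sigma^{1/2}\|_F$; 7. $|\mathbb E_{ij}a_{ij}[\langle X_{ij}-\Sigma_0,P\rangle^2-2\|\Sigma^{1/2}P\Sigma^{1/2}\|_F^2]|\le\tilde O_2(\epsilon)\,\|\Sigma^{1/2}P\Sigma^{1/2}\|_F^2$. -/

import Mathlib

open MeasureTheory ProbabilityTheory Matrix
open scoped BigOperators MatrixOrder

noncomputable section

/-- The bound `C · t · (1 + |log t|) ^ k`; an expression is `Õ(t)` if it is at most `softO C k t`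
for some absolute constants `C > 0` and `k`. -/
def softO (C : ℝ) (k : ℕ) (t : ℝ) : ℝ :=
  C * t * (1 + |Real.log t|) ^ k

/-- The outer product `u uᵀ`. -/
def outerSq {d : ℕ} (u : EuclideanSpace ℝ (Fin d)) : Matrix (Fin d) (Fin d) ℝ :=
  Matrix.vecMulVec u.ofLp u.ofLp

/-- The quadratic form `vᵀ M v`. -/
def quadForm {d : ℕ} (M : Matrix (Fin d) (Fin d) ℝ) (v : EuclideanSpace ℝ (Fin d)) : ℝ :=
  v.ofLp ⬝ᵥ (M *ᵥ v.ofLp)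

/-- The trace inner product `⟨A, B⟩ = tr (Aᵀ B)` of matrices. -/
def matInner {d : ℕ} (A B : Matrix (Fin d) (Fin d) ℝ) : ℝ :=
  (Aᵀ * B).trace

section Frobenius

open scoped Matrix.Norms.Frobenius

/-- The Frobenius norm. -/
def frobNorm {d : ℕ} (A : Matrix (Fin d) (Fin d) ℝ) : ℝ := ‖A‖

end Frobenius

/-- `‖S^{1/2} P S^{1/2}‖_F`, with the positive semidefinite square root of `S`. -/
def scaledFrob {d : ℕ} (S P : Matrix (Fin d) (Fin d) ℝ) : ℝ :=
  frobNorm (CFC.sqrt S * P * CFC.sqrt S)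

/-- The sample mean `𝔼 i, x i`. -/
def sampleMean {d n : ℕ} (x : Fin n → EuclideanSpace ℝ (Fin d)) : EuclideanSpace ℝ (Fin d) :=
  𝔼 i, x i

/-- The sample covariance `𝔼 i, (x i - μ₀) (x i - μ₀)ᵀ`, where `μ₀` is the sample mean. -/
def sampleCov {d n : ℕ} (x : Fin n → EuclideanSpace ℝ (Fin d)) : Matrix (Fin d) (Fin d) ℝ :=
  𝔼 i, outerSq (x i - sampleMean x)

/-- The paired matrix `X i j = ½ (x i - x j) (x i - x j)ᵀ`. -/
def pairedMat {d n : ℕ} (x : Fin n → EuclideanSpace ℝ (Fin d)) (i j : Fin n) :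
    Matrix (Fin d) (Fin d) ℝ :=
  (1 / 2 : ℝ) • outerSq (x i - x j)

/-- The conditions on the point weights `a` and the pair weights `b`. -/
structure AdmissibleWeights {n : ℕ} (ε : ℝ) (a : Fin n → ℝ) (b : Fin n → Fin n → ℝ) : Prop where
  a_mem : ∀ i, a i ∈ Set.Icc (0 : ℝ) 1
  b_mem : ∀ i j, b i j ∈ Set.Icc (0 : ℝ) 1
  symm : ∀ i j, b i j = b j i
  total : 1 - 4 * ε ≤ 𝔼 i, 𝔼 j, b i j
  marginal : ∀ i, a i * (1 - 2 * ε) ≤ 𝔼 j, b i j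
  le_point : ∀ i j, b i j ≤ a i

end

/-! ### Sums of sorted values -/

section SortedSums

/-! Writing x_i = μ + Σ^{1/2} z_i with z_i standard Gaussian, and replacing v by Σ^{1/2} v and P by
Σ^{1/2} P Σ^{1/2}, reduces everything to identity covariance. All seven estimates then follow
deterministically (`estimates_of_goodSample`) from one property, `GoodSample`, of the vectors z_i in
dimension d and of z_i z_iᵀ - 1 in dimension d². It says that, uniformly over directions u, the
empirical mean of ⟨φ_i, u⟩ is O(ε), its empirical second moment is correct up to O(ε), and weights
of average at most 4ε capture only O(ε log²(1/ε)) of it.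

Probability enters only in `measureReal_not_goodSample_le`, for independent centred vectors φ_i in
dimension D whose marginals have bounded exponential moments. Let l = 1 + log n + log(1/δ). Second
moments truncated at a level T ≲ l concentrate by Hoeffding, uniformly over a grid of (2n+1)^D
points, as soon as n ε² ≳ D l · T⁴; this is the source of the power l⁵. The values above the
truncation need a different argument, because a union bound over directions fails for subexponential
variables. Instead all signed sums ∑ σ_k φ_k are controlled at once. Adding the vectors one at a
time, the squared norm grows by at most R² plus twice a pairing of φ_k with the preceding partial
sum, whose direction is independent of φ_k. An exponential moment and a union bound over σ bound
these pairings (`measure_exists_pairings_ge_le`), so a signed sum of m vectors has norm at most √m R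
+ 2Lm (`norm_signedSum_le`). Choosing the signs of ⟨φ_i, u⟩ on a set of large values shows that the
k-th largest square is at most 4R²/k, and a harmonic sum bounds their total by 4R²(1 + log n)
(`sum_sq_large_le`), negligible against nε.

For z zᵀ - 1 the exponential moments come from diagonalizing the quadratic form and rotating the
Gaussian. Recentring by the sample mean costs only O(ε) (`stableSample_of_goodSample`). The pair
statistic is ½ r_i + ½ r_j - ⟨ψ_i, P ψ_j⟩ with r_i the centred form at ψ_i. For the cross term the
deleted weight is split as 1 - a_ij = (1 - a_i) + (a_i - a_ij): the first part removes few points i,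
and by the marginal condition the second removes few j for each fixed i. Thus one-sample removal
bounds, applied twice, control the pairs. -/

/-- In decreasing order, the hypothesis for the k largest values bounds the k-th by K/k. The
induction removes the minimum, which is the last term of the harmonic sum. -/
lemma sum_le_mul_harmonic {ι : Type*} [DecidableEq ι] (f : ι → ℝ) (K : ℝ) (T : Finset ι)
    (h : ∀ U ⊆ T, U.Nonempty → ∀ c, (∀ i ∈ U, c ≤ f i) → (U.card : ℝ) * c ≤ K) :
    ∑ i ∈ T, f i ≤ K * (harmonic T.card : ℝ) := by
  induction T using Finset.induction_on_min_value f with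
  | empty => simp
  | insert a s ha hmin ih =>
    have ih' := ih fun U hU => h U (hU.trans (Finset.subset_insert a s))
    have hK := h (insert a s) subset_rfl (Finset.insert_nonempty a s) (f a) (by
      intro i hi
      rcases Finset.mem_insert.1 hi with rfl | hi
      · exact le_rfl
      · exact hmin i hi)
    rw [Finset.sum_insert ha, Finset.card_insert_of_notMem ha, harmonic_succ]
    rw [Finset.card_insert_of_notMem ha] at hK
    push_cast at hK ⊢
    have hpos : (0 : ℝ) < (s.card : ℝ) + 1 := by positivity
    have : f a ≤ K * ((s.card : ℝ) + 1)⁻¹ := by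
      rw [← div_eq_mul_inv, le_div_iff₀ hpos]; linarith
    linarith

end SortedSums

/-! ### Signed sums built one vector at a time -/

section PartialSums

variable {H : Type*} [NormedAddCommGroup H] [InnerProductSpace ℝ H] {n : ℕ}

/-- The signed sum `∑ σ l • φ l` over the indices `l < k`. -/
noncomputable def prefixSum (σ : Fin n → ℝ) (φ : Fin n → H) (k : ℕ) : H :=
  ∑ l : Fin n with l.val < k, σ l • φ l

/-- The pairing of `φ k` with the direction of the preceding signed sum, in absolute value. -/
noncomputable def prefixPairing (σ : Fin n → ℝ) (φ : Fin n → H) (k : Fin n) : ℝ :=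
  |inner ℝ (φ k) (‖prefixSum σ φ k‖⁻¹ • prefixSum σ φ k)|

/-- The number of nonzero coefficients. -/
noncomputable def suppCard (σ : Fin n → ℝ) : ℕ := (Finset.univ.filter fun k => σ k ≠ 0).card

lemma prefixSum_succ (σ : Fin n → ℝ) (φ : Fin n → H) (k : Fin n) :
    prefixSum σ φ (k + 1) = σ k • φ k + prefixSum σ φ k := by
  have : (Finset.univ.filter fun l : Fin n => l.val < k + 1) =
      insert k (Finset.univ.filter fun l : Fin n => l.val < k) := by
    ext l
    simp only [Finset.mem_filter, Finset.mem_univ, true_and, Finset.mem_insert, Fin.ext_iff]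
    omega
  unfold prefixSum
  rw [this, Finset.sum_insert (by simp)]

lemma prefixSum_zero (σ : Fin n → ℝ) (φ : Fin n → H) : prefixSum σ φ 0 = 0 := by
  simp [prefixSum]

lemma prefixSum_top (σ : Fin n → ℝ) (φ : Fin n → H) : prefixSum σ φ n = ∑ l, σ l • φ l := by
  simp [prefixSum]

lemma norm_inv_smul_self_le_one (w : H) : ‖‖w‖⁻¹ • w‖ ≤ 1 := by
  rw [norm_smul, norm_inv, norm_norm]
  exact inv_mul_le_one

/-- Solves the quadratic inequality that arises when a maximum M bounds its own increments. -/
lemma le_add_of_sq_le {M A B : ℝ} (hB : 0 ≤ B) (hA : 0 ≤ A) (h : M ^ 2 ≤ A ^ 2 + M * B) :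
    M ≤ A + B := by
  by_contra! hc
  nlinarith

/-- Expanding the square at each step adds at most R² and twice a pairing scaled by the norm of the
current partial sum. Bounding that norm by the largest one, M, gives M² ≤ m R² + 2 M L m for a
support of size m, which is solved for M. -/
lemma norm_signedSum_le (σ : Fin n → ℝ) (hσ : ∀ k, |σ k| ≤ 1) (φ : Fin n → H) {R L : ℝ}
    (hR : 0 ≤ R) (hL : 0 ≤ L) (hφ : ∀ k, ‖φ k‖ ≤ R)
    (h : ∑ k with σ k ≠ 0, prefixPairing σ φ k ≤ L * suppCard σ) :
    ‖∑ k, σ k • φ k‖ ≤ √(suppCard σ) * R + 2 * L * suppCard σ := by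
  obtain ⟨k₀, hk₀, hmax⟩ := Finset.exists_max_image (Finset.range (n + 1))
    (fun k => ‖prefixSum σ φ k‖) ⟨0, by simp⟩
  set M := ‖prefixSum σ φ k₀‖ with hM
  have hM0 : 0 ≤ M := norm_nonneg _
  have step : ∀ k : Fin n, ‖prefixSum σ φ (k + 1)‖ ^ 2 ≤ ‖prefixSum σ φ k‖ ^ 2 +
      (if σ k ≠ 0 then R ^ 2 + 2 * M * prefixPairing σ φ k else 0) := by
    intro k
    rw [prefixSum_succ]
    split_ifs with h0
    · have h1 : ‖prefixSum σ φ k‖ ≤ M := hmax k (by simp)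
      have h2 : |inner ℝ (φ k) (prefixSum σ φ k)| ≤ M * prefixPairing σ φ k := by
        have : |inner ℝ (φ k) (prefixSum σ φ k)| = ‖prefixSum σ φ k‖ * prefixPairing σ φ k := by
          unfold prefixPairing
          rw [real_inner_smul_right, abs_mul, abs_of_nonneg (inv_nonneg.2 (norm_nonneg _)), ← mul_assoc]
          -- A zero partial sum has direction 0, as the inverse of 0 is 0, and both sides vanish.
          by_cases hw : prefixSum σ φ k = 0
          · simp [hw]
          · rw [mul_inv_cancel₀ (norm_ne_zero_iff.2 hw), one_mul]
        rw [this]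
        exact mul_le_mul_of_nonneg_right h1 (abs_nonneg _)
      rw [norm_add_sq_real, norm_smul, real_inner_smul_left]
      have h3 : σ k * inner ℝ (φ k) (prefixSum σ φ k) ≤ M * prefixPairing σ φ k := by
        refine (le_abs_self _).trans ?_
        rw [abs_mul]
        exact (mul_le_of_le_one_left (abs_nonneg _) (hσ k)).trans h2
      have h4 : ‖σ k‖ * ‖φ k‖ ≤ R := by
        rw [Real.norm_eq_abs]
        exact (mul_le_of_le_one_left (norm_nonneg _) (hσ k)).trans (hφ k)
      have h5 : (‖σ k‖ * ‖φ k‖) ^ 2 ≤ R ^ 2 := by gcongr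
      linarith
    · push Not at h0
      simp [h0]
  have key : ∀ k ≤ n, ‖prefixSum σ φ k‖ ^ 2 ≤ ∑ l : Fin n with l.val < k,
      (if σ l ≠ 0 then R ^ 2 + 2 * M * prefixPairing σ φ l else 0) := by
    intro k
    induction k with
    | zero => simp [prefixSum_zero]
    | succ k ih =>
      intro hk
      have hs := step ⟨k, hk⟩
      have : (Finset.univ.filter fun l : Fin n => l.val < k + 1) =
          insert ⟨k, hk⟩ (Finset.univ.filter fun l : Fin n => l.val < k) := by
        ext l
        simp only [Finset.mem_filter, Finset.mem_univ, true_and, Finset.mem_insert, Fin.ext_iff]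
        omega
      rw [this, Finset.sum_insert (by simp)]
      have := ih (by omega)
      simp only at hs
      linarith
  have hpair : ∀ l, 0 ≤ prefixPairing σ φ l := fun l => abs_nonneg _
  have h1 := key k₀ (by simpa [Nat.lt_succ_iff] using hk₀)
  have h2 : ∑ l : Fin n with l.val < k₀,
      (if σ l ≠ 0 then R ^ 2 + 2 * M * prefixPairing σ φ l else 0) ≤
      ∑ l : Fin n, (if σ l ≠ 0 then R ^ 2 + 2 * M * prefixPairing σ φ l else 0) := by
    apply Finset.sum_le_sum_of_subset_of_nonneg (Finset.filter_subset _ _)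
    intro i _ _
    split_ifs
    · have := hpair i
      positivity
    · exact le_rfl
  have h3 : ∑ l : Fin n, (if σ l ≠ 0 then R ^ 2 + 2 * M * prefixPairing σ φ l else 0) =
      suppCard σ * R ^ 2 + 2 * M * ∑ k with σ k ≠ 0, prefixPairing σ φ k := by
    rw [← Finset.sum_filter, Finset.sum_add_distrib, Finset.mul_sum, Finset.sum_const, suppCard,
      nsmul_eq_mul]
  have h4 : M ≤ √(suppCard σ) * R + 2 * L * suppCard σ := by
    apply le_add_of_sq_le (by positivity) (by positivity)
    rw [mul_pow, Real.sq_sqrt (by positivity)]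
    have := mul_le_mul_of_nonneg_left h (by positivity : 0 ≤ 2 * M)
    nlinarith
  rw [← prefixSum_top]
  exact (hmax n (by simp)).trans h4

/-- Control of all signed sums forces the large values of `⟨φ i, u⟩` to be few. -/
lemma sum_sq_large_le (φ : Fin n → H) {R L : ℝ} (hL : 0 < L)
    (h : ∀ σ : Fin n → SignType, ‖∑ k, (σ k : ℝ) • φ k‖ ≤
      √(suppCard fun k => (σ k : ℝ)) * R + 2 * L * suppCard fun k => (σ k : ℝ))
    (u : H) (hu : ‖u‖ ≤ 1) :
    ∑ i with 4 * L < |inner ℝ (φ i) u|, inner ℝ (φ i) u ^ 2 ≤ 4 * R ^ 2 * (1 + Real.log n) := by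
  classical
  set T := Finset.univ.filter fun i => 4 * L < |inner ℝ (φ i) u| with hT
  have hR : ∀ U ⊆ T, U.Nonempty → ∀ c, (∀ i ∈ U, c ≤ inner ℝ (φ i) u ^ 2) →
      (U.card : ℝ) * c ≤ 4 * R ^ 2 := by
    intro U hU hne c hc
    rcases lt_or_ge c 0 with hc0 | hc0
    · have := mul_nonpos_of_nonneg_of_nonpos (Nat.cast_nonneg (α := ℝ) U.card) hc0.le
      nlinarith [sq_nonneg R]
    -- With these signs on U, pairing the signed sum with u yields the sum of absolute values over
    -- U.
    set σ : Fin n → SignType := fun i => if i ∈ U then SignType.sign (inner ℝ (φ i) u) else 0 with hσ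
    have hm : suppCard (fun k => (σ k : ℝ)) = U.card := by
      unfold suppCard
      congr 1
      ext i
      simp only [hσ, Finset.mem_filter, Finset.mem_univ, true_and]
      by_cases hi : i ∈ U
      · simp only [hi, if_true, iff_true]
        have h1 : 4 * L < |inner ℝ (φ i) u| := by
          have := hU hi
          simpa [hT] using this
        have h2 : inner ℝ (φ i) u ≠ 0 := by
          intro h0
          rw [h0, abs_zero] at h1
          linarith
        rcases lt_or_gt_of_ne h2 with h3 | h3
        · simp [sign_neg h3]
        · simp [sign_pos h3]
      · simp [hi]
    have h1 := h σ
    rw [hm] at h1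
    have h2 : ∑ i ∈ U, |inner ℝ (φ i) u| ≤ ‖∑ k, (σ k : ℝ) • φ k‖ := by
      have h3 : ∑ i ∈ U, |inner ℝ (φ i) u| = inner ℝ (∑ k, (σ k : ℝ) • φ k) u := by
        rw [sum_inner, ← Finset.sum_subset (Finset.subset_univ U)]
        · apply Finset.sum_congr rfl
          intro i hi
          rw [real_inner_smul_left]
          simp [hσ, hi]
        · intro i _ hi
          simp [hσ, hi]
      rw [h3]
      refine (real_inner_le_norm _ _).trans ?_
      exact mul_le_of_le_one_right (norm_nonneg _) hu
    -- Since s ≥ 4L, the term 2Lm is at most half of ms and is absorbed on the left, leaving m s² ≤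
    -- 4R².
    set s := max √c (4 * L) with hs
    have hs0 : 0 < s := lt_of_lt_of_le (by positivity) (le_max_right _ _)
    have h4 : (U.card : ℝ) * s ≤ ∑ i ∈ U, |inner ℝ (φ i) u| := by
      rw [← nsmul_eq_mul]
      apply Finset.card_nsmul_le_sum
      intro i hi
      apply max_le
      · rw [← Real.sqrt_sq_eq_abs]
        exact Real.sqrt_le_sqrt (hc i hi)
      · have := hU hi
        simp only [hT, Finset.mem_filter, Finset.mem_univ, true_and] at this
        exact this.le
    set m : ℝ := (U.card : ℝ) with hmdef
    have hm0 : 0 < m := by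
      have := hne.card_pos
      positivity
    have h5 : m * s ≤ √m * R + 2 * L * m := h4.trans (h2.trans h1)
    have h6 : 4 * L ≤ s := le_max_right _ _
    have h7 : m * s ≤ 2 * (√m * R) := by nlinarith
    have h8 : (m * s) ^ 2 ≤ (2 * (√m * R)) ^ 2 := by gcongr
    have h9 : (√m) ^ 2 = m := Real.sq_sqrt hm0.le
    have h10 : m * (m * s ^ 2) ≤ m * (4 * R ^ 2) := by
      calc m * (m * s ^ 2) = (m * s) ^ 2 := by ring
        _ ≤ _ := h8
        _ = (√m) ^ 2 * (4 * R ^ 2) := by ring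
        _ = _ := by rw [h9]
    have h11 := le_of_mul_le_mul_left h10 hm0
    have h12 : c ≤ s ^ 2 := by
      calc c = √c ^ 2 := (Real.sq_sqrt hc0).symm
        _ ≤ s ^ 2 := by
          gcongr
          exact le_max_left _ _
    nlinarith
  have := sum_le_mul_harmonic (fun i => inner ℝ (φ i) u ^ 2) (4 * R ^ 2) T hR
  refine this.trans ?_
  apply mul_le_mul_of_nonneg_left _ (by positivity)
  rcases Nat.eq_zero_or_pos T.card with h0 | h0
  · rw [h0]
    simp only [harmonic_zero, Rat.cast_zero]
    have : 0 ≤ Real.log n := Real.log_natCast_nonneg n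
    linarith
  · refine (harmonic_le_one_add_log T.card).trans ?_
    have h1 : T.card ≤ n := by simpa using Finset.card_le_univ T
    have : Real.log T.card ≤ Real.log n := Real.log_le_log (by positivity) (by exact_mod_cast h1)
    linarith

end PartialSums

/-! ### Exponential moments of the pairings and the union bound over signs -/

section Chain

open scoped ENNReal

/-- Fubini on the product law: with `A` frozen, the inner integral over `B` is at most `c`. This
replaces conditioning on the past. -/
lemma lintegral_mul_le_of_indepFun {Ω α β : Type*} [MeasurableSpace Ω] [MeasurableSpace α]
    [MeasurableSpace β] {Pr : Measure Ω} [IsProbabilityMeasure Pr] {A : Ω → α} {B : Ω → β}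
    (hA : Measurable A) (hB : Measurable B) (hAB : IndepFun A B Pr) {f : α → ℝ≥0∞}
    {g : α × β → ℝ≥0∞} (hf : Measurable f) (hg : Measurable g) {c : ℝ≥0∞}
    (hc : ∀ a, ∫⁻ ω, g (a, B ω) ∂Pr ≤ c) :
    ∫⁻ ω, f (A ω) * g (A ω, B ω) ∂Pr ≤ c * ∫⁻ ω, f (A ω) ∂Pr := by
  have hlaw := (indepFun_iff_map_prod_eq_prod_map_map hA.aemeasurable hB.aemeasurable).1 hAB
  have h1 : ∫⁻ ω, f (A ω) * g (A ω, B ω) ∂Pr =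
      ∫⁻ p, f p.1 * g p ∂((Pr.map A).prod (Pr.map B)) := by
    rw [← hlaw, lintegral_map (by fun_prop) (by fun_prop)]
  have : IsProbabilityMeasure (Pr.map B) := Measure.isProbabilityMeasure_map hB.aemeasurable
  rw [h1, lintegral_prod _ (by fun_prop), ← lintegral_map hf hA,
    ← lintegral_const_mul _ hf]
  apply lintegral_mono
  intro a
  simp only
  rw [lintegral_const_mul _ (by fun_prop), mul_comm]
  gcongr
  rw [lintegral_map (by fun_prop) hB]
  exact hc a

variable {H : Type*} [NormedAddCommGroup H] [InnerProductSpace ℝ H] [MeasurableSpace H]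
  [BorelSpace H] [SecondCountableTopology H] {n : ℕ}
  {Ω : Type*} [MeasurableSpace Ω] {Pr : Measure Ω}

lemma measurable_prefixSum (σ : Fin n → ℝ) (k : ℕ) :
    Measurable fun φ : Fin n → H => prefixSum σ φ k := by
  unfold prefixSum
  fun_prop

lemma measurable_prefixPairing (σ : Fin n → ℝ) (k : Fin n) :
    Measurable fun φ : Fin n → H => prefixPairing σ φ k := by
  unfold prefixPairing
  have := measurable_prefixSum (H := H) σ k
  fun_prop

omit [MeasurableSpace H] [BorelSpace H] [SecondCountableTopology H] in
lemma prefixSum_congr (σ : Fin n → ℝ) {φ ψ : Fin n → H} {k : ℕ}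
    (h : ∀ l : Fin n, l.val < k → φ l = ψ l) : prefixSum σ φ k = prefixSum σ ψ k := by
  unfold prefixSum
  apply Finset.sum_congr rfl
  intro l hl
  rw [h l (by simpa using hl)]

/-- The factor contributed by index `l` to the exponential moment of the pairings. -/
noncomputable def pairingFactor (σ : Fin n → ℝ) (φ : Fin n → H) (l : Fin n) : ℝ≥0∞ :=
  if σ l ≠ 0 then ENNReal.ofReal (Real.exp (prefixPairing σ φ l / 4)) else 1

lemma measurable_pairingFactor (σ : Fin n → ℝ) (l : Fin n) :
    Measurable fun φ : Fin n → H => pairingFactor σ φ l := by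
  unfold pairingFactor
  have := measurable_prefixPairing (H := H) σ l
  split_ifs <;> fun_prop

/-- The direction paired with φ_k depends only on earlier vectors and has norm at most 1.
Integrating out the last vector first therefore costs a factor 3, and the rest follows by induction.
-/
lemma lintegral_prod_pairingFactor_le [IsProbabilityMeasure Pr] (σ : Fin n → ℝ)
    (Φ : Fin n → Ω → H)
    (hm : ∀ i, Measurable (Φ i)) (hind : iIndepFun Φ Pr)
    (hψ : ∀ i (u : H), ‖u‖ ≤ 1 → ∫⁻ ω, ENNReal.ofReal (Real.exp (|inner ℝ (Φ i ω) u| / 4)) ∂Pr ≤ 3)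
    (k : ℕ) (hk : k ≤ n) :
    ∫⁻ ω, ∏ l with l.val < k, pairingFactor σ (fun i => Φ i ω) l ∂Pr ≤
      ∏ l : Fin n with l.val < k, (if σ l ≠ 0 then 3 else 1) := by
  classical
  induction k with
  | zero => simp
  | succ k ih =>
    have hins : (Finset.univ.filter fun l : Fin n => l.val < k + 1) =
        insert ⟨k, hk⟩ (Finset.univ.filter fun l : Fin n => l.val < k) := by
      ext l
      simp only [Finset.mem_filter, Finset.mem_univ, true_and, Finset.mem_insert, Fin.ext_iff]
      omega
    set S := Finset.univ.filter fun l : Fin n => l.val < k with hS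
    have hkS : (⟨k, hk⟩ : Fin n) ∉ S := by simp [hS]
    rw [hins, Finset.prod_insert hkS]
    simp_rw [Finset.prod_insert hkS]
    set κ : Fin n := ⟨k, hk⟩ with hκ
    by_cases h0 : σ κ = 0
    · simpa [pairingFactor, h0] using ih (by omega)
    -- Extension by zero expresses the earlier factors and the partial sum through the coordinates
    -- in `S` alone, so that independence from φ_k applies.
    set ext : (S → H) → (Fin n → H) := fun y i => if h : i ∈ S then y ⟨i, h⟩ else 0 with hext
    have hextm : Measurable ext := by
      rw [measurable_pi_iff]
      intro i
      simp only [hext]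
      split_ifs <;> fun_prop
    have hres : ∀ ω, ∀ l : Fin n, l.val < k → ext (fun i : S => Φ i ω) l = Φ l ω := by
      intro ω l hl
      simp [hext, hS, hl]
    have hindep : IndepFun (fun ω (i : S) => Φ i ω) (Φ κ) Pr := by
      have := hind.indepFun_finset S {κ} (by simpa using hkS) hm
      exact this.comp (φ := id) (ψ := fun y : (({κ} : Finset (Fin n)) → H) => y ⟨κ, by simp⟩)
        measurable_id (by fun_prop)
    set f : (S → H) → ℝ≥0∞ := fun y => ∏ l ∈ S, pairingFactor σ (ext y) l with hf
    set W : (S → H) → H := fun y => prefixSum σ (ext y) k with hW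
    set g : (S → H) × H → ℝ≥0∞ := fun p => ENNReal.ofReal (Real.exp
        (|inner ℝ p.2 (‖W p.1‖⁻¹ • W p.1)| / 4)) with hg
    have hfm : Measurable f := by
      apply Finset.measurable_fun_prod
      intro l _
      exact (measurable_pairingFactor σ l).comp hextm
    have hWm : Measurable W := (measurable_prefixSum (H := H) σ k).comp hextm
    have hgm : Measurable g := by fun_prop
    have hAm : Measurable fun ω (i : S) => Φ i ω := measurable_pi_lambda _ fun i => hm i
    have hgc : ∀ a, ∫⁻ ω, g (a, Φ κ ω) ∂Pr ≤ 3 := fun a =>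
      hψ κ (‖W a‖⁻¹ • W a) (norm_inv_smul_self_le_one (W a))
    have key := lintegral_mul_le_of_indepFun hAm (hm κ) hindep hfm hgm hgc
    simp only [hf, hg, hW] at key
    have h1 : ∀ ω, ∏ l ∈ S, pairingFactor σ (ext fun i : S => Φ i ω) l =
        ∏ l ∈ S, pairingFactor σ (fun i => Φ i ω) l := by
      intro ω
      apply Finset.prod_congr rfl
      intro l hl
      have hl' : l.val < k := by simpa [hS] using hl
      unfold pairingFactor prefixPairing
      rw [hres ω l hl', prefixSum_congr σ (φ := ext fun i : S => Φ i ω) (ψ := fun i => Φ i ω)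
        (fun j hj => hres ω j (hj.trans hl'))]
    have h2 : ∀ ω, prefixSum σ (ext fun i : S => Φ i ω) k = prefixSum σ (fun i => Φ i ω) k :=
      fun ω => prefixSum_congr σ (hres ω)
    simp_rw [h1, h2] at key
    rw [if_pos h0]
    refine le_trans (le_of_eq ?_) (key.trans (mul_le_mul_right (ih (by omega)) _))
    apply lintegral_congr
    intro ω
    rw [mul_comm]
    have h3 : pairingFactor σ (fun i => Φ i ω) κ = ENNReal.ofReal
        (Real.exp (prefixPairing σ (fun i => Φ i ω) κ / 4)) := if_pos h0
    rw [h3]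
    rfl

lemma measure_pairings_ge_le [IsProbabilityMeasure Pr] (σ : Fin n → ℝ) (Φ : Fin n → Ω → H)
    (hm : ∀ i, Measurable (Φ i)) (hind : iIndepFun Φ Pr)
    (hψ : ∀ i (u : H), ‖u‖ ≤ 1 → ∫⁻ ω, ENNReal.ofReal (Real.exp (|inner ℝ (Φ i ω) u| / 4)) ∂Pr ≤ 3)
    (L : ℝ) :
    Pr {ω | L * suppCard σ ≤ ∑ k with σ k ≠ 0, prefixPairing σ (fun i => Φ i ω) k} ≤
      ENNReal.ofReal ((3 * Real.exp (-L / 4)) ^ suppCard σ) := by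
  have h := lintegral_prod_pairingFactor_le (Pr := Pr) σ Φ hm hind hψ n le_rfl
  have h2 : ∏ l : Fin n with l.val < n, (if σ l ≠ 0 then (3 : ℝ≥0∞) else 1) = 3 ^ suppCard σ := by
    rw [← Finset.prod_filter, Finset.prod_const, suppCard]
    simp
  have h3 : ∀ ω, ∏ l : Fin n with l.val < n, pairingFactor σ (fun i => Φ i ω) l =
      ENNReal.ofReal (Real.exp (∑ k with σ k ≠ 0, prefixPairing σ (fun i => Φ i ω) k / 4)) := by
    intro ω
    unfold pairingFactor
    rw [← Finset.prod_filter, Real.exp_sum, ENNReal.ofReal_prod_of_nonneg]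
    · simp
    · intros
      positivity
  rw [h2] at h
  simp_rw [h3] at h
  have hmeas : Measurable fun ω => ENNReal.ofReal
      (Real.exp (∑ k with σ k ≠ 0, prefixPairing σ (fun i => Φ i ω) k / 4)) := by
    have : ∀ k, Measurable fun ω => prefixPairing σ (fun i => Φ i ω) k := fun k =>
      (measurable_prefixPairing σ k).comp (measurable_pi_lambda _ hm)
    fun_prop
  have hmk := mul_meas_ge_le_lintegral (μ := Pr) hmeas
    (ENNReal.ofReal (Real.exp (L * suppCard σ / 4)))
  have hsub : {ω | L * suppCard σ ≤ ∑ k with σ k ≠ 0, prefixPairing σ (fun i => Φ i ω) k} ⊆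
      {ω | ENNReal.ofReal (Real.exp (L * suppCard σ / 4)) ≤ ENNReal.ofReal
      (Real.exp (∑ k with σ k ≠ 0, prefixPairing σ (fun i => Φ i ω) k / 4))} := by
    intro ω hω
    apply ENNReal.ofReal_le_ofReal
    apply Real.exp_le_exp.2
    rw [← Finset.sum_div]
    exact div_le_div_of_nonneg_right hω (by norm_num)
  refine (measure_mono hsub).trans ?_
  have hpos : ENNReal.ofReal (Real.exp (L * suppCard σ / 4)) ≠ 0 := by
    simp [Real.exp_pos]
  have h4 := (ENNReal.le_div_iff_mul_le (Or.inl hpos) (Or.inl ENNReal.ofReal_ne_top)).2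
    ((mul_comm _ _).trans_le (hmk.trans h))
  refine h4.trans (le_of_eq ?_)
  rw [show (3 : ℝ≥0∞) = ENNReal.ofReal 3 by simp, ← ENNReal.ofReal_pow (by norm_num),
    ← ENNReal.ofReal_div_of_pos (Real.exp_pos _), mul_pow, ← Real.exp_nat_mul, div_eq_mul_inv,
    ← Real.exp_neg]
  congr 3
  ring

/-- Expanding the product, each index contributes 1 for the sign 0 and x for each of the signs ±1.
-/
lemma sum_pow_suppCard (x : ℝ) :
    ∑ σ : Fin n → SignType, x ^ suppCard (fun k => (σ k : ℝ)) = (1 + 2 * x) ^ n := by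
  classical
  have h1 : ∀ σ : Fin n → SignType, x ^ suppCard (fun k => (σ k : ℝ)) =
      ∏ k, (if σ k = 0 then 1 else x) := by
    intro σ
    rw [suppCard, ← Finset.prod_const, Finset.prod_filter]
    apply Finset.prod_congr rfl
    intro k _
    rcases σ k with _ | _ | _ <;> simp
  simp_rw [h1]
  have := Finset.prod_univ_sum (fun _ : Fin n => (Finset.univ : Finset SignType))
    (fun _ s => if s = 0 then (1 : ℝ) else x)
  rw [Fintype.piFinset_univ] at this
  rw [← this, Finset.prod_const, Finset.card_univ, Fintype.card_fin]
  congr 1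
  have : (Finset.univ : Finset SignType) = {0, -1, 1} := by decide
  rw [this]
  rw [Finset.sum_insert (by decide), Finset.sum_insert (by decide), Finset.sum_singleton]
  simp
  ring

/-- A sign vector of support m fails with probability at most (3e^{-L/4})^m, a rate that beats the
number of such vectors once e^{L/4} is much larger than n; the generating function sums all supports
together. -/
lemma measure_exists_pairings_ge_le [IsProbabilityMeasure Pr] (Φ : Fin n → Ω → H)
    (hm : ∀ i, Measurable (Φ i)) (hind : iIndepFun Φ Pr)
    (hψ : ∀ i (u : H), ‖u‖ ≤ 1 → ∫⁻ ω, ENNReal.ofReal (Real.exp (|inner ℝ (Φ i ω) u| / 4)) ∂Pr ≤ 3)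
    (L : ℝ) :
    Pr {ω | ∃ σ : Fin n → SignType, L * suppCard (fun k => (σ k : ℝ)) <
      ∑ k with (σ k : ℝ) ≠ 0, prefixPairing (fun k => (σ k : ℝ)) (fun i => Φ i ω) k} ≤
      ENNReal.ofReal (Real.exp (6 * Real.exp (-L / 4) * n) - 1) := by
  classical
  have hsub : {ω | ∃ σ : Fin n → SignType, L * suppCard (fun k => (σ k : ℝ)) <
      ∑ k with (σ k : ℝ) ≠ 0, prefixPairing (fun k => (σ k : ℝ)) (fun i => Φ i ω) k} ⊆
      ⋃ σ ∈ (Finset.univ.erase (0 : Fin n → SignType)), {ω | L * suppCard (fun k => (σ k : ℝ)) ≤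
      ∑ k with (σ k : ℝ) ≠ 0, prefixPairing (fun k => (σ k : ℝ)) (fun i => Φ i ω) k} := by
    rintro ω ⟨σ, hσ⟩
    simp only [Set.mem_iUnion]
    refine ⟨σ, ?_, hσ.le⟩
    -- The strict inequality excludes σ = 0, where both sides vanish. This is what produces the -1
    -- in the bound.
    simp only [Finset.mem_erase, Finset.mem_univ, and_true]
    rintro rfl
    simp [suppCard] at hσ
  refine (measure_mono hsub).trans ((measure_biUnion_finset_le _ _).trans ?_)
  refine (Finset.sum_le_sum fun σ _ =>
    measure_pairings_ge_le (Pr := Pr) (fun k => (σ k : ℝ)) Φ hm hind hψ L).trans ?_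
  rw [← ENNReal.ofReal_sum_of_nonneg (fun _ _ => by positivity)]
  apply ENNReal.ofReal_le_ofReal
  have h := sum_pow_suppCard (n := n) (3 * Real.exp (-L / 4))
  rw [← Finset.add_sum_erase _ _ (Finset.mem_univ (0 : Fin n → SignType))] at h
  have h0 : suppCard (fun k => (((0 : Fin n → SignType) k : SignType) : ℝ)) = 0 := by
    simp [suppCard]
  rw [h0, pow_zero] at h
  have h1 : (1 + 2 * (3 * Real.exp (-L / 4))) ^ n ≤ Real.exp (6 * Real.exp (-L / 4) * n) := by
    rw [mul_comm _ (n : ℝ), Real.exp_nat_mul]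
    gcongr
    have := Real.add_one_le_exp (6 * Real.exp (-L / 4))
    linarith
  linarith

end Chain

/-! ### Scalar subexponential variables: moments, truncation and concentration -/

section Subexponential

variable {Ω : Type*} [MeasurableSpace Ω] {Pr : Measure Ω} [IsProbabilityMeasure Pr] {Y : Ω → ℝ}

omit [IsProbabilityMeasure Pr] in
lemma integrable_exp_of_lintegral_le (hY : Measurable Y)
    (h : ∫⁻ ω, ENNReal.ofReal (Real.exp (|Y ω| / 4)) ∂Pr ≤ 3) :
    Integrable (fun ω => Real.exp (|Y ω| / 4)) Pr := by
  refine ⟨by fun_prop, ?_⟩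
  rw [hasFiniteIntegral_iff_ofReal (Filter.Eventually.of_forall fun ω => (Real.exp_pos _).le)]
  exact h.trans_lt (by norm_num)

omit [IsProbabilityMeasure Pr] in
lemma integral_exp_le (hY : Measurable Y)
    (h : ∫⁻ ω, ENNReal.ofReal (Real.exp (|Y ω| / 4)) ∂Pr ≤ 3) :
    ∫ ω, Real.exp (|Y ω| / 4) ∂Pr ≤ 3 := by
  rw [integral_eq_lintegral_of_nonneg_ae (Filter.Eventually.of_forall fun ω => (Real.exp_pos _).le)
    (by fun_prop)]
  exact ENNReal.toReal_le_of_le_ofReal (by norm_num) (by simpa using h)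

omit [IsProbabilityMeasure Pr] in
lemma measure_abs_ge_le (hY : Measurable Y)
    (h : ∫⁻ ω, ENNReal.ofReal (Real.exp (|Y ω| / 4)) ∂Pr ≤ 3) (t : ℝ) :
    Pr {ω | t ≤ |Y ω|} ≤ ENNReal.ofReal (3 * Real.exp (-t / 4)) := by
  have hmk := mul_meas_ge_le_lintegral (μ := Pr)
    (f := fun ω => ENNReal.ofReal (Real.exp (|Y ω| / 4))) (by fun_prop)
    (ENNReal.ofReal (Real.exp (t / 4)))
  have hsub : {ω | t ≤ |Y ω|} ⊆ {ω | ENNReal.ofReal (Real.exp (t / 4)) ≤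
      ENNReal.ofReal (Real.exp (|Y ω| / 4))} := by
    intro ω hω
    apply ENNReal.ofReal_le_ofReal
    apply Real.exp_le_exp.2
    exact div_le_div_of_nonneg_right hω (by norm_num)
  refine (measure_mono hsub).trans ?_
  have hpos : ENNReal.ofReal (Real.exp (t / 4)) ≠ 0 := by simp [Real.exp_pos]
  have h4 := (ENNReal.le_div_iff_mul_le (Or.inl hpos) (Or.inl ENNReal.ofReal_ne_top)).2
    ((mul_comm _ _).trans_le (hmk.trans h))
  refine h4.trans (le_of_eq ?_)
  rw [show (3 : ENNReal) = ENNReal.ofReal 3 by simp,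
    ← ENNReal.ofReal_div_of_pos (Real.exp_pos _), div_eq_mul_inv, ← Real.exp_neg]
  congr 3
  ring

lemma abs_le_four_mul_exp (y : ℝ) : |y| ≤ 4 * Real.exp (|y| / 4) := by
  have := Real.add_one_le_exp (|y| / 4)
  linarith

lemma sq_le_mul_exp (y : ℝ) : y ^ 2 ≤ 128 * Real.exp (|y| / 8) := by
  have h0 : 0 ≤ |y| / 8 := by positivity
  have := Real.quadratic_le_exp_of_nonneg h0
  have h2 : y ^ 2 = |y| ^ 2 := (sq_abs y).symm
  rw [h2]
  nlinarith [abs_nonneg y]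

lemma exp_div_eight_le (y : ℝ) : Real.exp (|y| / 8) ≤ Real.exp (|y| / 4) := by
  apply Real.exp_le_exp.2
  have := abs_nonneg y
  linarith

omit [IsProbabilityMeasure Pr] in
lemma integrable_of_lintegral_exp_le (hY : Measurable Y)
    (h : ∫⁻ ω, ENNReal.ofReal (Real.exp (|Y ω| / 4)) ∂Pr ≤ 3) : Integrable Y Pr := by
  refine ((integrable_exp_of_lintegral_le hY h).const_mul 4).mono' (by fun_prop) ?_
  exact Filter.Eventually.of_forall fun ω => abs_le_four_mul_exp _

omit [IsProbabilityMeasure Pr] in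
lemma integrable_sq_of_lintegral_exp_le (hY : Measurable Y)
    (h : ∫⁻ ω, ENNReal.ofReal (Real.exp (|Y ω| / 4)) ∂Pr ≤ 3) :
    Integrable (fun ω => Y ω ^ 2) Pr := by
  refine ((integrable_exp_of_lintegral_le hY h).const_mul 128).mono' (by fun_prop) ?_
  refine Filter.Eventually.of_forall fun ω => ?_
  rw [Real.norm_eq_abs, abs_of_nonneg (sq_nonneg _)]
  exact (sq_le_mul_exp _).trans (mul_le_mul_of_nonneg_left (exp_div_eight_le _) (by norm_num))

omit [IsProbabilityMeasure Pr] in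
lemma integral_abs_le (hY : Measurable Y)
    (h : ∫⁻ ω, ENNReal.ofReal (Real.exp (|Y ω| / 4)) ∂Pr ≤ 3) : ∫ ω, |Y ω| ∂Pr ≤ 12 := by
  calc ∫ ω, |Y ω| ∂Pr ≤ ∫ ω, 4 * Real.exp (|Y ω| / 4) ∂Pr := by
        apply integral_mono (integrable_of_lintegral_exp_le hY h).abs
          ((integrable_exp_of_lintegral_le hY h).const_mul 4)
        exact fun ω => abs_le_four_mul_exp _
    _ = 4 * ∫ ω, Real.exp (|Y ω| / 4) ∂Pr := integral_const_mul _ _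
    _ ≤ 12 := by linarith [integral_exp_le hY h]

lemma integrable_min_sq (hY : Measurable Y) (T : ℝ) :
    Integrable (fun ω => min (Y ω ^ 2) (T ^ 2)) Pr := by
  apply Integrable.of_mem_Icc 0 (T ^ 2) (by fun_prop)
  exact Filter.Eventually.of_forall fun ω => ⟨by positivity, min_le_right _ _⟩

lemma integral_min_sq_le (hY : Measurable Y)
    (h : ∫⁻ ω, ENNReal.ofReal (Real.exp (|Y ω| / 4)) ∂Pr ≤ 3) (T : ℝ) :
    ∫ ω, min (Y ω ^ 2) (T ^ 2) ∂Pr ≤ ∫ ω, Y ω ^ 2 ∂Pr :=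
  integral_mono (integrable_min_sq hY T) (integrable_sq_of_lintegral_exp_le hY h)
    fun _ => min_le_left _ _

/-- Above `T` one has y² ≤ 128 e^{|y|/8} ≤ 128 e^{-T/8} e^{|y|/4}, and the exponential moment is at
most 3. -/
lemma integral_sq_le_integral_min_sq (hY : Measurable Y)
    (h : ∫⁻ ω, ENNReal.ofReal (Real.exp (|Y ω| / 4)) ∂Pr ≤ 3) (T : ℝ) :
    ∫ ω, Y ω ^ 2 ∂Pr ≤ ∫ ω, min (Y ω ^ 2) (T ^ 2) ∂Pr + 384 * Real.exp (-T / 8) := by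
  have hint := (integrable_exp_of_lintegral_le hY h).const_mul (128 * Real.exp (-T / 8))
  have h1 : ∫ ω, Y ω ^ 2 ∂Pr ≤
      ∫ ω, (min (Y ω ^ 2) (T ^ 2) + 128 * Real.exp (-T / 8) * Real.exp (|Y ω| / 4)) ∂Pr := by
    apply integral_mono (integrable_sq_of_lintegral_exp_le hY h)
      ((integrable_min_sq hY T).add hint)
    intro ω
    simp only [Pi.add_apply]
    rcases le_or_gt |Y ω| T with hle | hgt
    · have : Y ω ^ 2 ≤ T ^ 2 := by
        rw [← sq_abs (Y ω)]
        gcongr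
      rw [min_eq_left this]
      have : 0 ≤ 128 * Real.exp (-T / 8) * Real.exp (|Y ω| / 4) := by positivity
      linarith
    · have h2 : 128 * Real.exp (|Y ω| / 8) ≤
          128 * Real.exp (-T / 8) * Real.exp (|Y ω| / 4) := by
        rw [mul_assoc, ← Real.exp_add]
        gcongr
        linarith
      have h3 : 0 ≤ min (Y ω ^ 2) (T ^ 2) := by positivity
      linarith [sq_le_mul_exp (Y ω)]
  rw [integral_add (integrable_min_sq hY T) hint, integral_const_mul] at h1
  have := mul_le_mul_of_nonneg_left (integral_exp_le hY h)
    (by positivity : 0 ≤ 128 * Real.exp (-T / 8))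
  linarith

lemma exp_le_one_add_add_sq_mul_exp (x : ℝ) :
    Real.exp x ≤ 1 + x + x ^ 2 * Real.exp |x| := by
  have h := Complex.norm_exp_sub_sum_le_norm_mul_exp (x : ℂ) 2
  rw [← Complex.ofReal_exp] at h
  simp only [Finset.sum_range_succ, Finset.sum_range_zero] at h
  have h2 : ((Real.exp x : ℝ) : ℂ) - (0 + (x : ℂ) ^ 0 / ((Nat.factorial 0 : ℕ) : ℂ) +
      (x : ℂ) ^ 1 / ((Nat.factorial 1 : ℕ) : ℂ)) = ((Real.exp x - 1 - x : ℝ) : ℂ) := by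
    push_cast [Nat.factorial]
    ring
  rw [h2, Complex.norm_real, Complex.norm_real, Real.norm_eq_abs, Real.norm_eq_abs, sq_abs] at h
  linarith [le_abs_self (Real.exp x - 1 - x)]

lemma exp_mul_le_of_abs_le {s : ℝ} (hs : |s| ≤ 1 / 8) (y : ℝ) :
    Real.exp (s * y) ≤ 1 + s * y + 128 * s ^ 2 * Real.exp (|y| / 4) := by
  have h1 := exp_le_one_add_add_sq_mul_exp (s * y)
  have h2 : |s * y| ≤ |y| / 8 := by
    rw [abs_mul]
    nlinarith [abs_nonneg y]
  have h3 : (s * y) ^ 2 * Real.exp |s * y| ≤ s ^ 2 * (128 * Real.exp (|y| / 8)) *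
      Real.exp (|y| / 8) := by
    rw [mul_pow]
    gcongr
    exact sq_le_mul_exp y
  have h4 : s ^ 2 * (128 * Real.exp (|y| / 8)) * Real.exp (|y| / 8) =
      128 * s ^ 2 * Real.exp (|y| / 4) := by
    rw [show |y| / 4 = |y| / 8 + |y| / 8 by ring, Real.exp_add]
    ring
  linarith

omit [IsProbabilityMeasure Pr] in
lemma integrable_exp_mul_of_lintegral_exp_le (hY : Measurable Y)
    (h : ∫⁻ ω, ENNReal.ofReal (Real.exp (|Y ω| / 4)) ∂Pr ≤ 3) {s : ℝ} (hs : |s| ≤ 1 / 8) :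
    Integrable (fun ω => Real.exp (s * Y ω)) Pr := by
  refine (integrable_exp_of_lintegral_le hY h).mono' (by fun_prop) ?_
  refine Filter.Eventually.of_forall fun ω => ?_
  rw [Real.norm_eq_abs, Real.abs_exp]
  apply Real.exp_le_exp.2
  have h1 := le_abs_self (s * Y ω)
  rw [abs_mul] at h1
  nlinarith [abs_nonneg (Y ω)]

/-- The linear term of the exponential integrates to zero; the quadratic remainder is dominated by
128 s² e^{|y|/4}. -/
lemma mgf_le_of_lintegral_exp_le (hY : Measurable Y)
    (h : ∫⁻ ω, ENNReal.ofReal (Real.exp (|Y ω| / 4)) ∂Pr ≤ 3) (h0 : ∫ ω, Y ω ∂Pr = 0)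
    {s : ℝ} (hs : |s| ≤ 1 / 8) : mgf Y Pr s ≤ Real.exp (384 * s ^ 2) := by
  have hi := integrable_of_lintegral_exp_le hY h
  have he := (integrable_exp_of_lintegral_le hY h).const_mul (128 * s ^ 2)
  have h1 : mgf Y Pr s ≤ ∫ ω, (1 + s * Y ω + 128 * s ^ 2 * Real.exp (|Y ω| / 4)) ∂Pr := by
    apply integral_mono (integrable_exp_mul_of_lintegral_exp_le hY h hs)
      (((integrable_const 1).add (hi.const_mul s)).add he)
    exact fun ω => exp_mul_le_of_abs_le hs _
  have h2 : ∫ ω, (1 + s * Y ω + 128 * s ^ 2 * Real.exp (|Y ω| / 4)) ∂Pr =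
      1 + 128 * s ^ 2 * ∫ ω, Real.exp (|Y ω| / 4) ∂Pr := by
    have ha : Integrable (fun ω => 1 + s * Y ω) Pr := (integrable_const 1).add (hi.const_mul s)
    rw [integral_add ha he, integral_add (integrable_const 1) (hi.const_mul s), integral_const_mul, integral_const_mul, h0]
    simp
  have h3 := mul_le_mul_of_nonneg_left (integral_exp_le hY h)
    (by positivity : 0 ≤ 128 * s ^ 2)
  have h4 := Real.add_one_le_exp (384 * s ^ 2)
  linarith

/-- Chernoff's bound with parameter s/768, which minimizes 384 t² - s t. The range s ≤ 96 is exactly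
what keeps the parameter below 1/8. -/
lemma measure_sum_ge_le_of_lintegral_exp_le {n : ℕ} {Z : Fin n → Ω → ℝ}
    (hZ : ∀ i, Measurable (Z i)) (hind : iIndepFun Z Pr)
    (h : ∀ i, ∫⁻ ω, ENNReal.ofReal (Real.exp (|Z i ω| / 4)) ∂Pr ≤ 3)
    (h0 : ∀ i, ∫ ω, Z i ω ∂Pr = 0) {s : ℝ} (hs0 : 0 ≤ s) (hs : s ≤ 96) :
    Pr.real {ω | n * s ≤ ∑ i, Z i ω} ≤ Real.exp (-(n * s ^ 2 / 1536)) := by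
  have ht : |s / 768| ≤ 1 / 8 := by
    rw [abs_of_nonneg (by positivity)]
    linarith
  have hsum : (fun ω => ∑ i, Z i ω) = ∑ i, Z i := by
    ext ω
    simp
  have h1 : mgf (∑ i, Z i) Pr (s / 768) ≤ Real.exp (n * (384 * (s / 768) ^ 2)) := by
    rw [hind.mgf_sum hZ, Real.exp_nat_mul]
    calc ∏ i : Fin n, mgf (Z i) Pr (s / 768) ≤ ∏ i : Fin n, Real.exp (384 * (s / 768) ^ 2) := by
          apply Finset.prod_le_prod (fun i _ => mgf_nonneg)
          exact fun i _ => mgf_le_of_lintegral_exp_le (hZ i) (h i) (h0 i) ht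
      _ = _ := by simp
  have hint : Integrable (fun ω => Real.exp (s / 768 * (∑ i, Z i) ω)) Pr := by
    apply hind.integrable_exp_mul_sum hZ
    exact fun i _ => integrable_exp_mul_of_lintegral_exp_le (hZ i) (h i) ht
  have h2 := measure_ge_le_exp_mul_mgf (μ := Pr) (X := ∑ i, Z i) (n * s)
    (by positivity : 0 ≤ s / 768) hint
  have h3 : {ω | n * s ≤ ∑ i, Z i ω} = {ω | n * s ≤ (∑ i, Z i) ω} := by
    simp
  rw [h3]
  refine h2.trans ((mul_le_mul_of_nonneg_left h1 (Real.exp_pos _).le).trans (le_of_eq ?_))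
  rw [← Real.exp_add]
  congr 1
  ring

lemma measure_abs_sum_ge_le_of_lintegral_exp_le {n : ℕ} {Z : Fin n → Ω → ℝ}
    (hZ : ∀ i, Measurable (Z i)) (hind : iIndepFun Z Pr)
    (h : ∀ i, ∫⁻ ω, ENNReal.ofReal (Real.exp (|Z i ω| / 4)) ∂Pr ≤ 3)
    (h0 : ∀ i, ∫ ω, Z i ω ∂Pr = 0) {s : ℝ} (hs0 : 0 ≤ s) (hs : s ≤ 96) :
    Pr.real {ω | n * s ≤ |∑ i, Z i ω|} ≤ 2 * Real.exp (-(n * s ^ 2 / 1536)) := by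
  have h1 := measure_sum_ge_le_of_lintegral_exp_le hZ hind h h0 hs0 hs
  have h2 := measure_sum_ge_le_of_lintegral_exp_le (Z := fun i ω => -Z i ω) (fun i => (hZ i).neg)
    (hind.comp (fun _ x => -x) fun _ => measurable_neg) (by simpa using h)
    (by simpa [integral_neg] using h0) hs0 hs
  have hsub : {ω | n * s ≤ |∑ i, Z i ω|} ⊆
      {ω | n * s ≤ ∑ i, Z i ω} ∪ {ω | n * s ≤ ∑ i, -Z i ω} := by
    intro ω hω
    rcases le_abs.1 (show n * s ≤ |∑ i, Z i ω| from hω) with h | h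
    · exact Or.inl h
    · exact Or.inr (by simpa using h)
  have := (measureReal_mono (μ := Pr) hsub).trans (measureReal_union_le _ _)
  linarith

/-- Hoeffding's inequality for variables in [0, T²]; the fourth power of the truncation level enters
here. -/
lemma measure_abs_sum_min_sq_ge_le {n : ℕ} {Z : Fin n → Ω → ℝ}
    (hZ : ∀ i, Measurable (Z i)) (hind : iIndepFun Z Pr) {T t : ℝ} (ht : 0 ≤ t) :
    Pr.real {ω | n * t ≤ |∑ i, (min (Z i ω ^ 2) (T ^ 2) - ∫ ω', min (Z i ω' ^ 2) (T ^ 2) ∂Pr)|} ≤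
      2 * Real.exp (-(2 * n * t ^ 2 / T ^ 4)) := by
  have hm : ∀ i, Measurable fun ω => min (Z i ω ^ 2) (T ^ 2) := fun i => by fun_prop
  have hI : iIndepFun (fun i ω => min (Z i ω ^ 2) (T ^ 2) - ∫ ω', min (Z i ω' ^ 2) (T ^ 2) ∂Pr) Pr :=
    hind.comp (fun i z => min (z ^ 2) (T ^ 2) - ∫ ω', min (Z i ω' ^ 2) (T ^ 2) ∂Pr)
      fun i => by fun_prop
  have hg : ∀ i, HasSubgaussianMGF
      (fun ω => min (Z i ω ^ 2) (T ^ 2) - ∫ ω', min (Z i ω' ^ 2) (T ^ 2) ∂Pr)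
      ((‖T ^ 2 - 0‖₊ / 2) ^ 2) Pr := fun i =>
    hasSubgaussianMGF_of_mem_Icc (hm i).aemeasurable
      (Filter.Eventually.of_forall fun ω => ⟨by positivity, min_le_right _ _⟩)
  have hexp : Real.exp (-(n * t) ^ 2 / (2 * ((∑ i : Fin n, (‖T ^ 2 - 0‖₊ / 2) ^ 2 : NNReal) : ℝ))) =
      Real.exp (-(2 * n * t ^ 2 / T ^ 4)) := by
    congr 1
    simp only [sub_zero, Finset.sum_const, Finset.card_univ, Fintype.card_fin, nsmul_eq_mul]
    push_cast
    rw [Real.norm_eq_abs, abs_of_nonneg (by positivity)]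
    rcases Nat.eq_zero_or_pos n with h0 | h0
    · simp [h0]
    rcases eq_or_ne T 0 with hT | hT
    · simp [hT]
    have : (n : ℝ) ≠ 0 := by positivity
    field_simp
  have h1 := HasSubgaussianMGF.measure_sum_ge_le_of_iIndepFun hI (s := Finset.univ)
    (fun i _ => hg i) (by positivity : 0 ≤ n * t)
  have h2 := HasSubgaussianMGF.measure_sum_ge_le_of_iIndepFun
    (hI.comp (fun _ x => -x) fun _ => measurable_neg) (s := Finset.univ)
    (fun i _ => (hg i).neg) (by positivity : 0 ≤ n * t)
  rw [hexp] at h1 h2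
  have hsub : {ω | n * t ≤ |∑ i, (min (Z i ω ^ 2) (T ^ 2) -
        ∫ ω', min (Z i ω' ^ 2) (T ^ 2) ∂Pr)|} ⊆
      {ω | n * t ≤ ∑ i, (min (Z i ω ^ 2) (T ^ 2) - ∫ ω', min (Z i ω' ^ 2) (T ^ 2) ∂Pr)} ∪
      {ω | n * t ≤ ∑ i, ((fun x => -x) ∘ fun ω => (min (Z i ω ^ 2) (T ^ 2) -
        ∫ ω', min (Z i ω' ^ 2) (T ^ 2) ∂Pr)) ω} := by
    intro ω hω
    rcases le_abs.1 (show n * t ≤ |_| from hω) with h | h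
    · exact Or.inl h
    · right
      simpa using h
  have := (measureReal_mono (μ := Pr) hsub).trans (measureReal_union_le _ _)
  linarith

end Subexponential

/-! ### A cubical grid approximating the unit ball -/

section Grid

variable {ι : Type*} [Fintype ι]

lemma norm_le_sqrt_card_mul (v : EuclideanSpace ℝ ι) {c : ℝ} (hc : 0 ≤ c) (h : ∀ k, |v k| ≤ c) :
    ‖v‖ ≤ √(Fintype.card ι) * c := by
  rw [EuclideanSpace.norm_eq]
  apply Real.sqrt_le_iff.2 ⟨by positivity, ?_⟩
  rw [mul_pow, Real.sq_sqrt (by positivity), ← nsmul_eq_mul, ← Finset.card_univ,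
    ← Finset.sum_const]
  apply Finset.sum_le_sum
  intro k _
  rw [Real.norm_eq_abs]
  gcongr
  exact h k

/-- The points of the grid of mesh `1 / N` in the cube `[-1, 1]^ι`. -/
noncomputable def gridPoint (N : ℕ) (j : ι → Fin (2 * N + 1)) : EuclideanSpace ℝ ι :=
  WithLp.toLp 2 fun k => (((j k : ℕ) : ℝ) - N) / N

/-- Each coordinate is rounded down to a multiple of 1/N. This grid is cruder than a net, but only
the logarithm of its size matters later. -/
lemma exists_gridPoint_near {N : ℕ} (hN : 0 < N) (u : EuclideanSpace ℝ ι) (hu : ‖u‖ ≤ 1) :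
    ∃ j : ι → Fin (2 * N + 1), ‖u - gridPoint N j‖ ≤ √(Fintype.card ι) * (1 / N) := by
  have hN' : (0 : ℝ) < N := by exact_mod_cast hN
  have hk : ∀ k, |u k| ≤ 1 := fun k => (PiLp.norm_apply_le u k).trans hu
  have hf : ∀ k, ⌊N * (u k + 1)⌋₊ < 2 * N + 1 := by
    intro k
    rw [Nat.lt_succ_iff]
    apply Nat.floor_le_of_le
    push_cast
    nlinarith [(abs_le.1 (hk k)).2]
  refine ⟨fun k => ⟨⌊N * (u k + 1)⌋₊, hf k⟩, norm_le_sqrt_card_mul _ (by positivity) ?_⟩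
  intro k
  have h0 : 0 ≤ N * (u k + 1) := by
    have := (abs_le.1 (hk k)).1
    have : 0 ≤ u k + 1 := by linarith
    positivity
  have h1 := Nat.floor_le h0
  have h2 := Nat.lt_floor_add_one (N * (u k + 1))
  simp only [gridPoint, PiLp.sub_apply]
  rw [show u k - ((⌊N * (u k + 1)⌋₊ : ℝ) - N) / N = (N * (u k + 1) - ⌊N * (u k + 1)⌋₊) / N by
    field_simp; ring]
  rw [abs_of_nonneg (div_nonneg (by linarith) hN'.le)]
  gcongr
  linarith

end Grid

/-! ### Subexponential families and truncated second moments over the ball -/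

section Families

/-- The truncated square is the square of min(|x|, T), hence 2T-Lipschitz. This is what lets grid
bounds pass to all directions. -/
lemma abs_min_sq_sub_le {T : ℝ} (hT : 0 ≤ T) (a b : ℝ) :
    |min (a ^ 2) (T ^ 2) - min (b ^ 2) (T ^ 2)| ≤ 2 * T * |a - b| := by
  have h : ∀ x : ℝ, min (x ^ 2) (T ^ 2) = (min |x| T) ^ 2 := by
    intro x
    rw [← sq_abs x]
    rcases le_total |x| T with h | h
    · rw [min_eq_left h, min_eq_left (by gcongr)]
    · rw [min_eq_right h, min_eq_right (by gcongr)]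
  rw [h, h, sq_sub_sq, abs_mul]
  have h1 : |min |a| T - min |b| T| ≤ |a - b| := by
    refine (abs_min_sub_min_le_max _ _ _ _).trans ?_
    simp only [sub_self, abs_zero]
    exact max_le (abs_abs_sub_abs_le_abs_sub a b) (abs_nonneg _)
  have h2 : |min |a| T + min |b| T| ≤ 2 * T := by
    rw [abs_of_nonneg (by positivity)]
    linarith [min_le_right |a| T, min_le_right |b| T]
  gcongr

variable {ι : Type*} [Fintype ι] {n : ℕ} {Ω : Type*} [MeasurableSpace Ω] {Pr : Measure Ω}

/-- An independent centred family of random vectors whose one-dimensional marginals have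
uniformly bounded exponential moments. -/
structure IsSubexpFamily (Φ : Fin n → Ω → EuclideanSpace ℝ ι) (Pr : Measure Ω) : Prop where
  meas : ∀ i, Measurable (Φ i)
  indep : iIndepFun Φ Pr
  exp_le : ∀ i (u : EuclideanSpace ℝ ι), ‖u‖ ≤ 1 →
    ∫⁻ ω, ENNReal.ofReal (Real.exp (|inner ℝ (Φ i ω) u| / 4)) ∂Pr ≤ 3
  mean : ∀ i (u : EuclideanSpace ℝ ι), ∫ ω, inner ℝ (Φ i ω) u ∂Pr = 0

namespace IsSubexpFamily

variable {Φ : Fin n → Ω → EuclideanSpace ℝ ι} (hΦ : IsSubexpFamily Φ Pr)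

include hΦ

lemma meas_inner (i : Fin n) (u : EuclideanSpace ℝ ι) :
    Measurable fun ω => inner ℝ (Φ i ω) u := by
  have := hΦ.meas i
  fun_prop

lemma indep_inner (u : EuclideanSpace ℝ ι) : iIndepFun (fun i ω => inner ℝ (Φ i ω) u) Pr :=
  hΦ.indep.comp (fun _ x => inner ℝ x u) fun _ => by fun_prop

lemma measure_coord_ge_le (t : ℝ) :
    Pr.real {ω | ∃ i, ∃ k, t ≤ |Φ i ω k|} ≤ n * Fintype.card ι * (3 * Real.exp (-t / 4)) := by
  classical
  have h1 : ∀ i k, Pr.real {ω | t ≤ |Φ i ω k|} ≤ 3 * Real.exp (-t / 4) := by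
    intro i k
    have h2 := measure_abs_ge_le (hΦ.meas_inner i (EuclideanSpace.single k 1))
      (hΦ.exp_le i (EuclideanSpace.single k 1) (by simp)) t
    simp only [EuclideanSpace.inner_single_right, conj_trivial, one_mul] at h2
    exact ENNReal.toReal_le_of_le_ofReal (by positivity) h2
  have h3 : {ω | ∃ i, ∃ k, t ≤ |Φ i ω k|} = ⋃ p : Fin n × ι, {ω | t ≤ |Φ p.1 ω p.2|} := by
    ext ω
    simp
  rw [h3]
  refine (measureReal_iUnion_fintype_le _).trans ((Finset.sum_le_sum fun p _ => h1 p.1 p.2).trans ?_)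
  simp [Fintype.card_prod]

variable [IsProbabilityMeasure Pr]

/-- The mean is controlled coordinate by coordinate, a union bound over only D events; later s is
divided by √D to recover the norm. -/
lemma measure_mean_coord_ge_le {s : ℝ} (hs0 : 0 ≤ s) (hs : s ≤ 96) :
    Pr.real {ω | ∃ k, n * s ≤ |∑ i, Φ i ω k|} ≤
      Fintype.card ι * (2 * Real.exp (-(n * s ^ 2 / 1536))) := by
  classical
  have h1 : ∀ k, Pr.real {ω | n * s ≤ |∑ i, Φ i ω k|} ≤
      2 * Real.exp (-(n * s ^ 2 / 1536)) := by
    intro k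
    have h2 := measure_abs_sum_ge_le_of_lintegral_exp_le
      (fun i => hΦ.meas_inner i (EuclideanSpace.single k 1))
      (hΦ.indep_inner (EuclideanSpace.single k 1))
      (fun i => hΦ.exp_le i (EuclideanSpace.single k 1) (by simp))
      (fun i => hΦ.mean i _) hs0 hs
    simpa only [EuclideanSpace.inner_single_right, conj_trivial, one_mul] using h2
  have h3 : {ω | ∃ k, n * s ≤ |∑ i, Φ i ω k|} = ⋃ k, {ω | n * s ≤ |∑ i, Φ i ω k|} := by
    ext ω
    simp
  rw [h3]
  refine (measureReal_iUnion_fintype_le _).trans ((Finset.sum_le_sum fun k _ => h1 k).trans ?_)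
  simp

lemma measure_grid_ge_le (N : ℕ) {T t : ℝ} (ht : 0 ≤ t) :
    Pr.real {ω | ∃ j : ι → Fin (2 * N + 1), n * t ≤
      |∑ i, (min (inner ℝ (Φ i ω) (gridPoint N j) ^ 2) (T ^ 2) -
        ∫ ω', min (inner ℝ (Φ i ω') (gridPoint N j) ^ 2) (T ^ 2) ∂Pr)|} ≤
      (2 * N + 1) ^ Fintype.card ι * (2 * Real.exp (-(2 * n * t ^ 2 / T ^ 4))) := by
  classical
  have h3 : {ω | ∃ j : ι → Fin (2 * N + 1), n * t ≤
      |∑ i, (min (inner ℝ (Φ i ω) (gridPoint N j) ^ 2) (T ^ 2) -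
        ∫ ω', min (inner ℝ (Φ i ω') (gridPoint N j) ^ 2) (T ^ 2) ∂Pr)|} =
      ⋃ j : ι → Fin (2 * N + 1), {ω | n * t ≤
      |∑ i, (min (inner ℝ (Φ i ω) (gridPoint N j) ^ 2) (T ^ 2) -
        ∫ ω', min (inner ℝ (Φ i ω') (gridPoint N j) ^ 2) (T ^ 2) ∂Pr)|} := by
    ext ω
    simp
  rw [h3]
  refine (measureReal_iUnion_fintype_le _).trans ((Finset.sum_le_sum fun j _ =>
    measure_abs_sum_min_sq_ge_le (fun i => hΦ.meas_inner i (gridPoint N j))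
      (hΦ.indep_inner (gridPoint N j)) ht).trans ?_)
  simp

omit [IsProbabilityMeasure Pr] in
lemma integral_abs_inner_le (i : Fin n) (u : EuclideanSpace ℝ ι) :
    ∫ ω, |inner ℝ (Φ i ω) u| ∂Pr ≤ 12 * ‖u‖ := by
  have h := integral_abs_le (hΦ.meas_inner i (‖u‖⁻¹ • u))
    (hΦ.exp_le i _ (norm_inv_smul_self_le_one u))
  simp_rw [real_inner_smul_right, abs_mul, integral_const_mul] at h
  rcases eq_or_ne u 0 with rfl | hu
  · simp
  · have hpos : 0 < ‖u‖ := norm_pos_iff.2 hu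
    rw [abs_of_nonneg (inv_nonneg.2 hpos.le), inv_mul_le_iff₀ hpos] at h
    linarith

omit [IsProbabilityMeasure Pr] in
lemma integrable_inner (i : Fin n) (u : EuclideanSpace ℝ ι) :
    Integrable (fun ω => inner ℝ (Φ i ω) u) Pr := by
  have h := (integrable_of_lintegral_exp_le (hΦ.meas_inner i (‖u‖⁻¹ • u))
    (hΦ.exp_le i _ (norm_inv_smul_self_le_one u))).const_mul ‖u‖
  refine h.congr (Filter.Eventually.of_forall fun ω => ?_)
  rcases eq_or_ne u 0 with rfl | hu
  · simp
  · simp only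
    rw [real_inner_smul_right, ← mul_assoc, mul_inv_cancel₀ (norm_ne_zero_iff.2 hu), one_mul]

lemma abs_integral_min_sq_sub_le {T : ℝ} (hT : 0 ≤ T) (i : Fin n) (u v : EuclideanSpace ℝ ι) :
    |∫ ω, min (inner ℝ (Φ i ω) u ^ 2) (T ^ 2) ∂Pr - ∫ ω, min (inner ℝ (Φ i ω) v ^ 2) (T ^ 2) ∂Pr| ≤
      24 * T * ‖u - v‖ := by
  rw [← integral_sub (integrable_min_sq (hΦ.meas_inner i u) T)
    (integrable_min_sq (hΦ.meas_inner i v) T)]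
  refine abs_integral_le_integral_abs.trans ?_
  have h1 : ∫ ω, |min (inner ℝ (Φ i ω) u ^ 2) (T ^ 2) - min (inner ℝ (Φ i ω) v ^ 2) (T ^ 2)| ∂Pr ≤
      ∫ ω, 2 * T * |inner ℝ (Φ i ω) (u - v)| ∂Pr := by
    apply integral_mono (((integrable_min_sq (hΦ.meas_inner i u) T).sub
      (integrable_min_sq (hΦ.meas_inner i v) T)).abs)
      ((hΦ.integrable_inner i (u - v)).abs.const_mul _)
    intro ω
    simp only [inner_sub_right]
    exact abs_min_sq_sub_le hT _ _
  rw [integral_const_mul] at h1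
  have := mul_le_mul_of_nonneg_left (hΦ.integral_abs_inner_le i (u - v))
    (by positivity : 0 ≤ 2 * T)
  linarith

/-- Concentration of truncated second moments at the grid points extends to the unit ball. -/
lemma abs_sum_min_sq_le {N : ℕ} (hN : 0 < N) {T t R : ℝ} (hT : 0 ≤ T) {ω : Ω}
    (hR : ∀ i, ‖Φ i ω‖ ≤ R)
    (h : ∀ j : ι → Fin (2 * N + 1),
      |∑ i, (min (inner ℝ (Φ i ω) (gridPoint N j) ^ 2) (T ^ 2) -
        ∫ ω', min (inner ℝ (Φ i ω') (gridPoint N j) ^ 2) (T ^ 2) ∂Pr)| ≤ n * t)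
    (u : EuclideanSpace ℝ ι) (hu : ‖u‖ ≤ 1) :
    |∑ i, (min (inner ℝ (Φ i ω) u ^ 2) (T ^ 2) -
        ∫ ω', min (inner ℝ (Φ i ω') u ^ 2) (T ^ 2) ∂Pr)| ≤
      n * (t + (2 * R + 24) * T * (√(Fintype.card ι) * (1 / N))) := by
  obtain ⟨j, hj⟩ := exists_gridPoint_near hN u hu
  set v := gridPoint N j
  set r := √(Fintype.card ι) * (1 / N : ℝ)
  have h1 : ∀ i, |(min (inner ℝ (Φ i ω) u ^ 2) (T ^ 2) -
        ∫ ω', min (inner ℝ (Φ i ω') u ^ 2) (T ^ 2) ∂Pr) - (min (inner ℝ (Φ i ω) v ^ 2) (T ^ 2) -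
        ∫ ω', min (inner ℝ (Φ i ω') v ^ 2) (T ^ 2) ∂Pr)| ≤ (2 * R + 24) * T * r := by
    intro i
    have hRi : 0 ≤ R := (norm_nonneg _).trans (hR i)
    have h2 := abs_min_sq_sub_le hT (inner ℝ (Φ i ω) u) (inner ℝ (Φ i ω) v)
    rw [← inner_sub_right] at h2
    have h3 : |inner ℝ (Φ i ω) (u - v)| ≤ R * r :=
      (abs_real_inner_le_norm _ _).trans (mul_le_mul (hR i) hj (norm_nonneg _) hRi)
    have h4 := hΦ.abs_integral_min_sq_sub_le hT i u v
    have h5 : 24 * T * ‖u - v‖ ≤ 24 * T * r := by gcongr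
    have h6 : 2 * T * |inner ℝ (Φ i ω) (u - v)| ≤ 2 * T * (R * r) := by gcongr
    have h7 := abs_sub (min (inner ℝ (Φ i ω) u ^ 2) (T ^ 2) - min (inner ℝ (Φ i ω) v ^ 2) (T ^ 2))
      (∫ ω, min (inner ℝ (Φ i ω) u ^ 2) (T ^ 2) ∂Pr - ∫ ω, min (inner ℝ (Φ i ω) v ^ 2) (T ^ 2) ∂Pr)
    rw [sub_sub_sub_comm]
    linarith
  have h2 : |∑ i, ((min (inner ℝ (Φ i ω) u ^ 2) (T ^ 2) -
        ∫ ω', min (inner ℝ (Φ i ω') u ^ 2) (T ^ 2) ∂Pr) - (min (inner ℝ (Φ i ω) v ^ 2) (T ^ 2) -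
        ∫ ω', min (inner ℝ (Φ i ω') v ^ 2) (T ^ 2) ∂Pr))| ≤ n * ((2 * R + 24) * T * r) := by
    refine (Finset.abs_sum_le_sum_abs _ _).trans ((Finset.sum_le_sum fun i _ => h1 i).trans ?_)
    simp
  rw [Finset.sum_sub_distrib] at h2
  have h3 := h j
  have h4 := abs_sub_abs_le_abs_sub (∑ i, (min (inner ℝ (Φ i ω) u ^ 2) (T ^ 2) -
        ∫ ω', min (inner ℝ (Φ i ω') u ^ 2) (T ^ 2) ∂Pr)) (∑ i, (min (inner ℝ (Φ i ω) v ^ 2) (T ^ 2) -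
        ∫ ω', min (inner ℝ (Φ i ω') v ^ 2) (T ^ 2) ∂Pr))
  rw [mul_add]
  linarith

end IsSubexpFamily

end Families

/-! ### Good samples occur with high probability -/

section GoodSamples

lemma expect_fin_eq_sum_div {n : ℕ} (f : Fin n → ℝ) : 𝔼 i, f i = (∑ i, f i) / n := by
  rw [Finset.expect_eq_sum_div_card, Finset.card_univ, Fintype.card_fin]

/-- The mean of the sample is small, its second moments are close to `Q`, and small weights
cannot capture a large part of the second moments. -/
structure GoodSample {H : Type*} [NormedAddCommGroup H] [InnerProductSpace ℝ H] {n : ℕ}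
    (φ : Fin n → H) (Q : H → ℝ) (ε : ℝ) : Prop where
  mean : ∀ u, |𝔼 i, inner ℝ (φ i) u| ≤ ε / 4 * ‖u‖
  second : ∀ u, |𝔼 i, inner ℝ (φ i) u ^ 2 - Q u| ≤ 4 * ε * ‖u‖ ^ 2
  removal : ∀ w : Fin n → ℝ, (∀ i, w i ∈ Set.Icc (0 : ℝ) 1) → 𝔼 i, w i ≤ 4 * ε →
    ∀ u, 𝔼 i, w i * inner ℝ (φ i) u ^ 2 ≤ 12600 * (ε * (1 + Real.log (1 / ε)) ^ 2) * ‖u‖ ^ 2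

lemma GoodSample.of_unitBall {H : Type*} [NormedAddCommGroup H] [InnerProductSpace ℝ H] {n : ℕ}
    {φ : Fin n → H} {Q : H → ℝ} {ε : ℝ} (hQ : ∀ (c : ℝ) u, Q (c • u) = c ^ 2 * Q u)
    (mean : ∀ u, ‖u‖ ≤ 1 → |𝔼 i, inner ℝ (φ i) u| ≤ ε / 4)
    (second : ∀ u, ‖u‖ ≤ 1 → |𝔼 i, inner ℝ (φ i) u ^ 2 - Q u| ≤ 4 * ε)
    (removal : ∀ w : Fin n → ℝ, (∀ i, w i ∈ Set.Icc (0 : ℝ) 1) → 𝔼 i, w i ≤ 4 * ε →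
      ∀ u, ‖u‖ ≤ 1 →
        𝔼 i, w i * inner ℝ (φ i) u ^ 2 ≤ 12600 * (ε * (1 + Real.log (1 / ε)) ^ 2)) :
    GoodSample φ Q ε := by
  have hu : ∀ u : H, u = ‖u‖ • (‖u‖⁻¹ • u) := by
    intro u
    rcases eq_or_ne u 0 with rfl | h
    · simp
    · rw [smul_smul, mul_inv_cancel₀ (norm_ne_zero_iff.2 h), one_smul]
  have hin : ∀ u x : H, inner ℝ x u = ‖u‖ * inner ℝ x (‖u‖⁻¹ • u) := by
    intro u x
    conv_lhs => rw [hu u, real_inner_smul_right]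
  refine ⟨fun u => ?_, fun u => ?_, fun w hw hwε u => ?_⟩
  · have h := mean _ (norm_inv_smul_self_le_one u)
    simp_rw [hin u]
    rw [← Finset.mul_expect, abs_mul, abs_of_nonneg (norm_nonneg _), mul_comm]
    gcongr
  · have h := second _ (norm_inv_smul_self_le_one u)
    have hQu : Q u = ‖u‖ ^ 2 * Q (‖u‖⁻¹ • u) := by
      conv_lhs => rw [hu u, hQ]
    simp_rw [hin u, mul_pow]
    rw [← Finset.mul_expect, hQu, ← mul_sub, abs_mul, abs_of_nonneg (sq_nonneg _), mul_comm]
    gcongr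
  · have h := removal w hw hwε _ (norm_inv_smul_self_le_one u)
    simp_rw [hin u, mul_pow, mul_left_comm (w _)]
    rw [← Finset.mul_expect, mul_comm]
    gcongr

variable {ι : Type*} [Fintype ι] {n : ℕ} {Ω : Type*} [MeasurableSpace Ω] {Pr : Measure Ω}

/-- The deterministic core: truncated second moments at two levels, few large values, and a small
mean make a good sample. -/
lemma goodSample_of_truncated {φ : Fin n → EuclideanSpace ℝ ι} {Q : EuclideanSpace ℝ ι → ℝ}
    {ε T₁ T₂ : ℝ} (hn : 0 < n) (hε0 : 0 < ε) (hε1 : ε < 1)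
    (hQ : ∀ (c : ℝ) u, Q (c • u) = c ^ 2 * Q u)
    (hT₁ : T₁ = 56 * (1 + Real.log (1 / ε)))
    (mean : ∀ u, ‖u‖ ≤ 1 → |𝔼 i, inner ℝ (φ i) u| ≤ ε / 4)
    (h₁ : ∀ u, ‖u‖ ≤ 1 → Q u - 2 * ε ≤ 𝔼 i, min (inner ℝ (φ i) u ^ 2) (T₁ ^ 2))
    (h₂ : ∀ u, ‖u‖ ≤ 1 → 𝔼 i, min (inner ℝ (φ i) u ^ 2) (T₂ ^ 2) ≤ Q u + 2 * ε)
    (hlarge : ∀ u, ‖u‖ ≤ 1 → ∑ i with T₂ < |inner ℝ (φ i) u|, inner ℝ (φ i) u ^ 2 ≤ n * ε) :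
    GoodSample φ Q ε := by
  have hn' : (0 : ℝ) < n := by exact_mod_cast hn
  have hup : ∀ u, ‖u‖ ≤ 1 → 𝔼 i, inner ℝ (φ i) u ^ 2 ≤ Q u + 3 * ε := by
    intro u hu
    -- Values up to T₂ agree with their truncation; larger ones are paid for by the bound on large
    -- values.
    have h3 : ∑ i, inner ℝ (φ i) u ^ 2 ≤ ∑ i, min (inner ℝ (φ i) u ^ 2) (T₂ ^ 2) +
        ∑ i with T₂ < |inner ℝ (φ i) u|, inner ℝ (φ i) u ^ 2 := by
      rw [Finset.sum_filter, ← Finset.sum_add_distrib]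
      apply Finset.sum_le_sum
      intro i _
      split_ifs with h
      · have : 0 ≤ min (inner ℝ (φ i) u ^ 2) (T₂ ^ 2) := by positivity
        linarith
      · push Not at h
        have : inner ℝ (φ i) u ^ 2 ≤ T₂ ^ 2 := by
          rw [← sq_abs (inner ℝ (φ i) u)]
          gcongr
        rw [min_eq_left this, add_zero]
    have h4 := h₂ u hu
    have h5 := hlarge u hu
    rw [expect_fin_eq_sum_div] at h4 ⊢
    rw [div_le_iff₀ hn'] at h4 ⊢
    nlinarith
  have hlow : ∀ u, ‖u‖ ≤ 1 → Q u - 2 * ε ≤ 𝔼 i, inner ℝ (φ i) u ^ 2 := fun u hu =>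
    (h₁ u hu).trans (Finset.expect_le_expect fun i _ => min_le_left _ _)
  refine GoodSample.of_unitBall hQ mean (fun u hu => ?_) fun w hw hwε u hu => ?_
  · have h3 := hup u hu
    have h4 := hlow u hu
    rw [abs_le]
    constructor <;> linarith
  -- As w ≤ 1, w x² is at most w T₁² plus the excess over the truncation. The first averages to at
  -- most 4ε T₁². The excess averages to at most 5ε, by comparing the upper bound Q + 3ε with the
  -- truncated lower bound Q - 2ε. Finally 4 · 56² + 5 ≤ 12600.
  · have h3 : 𝔼 i, w i * inner ℝ (φ i) u ^ 2 ≤ 𝔼 i, (w i * T₁ ^ 2 + (inner ℝ (φ i) u ^ 2 -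
        min (inner ℝ (φ i) u ^ 2) (T₁ ^ 2))) := by
      apply Finset.expect_le_expect
      intro i _
      obtain ⟨hw0, hw1⟩ := hw i
      rcases le_total (inner ℝ (φ i) u ^ 2) (T₁ ^ 2) with h | h
      · rw [min_eq_left h]
        nlinarith
      · rw [min_eq_right h]
        nlinarith
    rw [Finset.expect_add_distrib, Finset.expect_sub_distrib, ← Finset.expect_mul] at h3
    have h4 := hup u hu
    have h5 := h₁ u hu
    have h6 := mul_le_mul_of_nonneg_right hwε (sq_nonneg T₁)
    have hlog : 0 ≤ Real.log (1 / ε) := Real.log_nonneg (by rw [le_div_iff₀ hε0]; linarith)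
    set lam := 1 + Real.log (1 / ε) with hlam
    have h7 : 1 ≤ lam ^ 2 := by nlinarith
    have h8 : ε ≤ ε * lam ^ 2 := by nlinarith
    have hT2 : T₁ ^ 2 = 3136 * lam ^ 2 := by
      rw [hT₁]
      ring
    rw [hT2] at h3 h6
    rw [hT2] at h5
    nlinarith

namespace IsSubexpFamily

variable {Φ : Fin n → Ω → EuclideanSpace ℝ ι} (hΦ : IsSubexpFamily Φ Pr)
  [IsProbabilityMeasure Pr]

include hΦ

/-- The grid of mesh 1/n has at most e^{2Dl} points, while the Hoeffding exponent is at least 5Dl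
because T⁴ ≤ (56 l)⁴. The constant 10⁸ is chosen so that 5 · 56⁴ ≤ 10⁸/2. -/
lemma measureReal_grid_le {T ε δ l : ℝ} (hn : 0 < n) (hD : 0 < Fintype.card ι) (hε0 : 0 < ε)
    (hδ0 : 0 < δ) (hδ1 : δ < 1)
    (hl : l = 1 + Real.log n + Real.log (1 / δ)) (hsize : 10 ^ 8 * Fintype.card ι * l ^ 5 ≤ n * ε ^ 2)
    (hT0 : 0 < T) (hT : T ≤ 56 * l) :
    Pr.real {ω | ∃ j : ι → Fin (2 * n + 1), n * (ε / 2) ≤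
      |∑ i, (min (inner ℝ (Φ i ω) (gridPoint n j) ^ 2) (T ^ 2) -
        ∫ ω', min (inner ℝ (Φ i ω') (gridPoint n j) ^ 2) (T ^ 2) ∂Pr)|} ≤ δ := by
  refine (hΦ.measure_grid_ge_le n (by positivity)).trans ?_
  have hn' : (1 : ℝ) ≤ n := by exact_mod_cast hn
  have hD' : (1 : ℝ) ≤ Fintype.card ι := by exact_mod_cast hD
  set D : ℝ := (Fintype.card ι : ℝ) with hDdef
  have hl0 : 0 < l := by linarith
  have hlog : 0 ≤ Real.log n := Real.log_nonneg hn'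
  have hlogδ : 0 ≤ Real.log (1 / δ) := Real.log_nonneg (by rw [le_div_iff₀ hδ0]; linarith)
  have hl1 : 1 ≤ l := by linarith
  have hexpl : Real.exp l = Real.exp 1 * n / δ := by
    rw [hl, Real.exp_add, Real.exp_add, Real.exp_log (by linarith), Real.exp_log (by positivity)]
    ring
  have he : (2 : ℝ) ≤ Real.exp 1 := by
    have := Real.add_one_le_exp (1 : ℝ)
    linarith
  have hexpl2 : 2 * n / δ ≤ Real.exp l := by
    rw [hexpl]
    gcongr
  have hexpn : 2 * n ≤ Real.exp l := by
    refine le_trans ?_ hexpl2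
    rw [le_div_iff₀ hδ0]
    nlinarith
  have h1 : (2 * n + 1 : ℝ) ≤ Real.exp (2 * l) := by
    rw [two_mul l, Real.exp_add]
    nlinarith
  have h2 : (2 * n + 1 : ℝ) ^ Fintype.card ι ≤ Real.exp (2 * D * l) := by
    calc (2 * n + 1 : ℝ) ^ Fintype.card ι ≤ Real.exp (2 * l) ^ Fintype.card ι := by gcongr
      _ = Real.exp (2 * D * l) := by
        rw [← Real.exp_nat_mul]
        congr 1
        ring
  have hT4 : T ^ 4 ≤ (56 * l) ^ 4 := by gcongr
  have h3 : 5 * D * l ≤ 2 * n * (ε / 2) ^ 2 / T ^ 4 := by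
    rw [le_div_iff₀ (by positivity)]
    calc 5 * D * l * T ^ 4 ≤ 5 * D * l * (56 * l) ^ 4 := by gcongr
      _ = (5 * 56 ^ 4) * (D * l ^ 5) := by ring
      _ ≤ 10 ^ 8 / 2 * (D * l ^ 5) := by
        gcongr
        norm_num
      _ ≤ 2 * n * (ε / 2) ^ 2 := by linarith
  have h4 : Real.exp (-l) ≤ δ / 2 := by
    rw [Real.exp_neg, inv_le_comm₀ (Real.exp_pos _) (by positivity), inv_div]
    refine le_trans ?_ hexpl2
    gcongr
    linarith
  calc (2 * n + 1 : ℝ) ^ Fintype.card ι * (2 * Real.exp (-(2 * n * (ε / 2) ^ 2 / T ^ 4)))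
      ≤ Real.exp (2 * D * l) * (2 * Real.exp (-(5 * D * l))) := by gcongr
    _ = 2 * Real.exp (-(3 * D * l)) := by
      rw [mul_left_comm, ← Real.exp_add]
      congr 2
      ring
    _ ≤ 2 * Real.exp (-l) := by
      gcongr
      nlinarith
    _ ≤ δ := by linarith

set_option maxHeartbeats 1000000 in
/-- With high probability a sub-exponential family is a good sample. -/
theorem measureReal_not_goodSample_le {Q : EuclideanSpace ℝ ι → ℝ} {ε δ : ℝ}
    (hQ : ∀ i u, ∫ ω, inner ℝ (Φ i ω) u ^ 2 ∂Pr = Q u) (hD : 0 < Fintype.card ι)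
    (hε0 : 0 < ε) (hε1 : ε < 1) (hδ0 : 0 < δ) (hδ1 : δ < 1)
    (hsize : 10 ^ 8 * Fintype.card ι * (1 + Real.log n + Real.log (1 / δ)) ^ 5 ≤ n * ε ^ 2) :
    Pr.real {ω | ¬ GoodSample (fun i => Φ i ω) Q ε} ≤ 5 * δ := by
  obtain ⟨l, hl⟩ : ∃ l, l = 1 + Real.log n + Real.log (1 / δ) := ⟨_, rfl⟩
  rw [← hl] at hsize
  have hD' : (1 : ℝ) ≤ Fintype.card ι := by exact_mod_cast hD
  have hlog : 0 ≤ Real.log n := Real.log_natCast_nonneg n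
  have hlogδ : 0 ≤ Real.log (1 / δ) := Real.log_nonneg (by rw [le_div_iff₀ hδ0]; linarith)
  have hl1 : 1 ≤ l := by linarith
  have hl5 : 1 ≤ l ^ 5 := one_le_pow₀ hl1
  have hn : 0 < n := by
    rcases Nat.eq_zero_or_pos n with h0 | h0
    · rw [h0] at hsize
      have : 0 < 10 ^ 8 * (Fintype.card ι : ℝ) * l ^ 5 := by positivity
      simp at hsize
      linarith
    · exact h0
  have hn' : (1 : ℝ) ≤ n := by exact_mod_cast hn
  have hn0 : (0 : ℝ) < n := by linarith
  have hgrid₁ := fun (T : ℝ) => hΦ.measureReal_grid_le (T := T) hn hD hε0 hδ0 hδ1 hl hsize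
  have hgridu := fun (T : ℝ) (hT : 0 ≤ T) (R : ℝ) (ω : Ω) (hR : ∀ i, ‖Φ i ω‖ ≤ R) =>
    hΦ.abs_sum_min_sq_le hn hT (t := ε / 2) hR
  set D : ℝ := (Fintype.card ι : ℝ) with hDdef
  have hexpl : Real.exp l = Real.exp 1 * n / δ := by
    rw [hl, Real.exp_add, Real.exp_add, Real.exp_log (by linarith), Real.exp_log (by positivity)]
    ring
  have he : (2.7 : ℝ) ≤ Real.exp 1 := by
    have := Real.exp_one_gt_d9
    linarith
  -- Exactly n e^{-l} = δ/e; the summand 1 in l supplies the spare factor used by the union bounds.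
  have hE : n * Real.exp (-l) ≤ δ / 2 := by
    rw [Real.exp_neg, hexpl, inv_div, mul_div_assoc', div_le_iff₀ (by positivity)]
    have : 0 < n * δ := by positivity
    nlinarith
  have hE0 : 0 < Real.exp (-l) := Real.exp_pos _
  have hε2 : ε ^ 2 ≤ ε := by nlinarith
  have hnε : 10 ^ 8 * D * l ^ 5 ≤ n * ε := hsize.trans (by gcongr)
  have hDn : D ≤ n := by nlinarith
  obtain ⟨lam, hlam⟩ : ∃ lam, lam = 1 + Real.log (1 / ε) := ⟨_, rfl⟩
  have hlogε : 0 ≤ Real.log (1 / ε) := Real.log_nonneg (by rw [le_div_iff₀ hε0]; linarith)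
  have hlaml : lam ≤ l := by
    have : Real.log (1 / ε) ≤ Real.log n := by
      apply Real.log_le_log (by positivity)
      rw [div_le_iff₀ hε0]
      nlinarith
    linarith
  have hlam1 : 1 ≤ lam := by linarith
  -- The norm bound that holds when every coordinate of every vector is at most 8l.
  set R := √D * (8 * l) with hRdef
  have hsD : √D ^ 2 = D := Real.sq_sqrt (by positivity)
  have hsD1 : 1 ≤ √D := Real.one_le_sqrt.2 hD'
  -- A mean deviation of s in each coordinate amounts to ε/4 in norm.
  set s := ε / (4 * √D) with hs
  -- the exceptional events
  set B₁ : Set Ω := {ω | ∃ i, ∃ k, 8 * l ≤ |Φ i ω k|} with hB₁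
  set B₂ : Set Ω := {ω | ∃ σ : Fin n → SignType, 14 * l * suppCard (fun k => (σ k : ℝ)) <
      ∑ k with (σ k : ℝ) ≠ 0, prefixPairing (fun k => (σ k : ℝ)) (fun i => Φ i ω) k} with hB₂
  set B₃ : ℝ → Set Ω := fun T => {ω | ∃ j : ι → Fin (2 * n + 1), n * (ε / 2) ≤
      |∑ i, (min (inner ℝ (Φ i ω) (gridPoint n j) ^ 2) (T ^ 2) -
        ∫ ω', min (inner ℝ (Φ i ω') (gridPoint n j) ^ 2) (T ^ 2) ∂Pr)|} with hB₃
  set B₅ : Set Ω := {ω | ∃ k, n * s ≤ |∑ i, Φ i ω k|} with hB₅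
  have hP₁ : Pr.real B₁ ≤ δ := by
    refine (hΦ.measure_coord_ge_le (8 * l)).trans ?_
    have : Real.exp (-(8 * l) / 4) = Real.exp (-l) * Real.exp (-l) := by
      rw [← Real.exp_add]
      congr 1
      ring
    rw [this]
    calc n * D * (3 * (Real.exp (-l) * Real.exp (-l)))
        ≤ n * n * (3 * (Real.exp (-l) * Real.exp (-l))) := by gcongr
      _ = 3 * (n * Real.exp (-l)) ^ 2 := by ring
      _ ≤ 3 * (δ / 2) ^ 2 := by gcongr
      _ ≤ δ := by nlinarith
  have hP₂ : Pr.real B₂ ≤ δ := by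
    have h := measure_exists_pairings_ge_le (Pr := Pr) Φ hΦ.meas hΦ.indep hΦ.exp_le (14 * l)
    refine ENNReal.toReal_le_of_le_ofReal hδ0.le (h.trans (ENNReal.ofReal_le_ofReal ?_))
    have h1 : Real.exp (-(14 * l) / 4) ≤ 1 / 7 * Real.exp (-l) := by
      have h2 : Real.exp (-(14 * l) / 4) ≤ Real.exp (-2) * Real.exp (-l) := by
        rw [← Real.exp_add]
        apply Real.exp_le_exp.2
        linarith
      have h3 : Real.exp (-2) ≤ 1 / 7 := by
        rw [Real.exp_neg, inv_le_comm₀ (Real.exp_pos _) (by norm_num)]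
        have : Real.exp 2 = Real.exp 1 ^ 2 := by
          rw [← Real.exp_nat_mul]
          norm_num
        rw [this]
        have : (2.7 : ℝ) ^ 2 ≤ Real.exp 1 ^ 2 := by gcongr
        norm_num at this ⊢
        linarith
      exact h2.trans (by gcongr)
    have h4 : 6 * Real.exp (-(14 * l) / 4) * n ≤ 3 / 7 * δ := by
      have := mul_le_mul_of_nonneg_right h1 hn0.le
      linarith
    have h5 : 0 ≤ 6 * Real.exp (-(14 * l) / 4) * n := by positivity
    have h6 := Real.abs_exp_sub_one_sub_id_le (x := 6 * Real.exp (-(14 * l) / 4) * n)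
      (by rw [abs_of_nonneg h5]; linarith)
    have h7 := (abs_le.1 h6).2
    have h8 : (6 * Real.exp (-(14 * l) / 4) * n) ^ 2 ≤ (3 / 7 * δ) ^ 2 := by gcongr
    have h9 : (3 / 7 * δ) ^ 2 ≤ 3 / 7 * δ := by nlinarith
    linarith
  have hP₃ : Pr.real (B₃ (56 * lam)) ≤ δ := hgrid₁ _ (by linarith) (by linarith)
  have hP₄ : Pr.real (B₃ (56 * l)) ≤ δ := hgrid₁ _ (by linarith) le_rfl
  have hs0 : 0 ≤ s := by positivity
  have hP₅ : Pr.real B₅ ≤ δ := by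
    have hs96 : s ≤ 96 := by
      rw [hs, div_le_iff₀ (by positivity)]
      linarith
    refine (hΦ.measure_mean_coord_ge_le hs0 hs96).trans ?_
    have h1 : 2 * l ≤ n * s ^ 2 / 1536 := by
      have : n * s ^ 2 = n * ε ^ 2 / (16 * D) := by
        rw [hs, div_pow, mul_pow, hsD]
        ring
      rw [this, div_div, le_div_iff₀ (by positivity)]
      have : D * l ≤ D * l ^ 5 := by
        gcongr
        exact le_self_pow₀ hl1 (by norm_num)
      have : 0 ≤ D * l ^ 5 := by positivity
      linarith
    calc D * (2 * Real.exp (-(n * s ^ 2 / 1536))) ≤ n * (2 * Real.exp (-(2 * l))) := by gcongr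
      _ = 2 * (n * Real.exp (-l)) * Real.exp (-l) := by
        rw [show -(2 * l) = -l + -l by ring, Real.exp_add]
        ring
      _ ≤ 2 * (δ / 2) * 1 := by
        gcongr
        exact Real.exp_le_one_iff.2 (by linarith)
      _ = δ := by ring
  have hQs : ∀ (c : ℝ) u, Q (c • u) = c ^ 2 * Q u := by
    intro c u
    rw [← hQ ⟨0, hn⟩, ← hQ ⟨0, hn⟩, ← integral_const_mul]
    simp_rw [real_inner_smul_right, mul_pow]
  have hint : ∀ (u : EuclideanSpace ℝ ι), ‖u‖ ≤ 1 → ∀ T i,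
      ∫ ω, min (inner ℝ (Φ i ω) u ^ 2) (T ^ 2) ∂Pr ≤ Q u := by
    intro u hu T i
    rw [← hQ i u]
    exact integral_min_sq_le (hΦ.meas_inner i u) (hΦ.exp_le i u hu) T
  have hint' : ∀ (u : EuclideanSpace ℝ ι), ‖u‖ ≤ 1 → ∀ i,
      Q u - ε ≤ ∫ ω, min (inner ℝ (Φ i ω) u ^ 2) ((56 * lam) ^ 2) ∂Pr := by
    intro u hu i
    have h1 := integral_sq_le_integral_min_sq (hΦ.meas_inner i u) (hΦ.exp_le i u hu) (56 * lam)
    rw [hQ i u] at h1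
    -- Since 56/8 = 7, the tail lost by truncation is 384 e^{-7} ε⁷, below ε.
    have h2 : Real.exp (-(56 * lam) / 8) = (Real.exp 1)⁻¹ ^ 7 * ε ^ 7 := by
      have : -(56 * lam) / 8 = ((7 : ℕ) : ℝ) * -(1 + Real.log (1 / ε)) := by
        rw [hlam]
        push_cast
        ring
      rw [this, Real.exp_nat_mul, ← mul_pow, Real.exp_neg, Real.exp_add,
        Real.exp_log (by positivity)]
      congr 1
      field_simp
    have h3 : (Real.exp 1)⁻¹ ^ 7 ≤ (2.7 : ℝ)⁻¹ ^ 7 := by gcongr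
    have h4 : ε ^ 7 ≤ ε := pow_le_of_le_one hε0.le hε1.le (by norm_num)
    have h5 : (Real.exp 1)⁻¹ ^ 7 * ε ^ 7 ≤ (2.7 : ℝ)⁻¹ ^ 7 * ε := by gcongr
    have h6 : 384 * ((2.7 : ℝ)⁻¹ ^ 7 * ε) ≤ ε := by
      rw [← mul_assoc]
      exact mul_le_of_le_one_left hε0.le (by norm_num)
    linarith
  have hsub : {ω | ¬ GoodSample (fun i => Φ i ω) Q ε} ⊆
      B₁ ∪ (B₂ ∪ (B₃ (56 * lam) ∪ (B₃ (56 * l) ∪ B₅))) := by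
    intro ω hω
    by_contra hc
    simp only [Set.mem_union, not_or] at hc
    obtain ⟨h₁, h₂, h₃, h₄, h₅⟩ := hc
    simp only [hB₁, hB₂, hB₃, hB₅, Set.mem_ofPred_eq, not_exists, not_le, not_lt] at h₁ h₂ h₃ h₄ h₅
    apply hω
    have hR : ∀ i, ‖Φ i ω‖ ≤ R := fun i =>
      norm_le_sqrt_card_mul _ (by positivity) fun k => (h₁ i k).le
    have herr : ∀ T, 0 ≤ T → T ≤ 56 * l →
        ε / 2 + (2 * R + 24) * T * (√D * (1 / n)) ≤ ε := by
      intro T hT0 hT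
      have h6 : (2 * R + 24) * T * (√D * (1 / n)) ≤ 2240 * D * l ^ 2 / n := by
        rw [mul_one_div, mul_div_assoc']
        apply div_le_div_of_nonneg_right _ hn0.le
        have h7 : 2 * R + 24 ≤ 40 * √D * l := by
          rw [hRdef]
          nlinarith [mul_le_mul hsD1 hl1 zero_le_one (by positivity)]
        calc (2 * R + 24) * T * √D ≤ (40 * √D * l) * (56 * l) * √D := by gcongr
          _ = 2240 * √D ^ 2 * l ^ 2 := by ring
          _ = 2240 * D * l ^ 2 := by rw [hsD]
      have h7 : 2240 * D * l ^ 2 / n ≤ ε / 2 := by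
        rw [div_le_iff₀ hn0]
        have : D * l ^ 2 ≤ D * l ^ 5 := by
          gcongr
          norm_num
        nlinarith [mul_pos (zero_lt_one.trans_le hD') (zero_lt_one.trans_le hl5)]
      linarith
    have htr : ∀ T, 0 ≤ T → T ≤ 56 * l → ω ∉ B₃ T → ∀ u : EuclideanSpace ℝ ι, ‖u‖ ≤ 1 →
        |∑ i, (min (inner ℝ (Φ i ω) u ^ 2) (T ^ 2) -
          ∫ ω', min (inner ℝ (Φ i ω') u ^ 2) (T ^ 2) ∂Pr)| ≤ n * ε := by
      intro T hT0 hT hω u hu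
      simp only [hB₃, Set.mem_ofPred_eq, not_exists, not_le] at hω
      refine (hgridu T hT0 R ω hR (fun j => (hω j).le) u hu).trans ?_
      gcongr
      exact herr T hT0 hT
    -- Two levels are needed. The lower one depends on ε alone and gives a removal bound free of n;
    -- the upper one is where the bound on large values starts to apply.
    apply goodSample_of_truncated hn hε0 hε1 hQs (T₁ := 56 * lam) (T₂ := 56 * l) (by rw [hlam])
    · intro u hu
      have h6 : ∀ k, |(∑ i, Φ i ω) k| ≤ n * s := by
        intro k
        have h7 : (∑ i, Φ i ω) k = ∑ i, Φ i ω k := by simp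
        rw [h7]
        exact (h₅ k).le
      have h7 := norm_le_sqrt_card_mul _ (by positivity) h6
      have h8 : √D * (n * s) = n * (ε / 4) := by
        rw [hs]
        field_simp
      rw [expect_fin_eq_sum_div, ← sum_inner, abs_div, abs_of_pos hn0, div_le_iff₀ hn0]
      refine (abs_real_inner_le_norm _ _).trans ?_
      refine (mul_le_of_le_one_right (norm_nonneg _) hu).trans (h7.trans ?_)
      rw [h8]
      linarith
    · intro u hu
      have h6 := (abs_le.1 (htr (56 * lam) (by linarith) (by linarith)
        (by simpa only [hB₃, Set.mem_ofPred_eq, not_exists, not_le] using h₃) u hu)).1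
      have h7 : ∑ i : Fin n, (Q u - ε) ≤
          ∑ i, ∫ ω', min (inner ℝ (Φ i ω') u ^ 2) ((56 * lam) ^ 2) ∂Pr :=
        Finset.sum_le_sum fun i _ => hint' u hu i
      rw [Finset.sum_sub_distrib] at h6
      simp only [Finset.sum_const, Finset.card_univ, Fintype.card_fin, nsmul_eq_mul] at h7
      rw [expect_fin_eq_sum_div, le_div_iff₀ hn0]
      linarith
    · intro u hu
      have h6 := (abs_le.1 (htr (56 * l) (by linarith) le_rfl
        (by simpa only [hB₃, Set.mem_ofPred_eq, not_exists, not_le] using h₄) u hu)).2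
      have h7 : ∑ i, ∫ ω', min (inner ℝ (Φ i ω') u ^ 2) ((56 * l) ^ 2) ∂Pr ≤ ∑ i : Fin n, Q u :=
        Finset.sum_le_sum fun i _ => hint u hu (56 * l) i
      rw [Finset.sum_sub_distrib] at h6
      simp only [Finset.sum_const, Finset.card_univ, Fintype.card_fin, nsmul_eq_mul] at h7
      rw [expect_fin_eq_sum_div, div_le_iff₀ hn0]
      nlinarith
    · intro u hu
      -- L = 14 l makes the threshold 4L equal to the upper truncation level 56 l.
      have h6 := sum_sq_large_le (fun i => Φ i ω) (R := R) (L := 14 * l) (by positivity)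
        (fun σ => norm_signedSum_le _ (fun k => by
          rcases σ k with _ | _ | _ <;> simp) _ (by positivity) (by positivity) hR (h₂ σ)) u hu
      rw [show 4 * (14 * l) = 56 * l by ring] at h6
      refine h6.trans ?_
      have h7 : 4 * R ^ 2 = 256 * D * l ^ 2 := by
        rw [hRdef, mul_pow, hsD]
        ring
      rw [h7]
      calc 256 * D * l ^ 2 * (1 + Real.log n) ≤ 256 * D * l ^ 2 * l := by
            gcongr
            linarith
        _ = 256 * (D * l ^ 3) := by ring
        _ ≤ 256 * (D * l ^ 5) := by
          gcongr
          norm_num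
        _ ≤ n * ε := by
          have : 0 ≤ D * l ^ 5 := by positivity
          linarith
  have hm := measureReal_mono (μ := Pr) hsub
  have u1 := measureReal_union_le (μ := Pr) B₁ (B₂ ∪ (B₃ (56 * lam) ∪ (B₃ (56 * l) ∪ B₅)))
  have u2 := measureReal_union_le (μ := Pr) B₂ (B₃ (56 * lam) ∪ (B₃ (56 * l) ∪ B₅))
  have u3 := measureReal_union_le (μ := Pr) (B₃ (56 * lam)) (B₃ (56 * l) ∪ B₅)
  have u4 := measureReal_union_le (μ := Pr) (B₃ (56 * l)) B₅
  linarith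

end IsSubexpFamily

end GoodSamples

/-! ### Moments of one standard Gaussian and of its centred square -/

section RealGaussian

lemma integrable_exp_mul_sq_gaussianReal {s : ℝ} (hs : s < 1 / 2) :
    Integrable (fun x => Real.exp (s * x ^ 2)) (gaussianReal 0 1) := by
  rw [gaussianReal_of_var_ne_zero 0 one_ne_zero]
  rw [integrable_withDensity_iff_integrable_smul' (by fun_prop)
    (Filter.Eventually.of_forall fun x => by simp [gaussianPDF])]
  have h := (integrable_exp_neg_mul_sq (b := 1 / 2 - s) (by linarith)).const_mul
    ((√(2 * Real.pi * 1))⁻¹)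
  refine h.congr (Filter.Eventually.of_forall fun x => ?_)
  simp only [gaussianPDF, gaussianPDFReal, smul_eq_mul]
  rw [ENNReal.toReal_ofReal (by positivity)]
  rw [NNReal.coe_one, mul_assoc (√(2 * Real.pi * 1))⁻¹, ← Real.exp_add]
  congr 2
  ring

lemma integral_exp_mul_sq_gaussianReal {s : ℝ} (hs : s < 1 / 2) :
    ∫ x, Real.exp (s * x ^ 2) ∂gaussianReal 0 1 = (√(1 - 2 * s))⁻¹ := by
  rw [integral_gaussianReal_eq_integral_smul one_ne_zero]
  have h : ∀ x : ℝ, gaussianPDFReal 0 1 x • Real.exp (s * x ^ 2) =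
      (√(2 * Real.pi * 1))⁻¹ * Real.exp (-(1 / 2 - s) * x ^ 2) := by
    intro x
    simp only [gaussianPDFReal, smul_eq_mul]
    rw [NNReal.coe_one, mul_assoc, ← Real.exp_add]
    congr 2
    ring
  simp_rw [h]
  rw [integral_const_mul, integral_gaussian, ← Real.sqrt_inv, ← Real.sqrt_inv,
    ← Real.sqrt_mul (by positivity)]
  congr 1
  have h1 : (1 : ℝ) / 2 - s ≠ 0 := by linarith
  have h2 : (1 : ℝ) - 2 * s ≠ 0 := by linarith
  have := Real.pi_pos.ne'
  field_simp

/-- The moment is exp(-s - ½ log(1 - 2s)); the linear terms cancel, and the logarithm's Taylor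
remainder leaves at most 4s². -/
lemma integral_exp_centered_sq_gaussianReal_le {s : ℝ} (hs : |s| ≤ 1 / 4) :
    ∫ x, Real.exp (s * (x ^ 2 - 1)) ∂gaussianReal 0 1 ≤ Real.exp (4 * s ^ 2) := by
  obtain ⟨hs1, hs2⟩ := abs_le.1 hs
  have h1 : ∀ x : ℝ, Real.exp (s * (x ^ 2 - 1)) = Real.exp (-s) * Real.exp (s * x ^ 2) := by
    intro x
    rw [← Real.exp_add]
    congr 1
    ring
  simp_rw [h1]
  rw [integral_const_mul, integral_exp_mul_sq_gaussianReal (by linarith)]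
  have hpos : 0 < 1 - 2 * s := by linarith
  have h2 : (√(1 - 2 * s))⁻¹ = Real.exp (-(Real.log (1 - 2 * s) / 2)) := by
    rw [Real.exp_neg, Real.exp_half, Real.exp_log hpos]
  rw [h2, ← Real.exp_add]
  apply Real.exp_le_exp.2
  have h2s : |2 * s| ≤ 1 / 2 := by
    rw [abs_mul, abs_of_pos (by norm_num : (0 : ℝ) < 2)]
    linarith
  have h3 := Real.abs_log_sub_add_sum_range_le (x := 2 * s) (by linarith) 1
  simp only [Finset.sum_range_one, zero_add, pow_one, Nat.cast_zero, div_one] at h3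
  have h4 : |2 * s| ^ (1 + 1) / (1 - |2 * s|) ≤ 2 * (2 * s) ^ 2 := by
    rw [div_le_iff₀ (by linarith), show 1 + 1 = 2 from rfl, sq_abs]
    nlinarith [sq_nonneg (2 * s)]
  have h5 := (abs_le.1 (h3.trans h4)).1
  linarith

/-- The fourth derivative at 0 of the moment generating function e^{t²/2}; each derivative is a
polynomial times that exponential. -/
lemma integral_pow_four_gaussianReal : ∫ x, x ^ 4 ∂gaussianReal 0 1 = 3 := by
  have h := iteratedDeriv_mgf_zero (X := id) (μ := gaussianReal 0 1)
    (by simp [integrableExpSet_id_gaussianReal]) 4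
  have hd : ∀ (p p' : ℝ → ℝ), (∀ t, HasDerivAt p (p' t) t) →
      deriv (fun t => p t * Real.exp (t ^ 2 / 2)) =
        fun t => (p' t + t * p t) * Real.exp (t ^ 2 / 2) := by
    intro p p' hp
    ext t
    have h1 : HasDerivAt (fun t : ℝ => Real.exp (t ^ 2 / 2)) (Real.exp (t ^ 2 / 2) * t) t := by
      have h2 : HasDerivAt (fun t : ℝ => t ^ 2 / 2) t t := by
        have := (hasDerivAt_pow 2 t).div_const 2
        rwa [show ((2 : ℕ) : ℝ) * t ^ (2 - 1) / 2 = t by norm_num] at this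
      exact h2.exp
    refine ((hp t).fun_mul h1).deriv.trans ?_
    ring
  have h0 : mgf id (gaussianReal 0 1) = fun t => 1 * Real.exp (t ^ 2 / 2) := by
    rw [mgf_id_gaussianReal]
    ext t
    simp
  have h1 : deriv (fun t : ℝ => 1 * Real.exp (t ^ 2 / 2)) = fun t => t * Real.exp (t ^ 2 / 2) := by
    rw [hd (fun _ => 1) (fun _ => 0) fun t => hasDerivAt_const t 1]
    simp
  have h2 : deriv (fun t : ℝ => t * Real.exp (t ^ 2 / 2)) =
      fun t => (1 + t ^ 2) * Real.exp (t ^ 2 / 2) := by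
    rw [hd (fun t => t) (fun _ => 1) fun t => hasDerivAt_id t]
    ext t
    ring
  have h3 : deriv (fun t : ℝ => (1 + t ^ 2) * Real.exp (t ^ 2 / 2)) =
      fun t => (3 * t + t ^ 3) * Real.exp (t ^ 2 / 2) := by
    rw [hd (fun t => 1 + t ^ 2) (fun t => 2 * t) fun t => by
      simpa using (hasDerivAt_pow 2 t).const_add 1]
    ext t
    ring
  have h4 : deriv (fun t : ℝ => (3 * t + t ^ 3) * Real.exp (t ^ 2 / 2)) =
      fun t => (3 + 6 * t ^ 2 + t ^ 4) * Real.exp (t ^ 2 / 2) := by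
    rw [hd (fun t => 3 * t + t ^ 3) (fun t => 3 + 3 * t ^ 2) fun t => by
      simpa using ((hasDerivAt_id' t).const_mul 3).fun_add (hasDerivAt_pow 3 t)]
    ext t
    ring
  rw [h0, iteratedDeriv_eq_iterate] at h
  simp only [Function.iterate_succ, Function.iterate_zero, Function.comp_apply, h1, h2, h3, h4,
    id_eq] at h
  simpa using h.symm

lemma integral_sq_gaussianReal : ∫ x, x ^ 2 ∂gaussianReal 0 1 = 1 := by
  have h := variance_eq_sub (memLp_id_gaussianReal (μ := 0) (v := 1) 2)
  rw [variance_id_gaussianReal] at h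
  simp only [id_eq, integral_id_gaussianReal] at h
  simpa using h.symm

lemma integrable_pow_gaussianReal (k : ℕ) : Integrable (fun x => x ^ k) (gaussianReal 0 1) := by
  have h := (memLp_id_gaussianReal (μ := 0) (v := 1) k).integrable_norm_pow'
  refine h.mono' (by fun_prop) (Filter.Eventually.of_forall fun x => ?_)
  simp

lemma integral_centered_sq_gaussianReal : ∫ x, (x ^ 2 - 1) ∂gaussianReal 0 1 = 0 := by
  rw [integral_sub (integrable_pow_gaussianReal 2) (integrable_const _), integral_sq_gaussianReal]
  simp

lemma memLp_centered_sq_gaussianReal : MemLp (fun x => x ^ 2 - 1) 2 (gaussianReal 0 1) := by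
  rw [memLp_two_iff_integrable_sq (by fun_prop)]
  have h := ((integrable_pow_gaussianReal 4).sub ((integrable_pow_gaussianReal 2).const_mul 2)).add
    (integrable_const 1)
  refine h.congr (Filter.Eventually.of_forall fun x => ?_)
  simp only [Pi.add_apply, Pi.sub_apply]
  ring

lemma variance_centered_sq_gaussianReal : Var[fun x => x ^ 2 - 1; gaussianReal 0 1] = 2 := by
  rw [variance_of_integral_eq_zero (by fun_prop) integral_centered_sq_gaussianReal]
  have h : ∀ x : ℝ, (x ^ 2 - 1) ^ 2 = x ^ 4 - 2 * x ^ 2 + 1 := fun x => by ring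
  simp_rw [h]
  have ha : Integrable (fun x : ℝ => x ^ 4 - 2 * x ^ 2) (gaussianReal 0 1) :=
    (integrable_pow_gaussianReal 4).sub ((integrable_pow_gaussianReal 2).const_mul 2)
  rw [integral_add ha (integrable_const 1), integral_sub (integrable_pow_gaussianReal 4)
    ((integrable_pow_gaussianReal 2).const_mul 2), integral_const_mul,
    integral_pow_four_gaussianReal, integral_sq_gaussianReal]
  norm_num

end RealGaussian

/-! ### Diagonal quadratic forms in independent Gaussians -/

section DiagonalChaos

variable {d : ℕ}

/-- The measure of `d` independent standard Gaussian coordinates. -/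
noncomputable abbrev gaussianPi (d : ℕ) : Measure (Fin d → ℝ) :=
  Measure.pi fun _ => gaussianReal 0 1

/-- Independence factors the moment, and the factors multiply to exp(4t² ∑ c_k²) ≤ e^{1/4}. Only ∑
c_k² ≤ 1 matters, so the bound does not depend on d. -/
lemma lintegral_exp_diagonal_le {c : Fin d → ℝ} (hc : ∑ k, c k ^ 2 ≤ 1) {t : ℝ} (ht : |t| = 1 / 4) :
    ∫⁻ g, ENNReal.ofReal (Real.exp (t * ∑ k, c k * (g k ^ 2 - 1))) ∂gaussianPi d ≤
      ENNReal.ofReal (Real.exp (1 / 4)) := by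
  have hck : ∀ k, |t * c k| ≤ 1 / 4 := by
    intro k
    have h1 : c k ^ 2 ≤ 1 :=
      (Finset.single_le_sum (f := fun k => c k ^ 2) (fun _ _ => sq_nonneg _) (Finset.mem_univ k)).trans hc
    have h2 : |c k| ≤ 1 := abs_le_one_iff_mul_self_le_one.2 (by linarith [sq (c k)])
    rw [abs_mul, ht]
    linarith
  have hprod : ∀ g : Fin d → ℝ, Real.exp (t * ∑ k, c k * (g k ^ 2 - 1)) =
      ∏ k, Real.exp (t * c k * (g k ^ 2 - 1)) := by
    intro g
    rw [← Real.exp_sum, Finset.mul_sum]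
    simp_rw [mul_assoc]
  have hint1 : ∀ k, Integrable (fun x : ℝ => Real.exp (t * c k * (x ^ 2 - 1))) (gaussianReal 0 1) := by
    intro k
    have := (integrable_exp_mul_sq_gaussianReal (s := t * c k)
      (by linarith [(abs_le.1 (hck k)).2])).const_mul (Real.exp (-(t * c k)))
    refine this.congr (Filter.Eventually.of_forall fun x => ?_)
    simp only
    rw [← Real.exp_add]
    congr 1
    ring
  have hint : Integrable (fun g : Fin d → ℝ => ∏ k, Real.exp (t * c k * (g k ^ 2 - 1)))
      (gaussianPi d) :=
    Integrable.fintype_prod (f := fun k x => Real.exp (t * c k * (x ^ 2 - 1))) hint1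
  simp_rw [hprod]
  rw [← ofReal_integral_eq_lintegral_ofReal hint
    (Filter.Eventually.of_forall fun g => Finset.prod_nonneg fun _ _ => (Real.exp_pos _).le)]
  apply ENNReal.ofReal_le_ofReal
  rw [integral_fintype_prod_eq_prod (f := fun k x => Real.exp (t * c k * (x ^ 2 - 1)))]
  calc ∏ k, ∫ x, Real.exp (t * c k * (x ^ 2 - 1)) ∂gaussianReal 0 1
      ≤ ∏ k, Real.exp (4 * (t * c k) ^ 2) :=
        Finset.prod_le_prod (fun k _ => integral_nonneg fun x => (Real.exp_pos _).le)
          fun k _ => integral_exp_centered_sq_gaussianReal_le (hck k)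
    _ = Real.exp (1 / 4 * ∑ k, c k ^ 2) := by
      rw [← Real.exp_sum, Finset.mul_sum]
      congr 1
      apply Finset.sum_congr rfl
      intro k _
      rw [mul_pow, ← sq_abs t, ht]
      ring
    _ ≤ Real.exp (1 / 4) := by
      apply Real.exp_le_exp.2
      linarith

/-- The exponential of |y|/4 is at most the sum of those of ±y/4, and 2e^{1/4} ≤ 3: this fixes the
constant 3 used throughout. -/
lemma lintegral_exp_abs_le_three {Ω : Type*} [MeasurableSpace Ω] {Pr : Measure Ω} {Y : Ω → ℝ}
    (hY : Measurable Y)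
    (h : ∀ t : ℝ, |t| = 1 / 4 →
      ∫⁻ ω, ENNReal.ofReal (Real.exp (t * Y ω)) ∂Pr ≤ ENNReal.ofReal (Real.exp (1 / 4))) :
    ∫⁻ ω, ENNReal.ofReal (Real.exp (|Y ω| / 4)) ∂Pr ≤ 3 := by
  have h1 : ∀ ω, ENNReal.ofReal (Real.exp (|Y ω| / 4)) ≤
      ENNReal.ofReal (Real.exp (1 / 4 * Y ω)) + ENNReal.ofReal (Real.exp (-(1 / 4) * Y ω)) := by
    intro ω
    rcases abs_cases (Y ω) with ⟨h, _⟩ | ⟨h, _⟩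
    · rw [h, show Y ω / 4 = 1 / 4 * Y ω by ring]
      exact le_self_add
    · rw [h, show -Y ω / 4 = -(1 / 4) * Y ω by ring]
      exact le_add_self
  refine (lintegral_mono h1).trans ?_
  rw [lintegral_add_left (by fun_prop)]
  refine (add_le_add (h (1 / 4) (by norm_num)) (h (-(1 / 4)) (by norm_num))).trans ?_
  rw [← ENNReal.ofReal_add (by positivity) (by positivity),
    show (3 : ENNReal) = ENNReal.ofReal 3 by simp]
  apply ENNReal.ofReal_le_ofReal
  have h2 := Real.abs_exp_sub_one_sub_id_le (x := 1 / 4) (by norm_num [abs_of_pos])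
  have h3 := (abs_le.1 h2).2
  norm_num at h3 ⊢
  linarith

lemma integral_diagonal (c : Fin d → ℝ) :
    ∫ g, ∑ k, c k * (g k ^ 2 - 1) ∂gaussianPi d = 0 := by
  have hint : ∀ k, Integrable (fun g : Fin d → ℝ => c k * (g k ^ 2 - 1)) (gaussianPi d) := by
    intro k
    exact integrable_comp_eval (μ := fun _ : Fin d => gaussianReal 0 1) (i := k) (f := fun x : ℝ => c k * (x ^ 2 - 1))
      ((memLp_centered_sq_gaussianReal.integrable (by norm_num)).const_mul (c k))
  rw [integral_finsetSum _ fun k _ => hint k]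
  apply Finset.sum_eq_zero
  intro k _
  rw [integral_const_mul,
    integral_comp_eval (μ := fun _ : Fin d => gaussianReal 0 1) (i := k) (f := fun x : ℝ => x ^ 2 - 1) (by fun_prop),
    integral_centered_sq_gaussianReal, mul_zero]

lemma integral_diagonal_sq (c : Fin d → ℝ) :
    ∫ g, (∑ k, c k * (g k ^ 2 - 1)) ^ 2 ∂gaussianPi d = 2 * ∑ k, c k ^ 2 := by
  have h := variance_sum_pi (μ := fun _ : Fin d => gaussianReal 0 1)
    (X := fun k x => c k * (x ^ 2 - 1)) fun k => memLp_centered_sq_gaussianReal.const_mul (c k)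
  have h2 : (∑ k, fun g : Fin d → ℝ => c k * (g k ^ 2 - 1)) =
      fun g => ∑ k, c k * (g k ^ 2 - 1) := by
    ext g
    simp
  rw [h2, variance_of_integral_eq_zero (Measurable.aemeasurable (by fun_prop)) (integral_diagonal c)] at h
  rw [h, Finset.mul_sum]
  apply Finset.sum_congr rfl
  intro k _
  rw [variance_const_mul, variance_centered_sq_gaussianReal]
  ring

end DiagonalChaos

/-! ### Gaussian quadratic forms as linear functionals of the outer product -/

section QuadraticForms

variable {d : ℕ}

lemma frobNorm_sq (A : Matrix (Fin d) (Fin d) ℝ) : frobNorm A ^ 2 = ∑ i, ∑ j, A i j ^ 2 := by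
  unfold frobNorm
  rw [Matrix.frobenius_norm_def, ← Real.rpow_natCast, ← Real.rpow_mul (by positivity)]
  simp

lemma frobNorm_nonneg (A : Matrix (Fin d) (Fin d) ℝ) : 0 ≤ frobNorm A := by
  unfold frobNorm
  rw [Matrix.frobenius_norm_def]
  positivity

lemma frobNorm_mul_le (A B : Matrix (Fin d) (Fin d) ℝ) :
    frobNorm (A * B) ≤ frobNorm A * frobNorm B := by
  unfold frobNorm
  exact Matrix.frobenius_norm_mul A B

lemma frobNorm_sq_eq_trace (A : Matrix (Fin d) (Fin d) ℝ) : frobNorm A ^ 2 = (Aᵀ * A).trace := by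
  rw [frobNorm_sq, Finset.sum_comm]
  simp [Matrix.trace, Matrix.mul_apply, sq]

/-- A matrix as a vector. -/
def matVec (P : Matrix (Fin d) (Fin d) ℝ) : EuclideanSpace ℝ (Fin d × Fin d) :=
  WithLp.toLp 2 fun p => P p.1 p.2

/-- The vector of entries of the centred outer product `z zᵀ - 1`. -/
def outerVec (z : EuclideanSpace ℝ (Fin d)) : EuclideanSpace ℝ (Fin d × Fin d) :=
  matVec (outerSq z - 1)

lemma norm_matVec (P : Matrix (Fin d) (Fin d) ℝ) : ‖matVec P‖ = frobNorm P := by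
  rw [← sq_eq_sq₀ (norm_nonneg _) (frobNorm_nonneg P), EuclideanSpace.norm_sq_eq, frobNorm_sq,
    Fintype.sum_prod_type]
  simp [matVec]

lemma inner_matVec (A B : Matrix (Fin d) (Fin d) ℝ) :
    inner ℝ (matVec A) (matVec B) = matInner A B := by
  rw [PiLp.inner_apply, Fintype.sum_prod_type, matInner, Finset.sum_comm]
  simp [matVec, Matrix.trace, Matrix.mul_apply, mul_comm]

lemma matInner_sub_left (A B C : Matrix (Fin d) (Fin d) ℝ) :
    matInner (A - B) C = matInner A C - matInner B C := by
  simp [matInner, Matrix.sub_mul]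

lemma matInner_outerSq (z : EuclideanSpace ℝ (Fin d)) (P : Matrix (Fin d) (Fin d) ℝ) :
    matInner (outerSq z) P = quadForm P z := by
  simp only [matInner, outerSq, quadForm, Matrix.trace, Matrix.diag, Matrix.mul_apply,
    Matrix.transpose_apply, vecMulVec_apply, dotProduct, mulVec, Finset.mul_sum]
  rw [Finset.sum_comm]
  exact Finset.sum_congr rfl fun _ _ => Finset.sum_congr rfl fun _ _ => by ring

lemma matInner_one_left (P : Matrix (Fin d) (Fin d) ℝ) : matInner 1 P = P.trace := by
  simp [matInner]

lemma inner_outerVec_matVec (z : EuclideanSpace ℝ (Fin d)) (P : Matrix (Fin d) (Fin d) ℝ) :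
    inner ℝ (outerVec z) (matVec P) = quadForm P z - P.trace := by
  rw [outerVec, inner_matVec, matInner_sub_left, matInner_outerSq, matInner_one_left]

/-- The symmetric part of a matrix given as a vector. -/
noncomputable def symPart (u : EuclideanSpace ℝ (Fin d × Fin d)) : Matrix (Fin d) (Fin d) ℝ :=
  Matrix.of fun i j => (u (i, j) + u (j, i)) / 2

lemma symPart_isSymm (u : EuclideanSpace ℝ (Fin d × Fin d)) : (symPart u).IsSymm := by
  ext i j
  simp [symPart, add_comm]

lemma symPart_matVec {P : Matrix (Fin d) (Fin d) ℝ} (hP : P.IsSymm) : symPart (matVec P) = P := by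
  ext i j
  have := hP.apply i j
  simp only [symPart, matVec, Matrix.of_apply]
  rw [this]
  ring

/-- The matrix z zᵀ - 1 is symmetric, so it sees only the symmetric part of u. This reduces
arbitrary directions in dimension d² to diagonalizable forms. -/
lemma inner_outerVec (z : EuclideanSpace ℝ (Fin d)) (u : EuclideanSpace ℝ (Fin d × Fin d)) :
    inner ℝ (outerVec z) u = quadForm (symPart u) z - (symPart u).trace := by
  rw [← inner_outerVec_matVec]
  set A := outerSq z - 1 with hA
  have hsymm : ∀ i j, A j i = A i j := by
    intro i j
    simp only [hA, outerSq, Matrix.sub_apply, vecMulVec_apply, Matrix.one_apply, eq_comm (a := i)]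
    ring
  have h1 : ∀ w : EuclideanSpace ℝ (Fin d × Fin d),
      inner ℝ (outerVec z) w = ∑ i, ∑ j, A i j * w (i, j) := by
    intro w
    rw [outerVec, PiLp.inner_apply, Fintype.sum_prod_type]
    simp [matVec, mul_comm, hA]
  rw [h1, h1]
  have h2 : ∑ i, ∑ j, A i j * u (j, i) = ∑ i, ∑ j, A i j * u (i, j) := by
    rw [Finset.sum_comm]
    exact Finset.sum_congr rfl fun i _ => Finset.sum_congr rfl fun j _ => by rw [hsymm]
  have h3 : ∑ i, ∑ j, A i j * (matVec (symPart u)) (i, j) =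
      (∑ i, ∑ j, A i j * u (i, j) + ∑ i, ∑ j, A i j * u (j, i)) / 2 := by
    rw [← Finset.sum_add_distrib, Finset.sum_div]
    refine Finset.sum_congr rfl fun i _ => ?_
    rw [← Finset.sum_add_distrib, Finset.sum_div]
    refine Finset.sum_congr rfl fun j _ => ?_
    simp only [matVec, symPart, Matrix.of_apply]
    ring
  rw [h3, h2]
  ring

lemma frobNorm_symPart_le (u : EuclideanSpace ℝ (Fin d × Fin d)) : frobNorm (symPart u) ≤ ‖u‖ := by
  rw [← sq_le_sq₀ (frobNorm_nonneg _) (norm_nonneg _), frobNorm_sq, EuclideanSpace.norm_sq_eq,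
    Fintype.sum_prod_type]
  have h1 : ∑ i, ∑ j, ‖u (i, j)‖ ^ 2 = ∑ i, ∑ j, (u (i, j) ^ 2 + u (j, i) ^ 2) / 2 := by
    have : ∑ i, ∑ j, u (j, i) ^ 2 = ∑ i, ∑ j, u (i, j) ^ 2 := Finset.sum_comm
    simp_rw [← Finset.sum_div, Finset.sum_add_distrib, this]
    simp
  rw [h1]
  refine Finset.sum_le_sum fun i _ => Finset.sum_le_sum fun j _ => ?_
  simp only [symPart, Matrix.of_apply]
  nlinarith [sq_nonneg (u (i, j) - u (j, i))]

lemma measurable_outerVec : Measurable (outerVec : EuclideanSpace ℝ (Fin d) → _) := by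
  have : Continuous (outerVec : EuclideanSpace ℝ (Fin d) → _) := by
    unfold outerVec matVec
    refine (PiLp.continuous_toLp 2 _).comp (continuous_pi fun p => ?_)
    simp only [outerSq, Matrix.sub_apply, vecMulVec_apply]
    fun_prop
  exact this.measurable

/-- The coordinates are taken in an orthonormal eigenbasis: the trace is the sum of the eigenvalues,
the squared Frobenius norm the sum of their squares. -/
lemma exists_diagonalization {V : Matrix (Fin d) (Fin d) ℝ} (hV : V.IsSymm) :
    ∃ (c : Fin d → ℝ) (e : EuclideanSpace ℝ (Fin d) ≃ₗᵢ[ℝ] EuclideanSpace ℝ (Fin d)),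
      (∀ z, quadForm V z - V.trace = ∑ k, c k * (e z k ^ 2 - 1)) ∧
      ∑ k, c k ^ 2 = frobNorm V ^ 2 := by
  have hH : V.IsHermitian := by
    rw [Matrix.IsHermitian, Matrix.conjTranspose_eq_transpose_of_trivial]
    exact hV
  refine ⟨hH.eigenvalues, hH.eigenvectorBasis.repr, fun z => ?_, ?_⟩
  · have htr : V.trace = ∑ k, hH.eigenvalues k := by
      simpa using hH.trace_eq_sum_eigenvalues
    have hq : quadForm V z = inner ℝ z (WithLp.toLp 2 (V *ᵥ z.ofLp)) := by
      simp [quadForm, PiLp.inner_apply, dotProduct, mul_comm]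
    have hb : ∀ k, inner ℝ (hH.eigenvectorBasis k) (WithLp.toLp 2 (V *ᵥ z.ofLp)) =
        hH.eigenvalues k * hH.eigenvectorBasis.repr z k := by
      intro k
      have h1 := hH.mulVec_eigenvectorBasis k
      have h2 : inner ℝ (hH.eigenvectorBasis k) (WithLp.toLp 2 (V *ᵥ z.ofLp)) =
          (V *ᵥ (hH.eigenvectorBasis k).ofLp) ⬝ᵥ z.ofLp := by
        have h3 : inner ℝ (hH.eigenvectorBasis k) (WithLp.toLp 2 (V *ᵥ z.ofLp)) =
            (hH.eigenvectorBasis k).ofLp ⬝ᵥ (V *ᵥ z.ofLp) := by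
          simp [PiLp.inner_apply, dotProduct, mul_comm]
        rw [h3, Matrix.dotProduct_mulVec, ← Matrix.mulVec_transpose, hV.eq]
      rw [h2, h1, OrthonormalBasis.repr_apply_apply]
      simp [PiLp.inner_apply, dotProduct, Finset.mul_sum, mul_comm, mul_left_comm]
    rw [hq, ← hH.eigenvectorBasis.sum_inner_mul_inner, htr, ← Finset.sum_sub_distrib]
    refine Finset.sum_congr rfl fun k _ => ?_
    rw [hb, OrthonormalBasis.repr_apply_apply, real_inner_comm]
    ring
  · rw [frobNorm_sq_eq_trace, hV.eq]
    have h := hH.spectral_theorem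
    have h2 : V * V = Unitary.conjStarAlgAut ℝ (Matrix (Fin d) (Fin d) ℝ) hH.eigenvectorUnitary
        (diagonal (RCLike.ofReal ∘ hH.eigenvalues) * diagonal (RCLike.ofReal ∘ hH.eigenvalues)) := by
      rw [map_mul, ← h]
    rw [h2, Unitary.conjStarAlgAut_apply, Matrix.trace_mul_cycle, Unitary.coe_star_mul_self,
      one_mul, Matrix.diagonal_mul_diagonal, Matrix.trace_diagonal]
    simp [sq]

lemma measurable_quadForm (V : Matrix (Fin d) (Fin d) ℝ) :
    Measurable fun z : EuclideanSpace ℝ (Fin d) => quadForm V z := by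
  unfold quadForm
  simp only [dotProduct, mulVec]
  fun_prop

/-- The law of a centred Gaussian quadratic form in diagonal coordinates. -/
lemma exists_map_quadForm_eq {V : Matrix (Fin d) (Fin d) ℝ} (hV : V.IsSymm) :
    ∃ c : Fin d → ℝ, ∑ k, c k ^ 2 = frobNorm V ^ 2 ∧
      (stdGaussian (EuclideanSpace ℝ (Fin d))).map (fun z => quadForm V z - V.trace) =
        (gaussianPi d).map fun g => ∑ k, c k * (g k ^ 2 - 1) := by
  obtain ⟨c, e, h, hc⟩ := exists_diagonalization hV
  refine ⟨c, hc, ?_⟩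
  have hG : Measurable fun z : EuclideanSpace ℝ (Fin d) => ∑ k, c k * (z k ^ 2 - 1) := by fun_prop
  calc (stdGaussian (EuclideanSpace ℝ (Fin d))).map (fun z => quadForm V z - V.trace)
      = (stdGaussian (EuclideanSpace ℝ (Fin d))).map
          ((fun z : EuclideanSpace ℝ (Fin d) => ∑ k, c k * (z k ^ 2 - 1)) ∘ e) := by
        congr 1
        ext z
        exact h z
    _ = (stdGaussian (EuclideanSpace ℝ (Fin d))).map
          (fun z : EuclideanSpace ℝ (Fin d) => ∑ k, c k * (z k ^ 2 - 1)) := by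
        -- Rotation invariance of the standard Gaussian removes the change of basis.
        rw [← Measure.map_map hG (by fun_prop), stdGaussian_map]
    _ = _ := by
        rw [← map_pi_eq_stdGaussian, Measure.map_map hG (by fun_prop)]
        rfl

lemma lintegral_exp_outerVec_le (u : EuclideanSpace ℝ (Fin d × Fin d)) (hu : ‖u‖ ≤ 1) :
    ∫⁻ z, ENNReal.ofReal (Real.exp (|inner ℝ (outerVec z) u| / 4))
      ∂stdGaussian (EuclideanSpace ℝ (Fin d)) ≤ 3 := by
  simp_rw [inner_outerVec]
  obtain ⟨c, hc, hlaw⟩ := exists_map_quadForm_eq (symPart_isSymm u)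
  have hc1 : ∑ k, c k ^ 2 ≤ 1 := by
    rw [hc]
    exact pow_le_one₀ (frobNorm_nonneg _) ((frobNorm_symPart_le u).trans hu)
  have hm := (measurable_quadForm (symPart u)).sub_const (symPart u).trace
  rw [← lintegral_map (f := fun y => ENNReal.ofReal (Real.exp (|y| / 4))) (by fun_prop) hm, hlaw,
    lintegral_map (by fun_prop) (by fun_prop)]
  exact lintegral_exp_abs_le_three (by fun_prop) fun t ht => lintegral_exp_diagonal_le hc1 ht

lemma integral_outerVec (u : EuclideanSpace ℝ (Fin d × Fin d)) :
    ∫ z, inner ℝ (outerVec z) u ∂stdGaussian (EuclideanSpace ℝ (Fin d)) = 0 := by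
  simp_rw [inner_outerVec]
  obtain ⟨c, hc, hlaw⟩ := exists_map_quadForm_eq (symPart_isSymm u)
  have hm := (measurable_quadForm (symPart u)).sub_const (symPart u).trace
  rw [← integral_map (f := fun y => y) hm.aemeasurable (by fun_prop), hlaw,
    integral_map (Measurable.aemeasurable (by fun_prop)) (by fun_prop)]
  exact integral_diagonal c

lemma integral_outerVec_sq (u : EuclideanSpace ℝ (Fin d × Fin d)) :
    ∫ z, inner ℝ (outerVec z) u ^ 2 ∂stdGaussian (EuclideanSpace ℝ (Fin d)) =
      2 * frobNorm (symPart u) ^ 2 := by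
  simp_rw [inner_outerVec]
  obtain ⟨c, hc, hlaw⟩ := exists_map_quadForm_eq (symPart_isSymm u)
  have hm := (measurable_quadForm (symPart u)).sub_const (symPart u).trace
  rw [← integral_map (f := fun y => y ^ 2) hm.aemeasurable (by fun_prop), hlaw,
    integral_map (Measurable.aemeasurable (by fun_prop)) (by fun_prop), ← hc]
  exact integral_diagonal_sq c

lemma lintegral_exp_inner_stdGaussian_le (u : EuclideanSpace ℝ (Fin d)) (hu : ‖u‖ ≤ 1) :
    ∫⁻ z, ENNReal.ofReal (Real.exp (|inner ℝ z u| / 4))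
      ∂stdGaussian (EuclideanSpace ℝ (Fin d)) ≤ 3 := by
  refine lintegral_exp_abs_le_three (by fun_prop) fun t ht => ?_
  have hlaw : (stdGaussian (EuclideanSpace ℝ (Fin d))).map (fun z => inner ℝ z u) =
      gaussianReal 0 (‖u‖ ^ 2).toNNReal := by
    have h := IsGaussian.map_eq_gaussianReal (μ := stdGaussian (EuclideanSpace ℝ (Fin d)))
      (innerSL ℝ u)
    rw [integral_strongDual_stdGaussian, variance_dual_stdGaussian, innerSL_apply_norm] at h
    rw [← h]
    congr 1
    ext z
    simp [real_inner_comm]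
  have h1 : ∀ y : ℝ, Integrable (fun x => Real.exp (y * x)) (gaussianReal 0 (‖u‖ ^ 2).toNNReal) :=
    fun y => integrable_exp_mul_gaussianReal y
  rw [← lintegral_map (f := fun y => ENNReal.ofReal (Real.exp (t * y))) (by fun_prop)
    (by fun_prop), hlaw, ← ofReal_integral_eq_lintegral_ofReal (h1 t)
    (Filter.Eventually.of_forall fun g => (Real.exp_pos _).le)]
  apply ENNReal.ofReal_le_ofReal
  have h2 := congrFun (mgf_id_gaussianReal (μ := 0) (v := (‖u‖ ^ 2).toNNReal)) t
  simp only [mgf, id_eq] at h2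
  rw [h2]
  apply Real.exp_le_exp.2
  rw [Real.coe_toNNReal _ (sq_nonneg _), ← sq_abs t, ht]
  have : ‖u‖ ^ 2 ≤ 1 := pow_le_one₀ (norm_nonneg _) hu
  linarith

lemma integral_inner_stdGaussian (u : EuclideanSpace ℝ (Fin d)) :
    ∫ z, inner ℝ z u ∂stdGaussian (EuclideanSpace ℝ (Fin d)) = 0 := by
  have h := integral_strongDual_stdGaussian (innerSL ℝ u)
  simpa [real_inner_comm] using h

end QuadraticForms

/-! ### Weighted averages -/

section Averages

variable {ι : Type*} [Fintype ι]

lemma sq_expect_mul_le {w x : ι → ℝ} (hw : ∀ i, 0 ≤ w i) :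
    (𝔼 i, w i * x i) ^ 2 ≤ (𝔼 i, w i) * 𝔼 i, w i * x i ^ 2 := by
  have h := Finset.sum_mul_sq_le_sq_mul_sq Finset.univ (fun i => √(w i)) fun i => √(w i) * x i
  have h1 : ∀ i, √(w i) * (√(w i) * x i) = w i * x i := fun i => by
    rw [← mul_assoc, Real.mul_self_sqrt (hw i)]
  have h2 : ∀ i, (√(w i) * x i) ^ 2 = w i * x i ^ 2 := fun i => by
    rw [mul_pow, Real.sq_sqrt (hw i)]
  have h3 : ∀ i, √(w i) ^ 2 = w i := fun i => Real.sq_sqrt (hw i)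
  simp_rw [h1, h2, h3] at h
  rw [Finset.expect_eq_sum_div_card, Finset.expect_eq_sum_div_card, Finset.expect_eq_sum_div_card,
    div_pow, div_mul_div_comm, sq (Finset.univ.card : ℝ)]
  gcongr

/-- Cauchy–Schwarz for weights of small total mass. -/
lemma abs_expect_mul_le {w x : ι → ℝ} (hw : ∀ i, 0 ≤ w i) {ε κ C D F : ℝ} (hε : 0 ≤ ε) (hεκ : ε ≤ κ)
    (hwε : 𝔼 i, w i ≤ 4 * ε) (hx : 𝔼 i, w i * x i ^ 2 ≤ C * κ * F ^ 2) (hC : 0 ≤ C)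
    (hF : 0 ≤ F) (hD : 0 ≤ D) (hCD : 4 * C ≤ D ^ 2) :
    |𝔼 i, w i * x i| ≤ D * κ * F := by
  have hκ : 0 ≤ κ := hε.trans hεκ
  apply abs_le_of_sq_le_sq _ (by positivity)
  have h0 : 0 ≤ 𝔼 i, w i * x i ^ 2 :=
    Finset.expect_nonneg fun i _ => mul_nonneg (hw i) (sq_nonneg _)
  calc (𝔼 i, w i * x i) ^ 2 ≤ (𝔼 i, w i) * 𝔼 i, w i * x i ^ 2 := sq_expect_mul_le hw
    _ ≤ (4 * ε) * (C * κ * F ^ 2) := by gcongr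
    _ ≤ (4 * κ) * (C * κ * F ^ 2) := by gcongr
    _ = (4 * C) * (κ ^ 2 * F ^ 2) := by ring
    _ ≤ D ^ 2 * (κ ^ 2 * F ^ 2) := by gcongr
    _ = (D * κ * F) ^ 2 := by ring

lemma expect_const_fin {n : ℕ} (hn : 0 < n) (c : ℝ) : 𝔼 _i : Fin n, c = c := by
  have : Nonempty (Fin n) := ⟨⟨0, hn⟩⟩
  exact Fintype.expect_const c

lemma expect_prod_eq {n : ℕ} (f : Fin n → Fin n → ℝ) :
    𝔼 p : Fin n × Fin n, f p.1 p.2 = 𝔼 i, 𝔼 j, f i j := by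
  rw [← Finset.univ_product_univ, Finset.expect_product']

end Averages

/-! ### Matrices acting on Euclidean space -/

section MatrixAction

variable {d : ℕ}

/-- The linear map of a square matrix on Euclidean space. -/
noncomputable abbrev matAct (P : Matrix (Fin d) (Fin d) ℝ) :
    EuclideanSpace ℝ (Fin d) →L[ℝ] EuclideanSpace ℝ (Fin d) :=
  toEuclideanCLM (𝕜 := ℝ) P

lemma quadForm_eq_inner (P : Matrix (Fin d) (Fin d) ℝ) (v : EuclideanSpace ℝ (Fin d)) :
    quadForm P v = inner ℝ v (matAct P v) := by
  simp [quadForm, PiLp.inner_apply, dotProduct, mul_comm]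

lemma inner_matAct_eq (P : Matrix (Fin d) (Fin d) ℝ) (u v : EuclideanSpace ℝ (Fin d)) :
    inner ℝ u (matAct P v) = inner ℝ (matAct Pᵀ u) v := by
  have h1 : inner ℝ u (matAct P v) = u.ofLp ⬝ᵥ (P *ᵥ v.ofLp) := by
    simp [PiLp.inner_apply, dotProduct, mul_comm]
  have h2 : inner ℝ (matAct Pᵀ u) v = (Pᵀ *ᵥ u.ofLp) ⬝ᵥ v.ofLp := by
    simp [PiLp.inner_apply, dotProduct, mul_comm]
  rw [h1, h2, Matrix.dotProduct_mulVec, Matrix.mulVec_transpose]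

lemma matAct_mul (A B : Matrix (Fin d) (Fin d) ℝ) (v : EuclideanSpace ℝ (Fin d)) :
    matAct (A * B) v = matAct A (matAct B v) := by
  simp [matAct, map_mul]

lemma quadForm_mul_self {P : Matrix (Fin d) (Fin d) ℝ} (hP : P.IsSymm)
    (v : EuclideanSpace ℝ (Fin d)) : quadForm (P * P) v = ‖matAct P v‖ ^ 2 := by
  rw [quadForm_eq_inner, matAct_mul, inner_matAct_eq, hP.eq, real_inner_self_eq_norm_sq]

lemma isSymm_mul_self {P : Matrix (Fin d) (Fin d) ℝ} (hP : P.IsSymm) : (P * P).IsSymm := by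
  rw [Matrix.IsSymm, Matrix.transpose_mul, hP.eq]

lemma quadForm_add {P : Matrix (Fin d) (Fin d) ℝ} (hP : P.IsSymm)
    (u v : EuclideanSpace ℝ (Fin d)) :
    quadForm P (u + v) = quadForm P u + 2 * inner ℝ u (matAct P v) + quadForm P v := by
  have h : inner ℝ v (matAct P u) = inner ℝ u (matAct P v) := by
    rw [inner_matAct_eq, hP.eq, real_inner_comm]
  rw [quadForm_eq_inner, quadForm_eq_inner, quadForm_eq_inner, map_add, inner_add_left,
    inner_add_right, inner_add_right, h]
  ring

lemma quadForm_sub {P : Matrix (Fin d) (Fin d) ℝ} (hP : P.IsSymm)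
    (u v : EuclideanSpace ℝ (Fin d)) :
    quadForm P (u - v) = quadForm P u - 2 * inner ℝ u (matAct P v) + quadForm P v := by
  have h : quadForm P (-v) = quadForm P v := by
    rw [quadForm_eq_inner, quadForm_eq_inner, map_neg, inner_neg_neg]
  rw [sub_eq_add_neg, quadForm_add hP, h, map_neg, inner_neg_right]
  ring

lemma norm_matAct_le (P : Matrix (Fin d) (Fin d) ℝ) (v : EuclideanSpace ℝ (Fin d)) :
    ‖matAct P v‖ ≤ frobNorm P * ‖v‖ := by
  rw [← sq_le_sq₀ (norm_nonneg _) (mul_nonneg (frobNorm_nonneg _) (norm_nonneg _)), mul_pow,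
    frobNorm_sq, EuclideanSpace.norm_sq_eq, EuclideanSpace.norm_sq_eq v, Finset.sum_mul]
  refine Finset.sum_le_sum fun i _ => ?_
  have h := Finset.sum_mul_sq_le_sq_mul_sq Finset.univ (fun j => P i j) fun j => v j
  simpa [matAct, mulVec, dotProduct] using h

lemma outerSq_isSymm (v : EuclideanSpace ℝ (Fin d)) : (outerSq v).IsSymm := by
  ext i j
  simp [outerSq, vecMulVec_apply, mul_comm]

lemma quadForm_outerSq (v z : EuclideanSpace ℝ (Fin d)) :
    quadForm (outerSq v) z = inner ℝ z v ^ 2 := by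
  have h : inner ℝ z v = z.ofLp ⬝ᵥ v.ofLp := by
    simp [PiLp.inner_apply, dotProduct, mul_comm]
  rw [h, quadForm, outerSq, Matrix.vecMulVec_mulVec]
  simp [dotProduct_comm v.ofLp, sq]

lemma trace_outerSq (v : EuclideanSpace ℝ (Fin d)) : (outerSq v).trace = ‖v‖ ^ 2 := by
  rw [outerSq, Matrix.trace_vecMulVec, EuclideanSpace.norm_sq_eq]
  simp [dotProduct, sq]

lemma frobNorm_outerSq (v : EuclideanSpace ℝ (Fin d)) : frobNorm (outerSq v) = ‖v‖ ^ 2 := by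
  rw [← sq_eq_sq₀ (frobNorm_nonneg _) (by positivity), frobNorm_sq, EuclideanSpace.norm_sq_eq,
    sq (∑ i, _), Finset.sum_mul_sum]
  simp [outerSq, vecMulVec_apply, mul_pow]

lemma abs_quadForm_le (P : Matrix (Fin d) (Fin d) ℝ) (v : EuclideanSpace ℝ (Fin d)) :
    |quadForm P v| ≤ frobNorm P * ‖v‖ ^ 2 := by
  rw [quadForm_eq_inner]
  refine (abs_real_inner_le_norm _ _).trans ?_
  nlinarith [norm_matAct_le P v, norm_nonneg v]

end MatrixAction

/-! ### Recentring by the sample mean -/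

section Centering

variable {d n : ℕ}

/-- The value of the quadratic form `P` on the `i`-th point, centred by its sample average. -/
noncomputable def centredForm (ψ : Fin n → EuclideanSpace ℝ (Fin d)) (P : Matrix (Fin d) (Fin d) ℝ)
    (i : Fin n) : ℝ :=
  quadForm P (ψ i) - 𝔼 j, quadForm P (ψ j)

/-- A centred sample whose quadratic statistics are close to those of a standard Gaussian, also
after the removal of a small fraction of the points. -/
structure StableSample (ψ : Fin n → EuclideanSpace ℝ (Fin d)) (ε κ : ℝ) : Prop where
  mean_zero : ∀ v, 𝔼 i, inner ℝ (ψ i) v = 0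
  trace_close : ∀ P : Matrix (Fin d) (Fin d) ℝ, P.IsSymm →
    |𝔼 i, quadForm P (ψ i) - P.trace| ≤ ε / 2 * frobNorm P
  second : ∀ P : Matrix (Fin d) (Fin d) ℝ, P.IsSymm →
    |𝔼 i, centredForm ψ P i ^ 2 - 2 * frobNorm P ^ 2| ≤ 9 * ε * frobNorm P ^ 2
  removal : ∀ w : Fin n → ℝ, (∀ i, w i ∈ Set.Icc (0 : ℝ) 1) → 𝔼 i, w i ≤ 4 * ε →
    ∀ P : Matrix (Fin d) (Fin d) ℝ, P.IsSymm →
      𝔼 i, w i * centredForm ψ P i ^ 2 ≤ 25201 * κ * frobNorm P ^ 2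

lemma inner_sampleMean (x : Fin n → EuclideanSpace ℝ (Fin d)) (v : EuclideanSpace ℝ (Fin d)) :
    inner ℝ (sampleMean x) v = 𝔼 i, inner ℝ (x i) v := by
  unfold sampleMean Finset.expect
  rw [real_inner_comm, ← innerSL_apply_apply ℝ, map_nnrat_smul, map_sum]
  simp [real_inner_comm]

lemma expect_inner_sub_sampleMean (hn : 0 < n) (x : Fin n → EuclideanSpace ℝ (Fin d))
    (v : EuclideanSpace ℝ (Fin d)) : 𝔼 i, inner ℝ (x i - sampleMean x) v = 0 := by
  simp_rw [inner_sub_left]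
  rw [Finset.expect_sub_distrib, expect_const_fin hn, inner_sampleMean, sub_self]

/-- The bound is tested in the direction of the sample mean itself. -/
lemma norm_sampleMean_le {z : Fin n → EuclideanSpace ℝ (Fin d)} {c : ℝ} (hc : 0 ≤ c)
    (h : ∀ v, |𝔼 i, inner ℝ (z i) v| ≤ c * ‖v‖) : ‖sampleMean z‖ ≤ c := by
  have h1 := h (sampleMean z)
  rw [← inner_sampleMean, real_inner_self_eq_norm_sq, abs_of_nonneg (sq_nonneg _), sq] at h1
  rcases (norm_nonneg (sampleMean z)).eq_or_lt with h0 | h0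
  · rw [← h0]
    exact hc
  · exact le_of_mul_le_mul_right h1 h0

lemma expect_quadForm_centred (hn : 0 < n) (z : Fin n → EuclideanSpace ℝ (Fin d))
    {P : Matrix (Fin d) (Fin d) ℝ} (hP : P.IsSymm) :
    𝔼 i, quadForm P (z i - sampleMean z) = 𝔼 i, quadForm P (z i) - quadForm P (sampleMean z) := by
  simp_rw [quadForm_sub hP]
  rw [Finset.expect_add_distrib, Finset.expect_sub_distrib, ← Finset.mul_expect,
    ← inner_sampleMean, expect_const_fin hn, ← quadForm_eq_inner]
  ring

lemma centredForm_sub_sampleMean (hn : 0 < n) (z : Fin n → EuclideanSpace ℝ (Fin d))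
    {P : Matrix (Fin d) (Fin d) ℝ} (hP : P.IsSymm) (i : Fin n) :
    centredForm (fun i => z i - sampleMean z) P i =
      inner ℝ (outerVec (z i)) (matVec P) + (-(𝔼 j, inner ℝ (outerVec (z j)) (matVec P)) -
        2 * inner ℝ (z i - sampleMean z) (matAct P (sampleMean z))) := by
  unfold centredForm
  rw [expect_quadForm_centred hn z hP]
  simp_rw [inner_outerVec_matVec]
  rw [Finset.expect_sub_distrib, expect_const_fin hn, quadForm_sub hP, inner_sub_left,
    quadForm_eq_inner P (sampleMean z)]
  ring

/-- Recentring changes the linear functional of z zᵀ - 1 by a term whose mean square is at most ε²/2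
times the squared Frobenius norm, since the sample mean has norm at most ε/4. Of the sample z itself
only the mean bound is used: second moments of ⟨z, v⟩ come from the outer products with P = v vᵀ. -/
lemma stableSample_of_goodSample (hn : 0 < n) {ε κ : ℝ} (hε0 : 0 < ε) (hε1 : ε < 1)
    (hκ : κ = ε * (1 + Real.log (1 / ε)) ^ 2) {z : Fin n → EuclideanSpace ℝ (Fin d)}
    {Q : EuclideanSpace ℝ (Fin d) → ℝ} (hz : GoodSample z Q ε)
    (hφ : GoodSample (fun i => outerVec (z i)) (fun u => 2 * frobNorm (symPart u) ^ 2) ε) :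
    StableSample (fun i => z i - sampleMean z) ε κ := by
  have hlog : 0 ≤ Real.log (1 / ε) := Real.log_nonneg (by rw [le_div_iff₀ hε0]; linarith)
  have hεκ : ε ≤ κ := by
    rw [hκ]
    exact le_mul_of_one_le_right hε0.le (one_le_pow₀ (by linarith))
  have hε2 : ε ^ 2 ≤ ε := by nlinarith
  have hmean : ‖sampleMean z‖ ≤ ε / 4 := norm_sampleMean_le (by positivity) hz.mean
  have hq : ∀ P : Matrix (Fin d) (Fin d) ℝ,
      |𝔼 i, inner ℝ (outerVec (z i)) (matVec P)| ≤ ε / 4 * frobNorm P := by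
    intro P
    rw [← norm_matVec]
    exact hφ.mean _
  have htr : ∀ P : Matrix (Fin d) (Fin d) ℝ, P.IsSymm →
      |𝔼 i, quadForm P (z i - sampleMean z) - P.trace| ≤ ε / 2 * frobNorm P := by
    intro P hP
    have h1 := hq P
    simp_rw [inner_outerVec_matVec] at h1
    rw [Finset.expect_sub_distrib, expect_const_fin hn] at h1
    rw [expect_quadForm_centred hn z hP]
    have h2 := abs_quadForm_le P (sampleMean z)
    have h3 : frobNorm P * ‖sampleMean z‖ ^ 2 ≤ frobNorm P * (ε / 4) ^ 2 := by
      have := frobNorm_nonneg P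
      gcongr
    have h4 : frobNorm P * (ε / 4) ^ 2 ≤ ε / 4 * frobNorm P := by
      have := frobNorm_nonneg P
      nlinarith
    have h5 := abs_sub (𝔼 i, quadForm P (z i) - P.trace) (quadForm P (sampleMean z))
    rw [show 𝔼 i, quadForm P (z i) - quadForm P (sampleMean z) - P.trace =
      𝔼 i, quadForm P (z i) - P.trace - quadForm P (sampleMean z) by ring]
    linarith
  have hcov : ∀ v : EuclideanSpace ℝ (Fin d),
      𝔼 i, inner ℝ (z i - sampleMean z) v ^ 2 ≤ 3 / 2 * ‖v‖ ^ 2 := by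
    intro v
    have h1 := htr (outerSq v) (outerSq_isSymm v)
    simp_rw [quadForm_outerSq, trace_outerSq, frobNorm_outerSq] at h1
    have h2 := (abs_le.1 h1).2
    nlinarith [sq_nonneg ‖v‖]
  have hg : ∀ P : Matrix (Fin d) (Fin d) ℝ, 𝔼 i, (-(𝔼 j, inner ℝ (outerVec (z j)) (matVec P)) -
        2 * inner ℝ (z i - sampleMean z) (matAct P (sampleMean z))) ^ 2 ≤
      ε ^ 2 / 2 * frobNorm P ^ 2 := by
    intro P
    set c := 𝔼 j, inner ℝ (outerVec (z j)) (matVec P)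
    set v := matAct P (sampleMean z)
    have h1 : ∀ i, (-c - 2 * inner ℝ (z i - sampleMean z) v) ^ 2 =
        c ^ 2 + 4 * c * inner ℝ (z i - sampleMean z) v +
          4 * inner ℝ (z i - sampleMean z) v ^ 2 := fun i => by ring
    simp_rw [h1]
    rw [Finset.expect_add_distrib, Finset.expect_add_distrib, expect_const_fin hn,
      ← Finset.mul_expect, ← Finset.mul_expect, expect_inner_sub_sampleMean hn]
    have h2 : c ^ 2 ≤ (ε / 4 * frobNorm P) ^ 2 := by
      rw [← sq_abs c]
      have := hq P
      gcongr
    have h3 : ‖v‖ ≤ frobNorm P * (ε / 4) :=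
      (norm_matAct_le _ _).trans (mul_le_mul_of_nonneg_left hmean (frobNorm_nonneg P))
    have h4 : ‖v‖ ^ 2 ≤ (frobNorm P * (ε / 4)) ^ 2 := by gcongr
    have h5 := hcov v
    nlinarith [sq_nonneg (ε * frobNorm P)]
  have hsecond : ∀ P : Matrix (Fin d) (Fin d) ℝ, P.IsSymm →
      |𝔼 i, inner ℝ (outerVec (z i)) (matVec P) ^ 2 - 2 * frobNorm P ^ 2| ≤
        4 * ε * frobNorm P ^ 2 := by
    intro P hP
    have h1 := hφ.second (matVec P)
    rwa [symPart_matVec hP, norm_matVec] at h1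
  refine ⟨fun v => expect_inner_sub_sampleMean hn z v, htr, fun P hP => ?_,
    fun w hw hwε P hP => ?_⟩
  · simp_rw [centredForm_sub_sampleMean hn z hP]
    set q : Fin n → ℝ := fun i => inner ℝ (outerVec (z i)) (matVec P)
    set g : Fin n → ℝ := fun i => -(𝔼 j, inner ℝ (outerVec (z j)) (matVec P)) -
        2 * inner ℝ (z i - sampleMean z) (matAct P (sampleMean z))
    have h1 : |𝔼 i, q i ^ 2 - 2 * frobNorm P ^ 2| ≤ 4 * ε * frobNorm P ^ 2 := hsecond P hP
    have h2 : 𝔼 i, g i ^ 2 ≤ ε ^ 2 / 2 * frobNorm P ^ 2 := hg P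
    have h2' : 0 ≤ 𝔼 i, g i ^ 2 := Finset.expect_nonneg fun i _ => sq_nonneg _
    have h3 : ∀ i, (q i + g i) ^ 2 = q i ^ 2 + 2 * (q i * g i) + g i ^ 2 := fun i => by ring
    change |𝔼 i, (q i + g i) ^ 2 - 2 * frobNorm P ^ 2| ≤ _
    simp_rw [h3]
    rw [Finset.expect_add_distrib, Finset.expect_add_distrib, ← Finset.mul_expect]
    obtain ⟨h1a, h1b⟩ := abs_le.1 h1
    have hf2 := sq_nonneg (frobNorm P)
    have h4 : 𝔼 i, q i ^ 2 ≤ 6 * frobNorm P ^ 2 := by nlinarith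
    have h5 : |𝔼 i, q i * g i| ≤ 2 * ε * frobNorm P ^ 2 := by
      apply abs_le_of_sq_le_sq _ (by positivity)
      have h6 := Finset.sum_mul_sq_le_sq_mul_sq Finset.univ q g
      have h7 : (𝔼 i, q i * g i) ^ 2 ≤ (𝔼 i, q i ^ 2) * 𝔼 i, g i ^ 2 := by
        rw [expect_fin_eq_sum_div, expect_fin_eq_sum_div, expect_fin_eq_sum_div, div_pow,
          div_mul_div_comm, sq (n : ℝ)]
        gcongr
      calc (𝔼 i, q i * g i) ^ 2 ≤ (𝔼 i, q i ^ 2) * 𝔼 i, g i ^ 2 := h7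
        _ ≤ (6 * frobNorm P ^ 2) * (ε ^ 2 / 2 * frobNorm P ^ 2) := by gcongr
        _ = 3 * (ε * frobNorm P ^ 2) ^ 2 := by ring
        _ ≤ 4 * (ε * frobNorm P ^ 2) ^ 2 := by
          gcongr
          norm_num
        _ = (2 * ε * frobNorm P ^ 2) ^ 2 := by ring
    obtain ⟨h5a, h5b⟩ := abs_le.1 h5
    have h8 : ε ^ 2 / 2 * frobNorm P ^ 2 ≤ ε * frobNorm P ^ 2 := by
      gcongr
      linarith
    rw [abs_le]
    constructor <;> linarith
  · simp_rw [centredForm_sub_sampleMean hn z hP]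
    set q : Fin n → ℝ := fun i => inner ℝ (outerVec (z i)) (matVec P)
    set g : Fin n → ℝ := fun i => -(𝔼 j, inner ℝ (outerVec (z j)) (matVec P)) -
        2 * inner ℝ (z i - sampleMean z) (matAct P (sampleMean z))
    change 𝔼 i, w i * (q i + g i) ^ 2 ≤ _
    have h1 : 𝔼 i, w i * q i ^ 2 ≤ 12600 * κ * frobNorm P ^ 2 := by
      rw [hκ, ← norm_matVec]
      exact hφ.removal w hw hwε (matVec P)
    have h2 : 𝔼 i, g i ^ 2 ≤ ε ^ 2 / 2 * frobNorm P ^ 2 := hg P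
    have h3 : 𝔼 i, w i * (q i + g i) ^ 2 ≤ 𝔼 i, (2 * (w i * q i ^ 2) + 2 * g i ^ 2) := by
      apply Finset.expect_le_expect
      intro i _
      obtain ⟨hw0, hw1⟩ := hw i
      nlinarith [mul_nonneg hw0 (sq_nonneg (q i - g i)),
        mul_nonneg (sub_nonneg.2 hw1) (sq_nonneg (g i))]
    rw [Finset.expect_add_distrib, ← Finset.mul_expect, ← Finset.mul_expect] at h3
    have hf2 := sq_nonneg (frobNorm P)
    have h4 : ε ^ 2 * frobNorm P ^ 2 ≤ κ * frobNorm P ^ 2 := by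
      gcongr
      linarith
    linarith

end Centering

/-! ### Deleted mass of admissible weights -/

section Weights

variable {n : ℕ} {ε : ℝ} {a : Fin n → ℝ} {b : Fin n → Fin n → ℝ}

namespace AdmissibleWeights

lemma expect_one_sub_le (hn : 0 < n) (h : AdmissibleWeights ε a b) : 𝔼 i, (1 - a i) ≤ 4 * ε := by
  rw [Finset.expect_sub_distrib, expect_const_fin hn]
  have h1 : 𝔼 i, 𝔼 j, b i j ≤ 𝔼 i, a i := by
    apply Finset.expect_le_expect
    intro i _
    rw [← expect_const_fin hn (a i)]
    exact Finset.expect_le_expect fun j _ => h.le_point i j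
  linarith [h.total]

lemma one_sub_mem (h : AdmissibleWeights ε a b) (i : Fin n) : 1 - a i ∈ Set.Icc (0 : ℝ) 1 :=
  ⟨by linarith [(h.a_mem i).2], by linarith [(h.a_mem i).1]⟩

lemma expect_pair_mem (hn : 0 < n) (h : AdmissibleWeights ε a b) (i : Fin n) :
    𝔼 j, (1 - b i j) ∈ Set.Icc (0 : ℝ) 1 := by
  constructor
  · exact Finset.expect_nonneg fun j _ => by linarith [(h.b_mem i j).2]
  · rw [← expect_const_fin hn (1 : ℝ)]
    exact Finset.expect_le_expect fun j _ => by
      rw [expect_const_fin hn]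
      linarith [(h.b_mem i j).1]

lemma expect_pair_le (hn : 0 < n) (h : AdmissibleWeights ε a b) :
    𝔼 i, 𝔼 j, (1 - b i j) ≤ 4 * ε := by
  simp_rw [Finset.expect_sub_distrib, expect_const_fin hn]
  linarith [h.total]

/-- The marginal condition gives 2ε a_i; the looser 4ε matches the threshold in the removal bounds.
-/
lemma expect_gap_le (hn : 0 < n) (hε : 0 ≤ ε) (h : AdmissibleWeights ε a b) (i : Fin n) :
    𝔼 j, (a i - b i j) ≤ 4 * ε := by
  rw [Finset.expect_sub_distrib, expect_const_fin hn]
  obtain ⟨h0, h1⟩ := h.a_mem i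
  nlinarith [h.marginal i]

lemma gap_mem (h : AdmissibleWeights ε a b) (i j : Fin n) : a i - b i j ∈ Set.Icc (0 : ℝ) 1 :=
  ⟨by linarith [h.le_point i j], by linarith [(h.a_mem i).2, (h.b_mem i j).1]⟩

end AdmissibleWeights

end Weights

/-! ### Deterministic estimates for stable samples -/

section StableBounds

variable {d n : ℕ} {ε κ : ℝ} {ψ : Fin n → EuclideanSpace ℝ (Fin d)}

/-- The centred value of the quadratic form `P` on half the squared difference of two points. -/
noncomputable def pairForm (ψ : Fin n → EuclideanSpace ℝ (Fin d)) (P : Matrix (Fin d) (Fin d) ℝ)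
    (i j : Fin n) : ℝ :=
  1 / 2 * quadForm P (ψ i - ψ j) - 𝔼 k, quadForm P (ψ k)

lemma pairForm_eq {P : Matrix (Fin d) (Fin d) ℝ} (hP : P.IsSymm) (i j : Fin n) :
    pairForm ψ P i j = 1 / 2 * centredForm ψ P i + 1 / 2 * centredForm ψ P j -
      inner ℝ (ψ i) (matAct P (ψ j)) := by
  unfold pairForm centredForm
  rw [quadForm_sub hP]
  ring

lemma expect_centredForm (hn : 0 < n) (P : Matrix (Fin d) (Fin d) ℝ) :
    𝔼 i, centredForm ψ P i = 0 := by
  unfold centredForm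
  rw [Finset.expect_sub_distrib, expect_const_fin hn, sub_self]

namespace StableSample

variable (hn : 0 < n) (hε0 : 0 < ε) (hε1 : ε < 1) (hεκ : ε ≤ κ) (h : StableSample ψ ε κ)

include h

lemma abs_expect_inner_sq_sub_le (v : EuclideanSpace ℝ (Fin d)) :
    |𝔼 i, inner ℝ (ψ i) v ^ 2 - ‖v‖ ^ 2| ≤ ε / 2 * ‖v‖ ^ 2 := by
  have h1 := h.trace_close (outerSq v) (outerSq_isSymm v)
  simpa only [quadForm_outerSq, trace_outerSq, frobNorm_outerSq] using h1

/-- The trace estimate is applied to P², with tr P² = ‖P‖_F² and ‖P²‖_F ≤ ‖P‖_F². -/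
lemma abs_expect_norm_matAct_sq_sub_le {P : Matrix (Fin d) (Fin d) ℝ} (hP : P.IsSymm)
    (hε0 : 0 < ε) : |𝔼 i, ‖matAct P (ψ i)‖ ^ 2 - frobNorm P ^ 2| ≤ ε / 2 * frobNorm P ^ 2 := by
  have h1 := h.trace_close (P * P) (isSymm_mul_self hP)
  have h2 : (P * P).trace = frobNorm P ^ 2 := by rw [frobNorm_sq_eq_trace, hP.eq]
  simp_rw [quadForm_mul_self hP, h2] at h1
  refine h1.trans ?_
  rw [sq]
  exact mul_le_mul_of_nonneg_left (frobNorm_mul_le P P) (by linarith)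

include hn hε0 hεκ

omit hn in
-- Cauchy–Schwarz turns the removal bound for squares into one for the forms themselves, with 4 ·
-- 25201 ≤ 318². Used with P = v vᵀ and with P², it yields the two removal bounds that follow.
lemma expect_mul_quadForm_le {w : Fin n → ℝ} (hw : ∀ i, w i ∈ Set.Icc (0 : ℝ) 1)
    (hwε : 𝔼 i, w i ≤ 4 * ε) {P : Matrix (Fin d) (Fin d) ℝ} (hP : P.IsSymm) :
    𝔼 i, w i * quadForm P (ψ i) ≤ 318 * κ * frobNorm P + 4 * ε * |𝔼 i, quadForm P (ψ i)| := by
  have h1 := abs_expect_mul_le (fun i => (hw i).1) hε0.le hεκ hwε (h.removal w hw hwε P hP)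
    (by norm_num) (frobNorm_nonneg P) (by norm_num : (0 : ℝ) ≤ 318) (by norm_num)
  have h2 : 𝔼 i, w i * quadForm P (ψ i) = 𝔼 i, w i * centredForm ψ P i +
      (𝔼 i, w i) * 𝔼 i, quadForm P (ψ i) := by
    rw [Finset.expect_mul, ← Finset.expect_add_distrib]
    refine Finset.expect_congr rfl fun i _ => ?_
    unfold centredForm
    ring
  have hw0 : 0 ≤ 𝔼 i, w i := Finset.expect_nonneg fun i _ => (hw i).1
  have h3 : (𝔼 i, w i) * 𝔼 i, quadForm P (ψ i) ≤ 4 * ε * |𝔼 i, quadForm P (ψ i)| :=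
    (mul_le_mul_of_nonneg_left (le_abs_self _) hw0).trans
      (mul_le_mul_of_nonneg_right hwε (abs_nonneg _))
  linarith [le_abs_self (𝔼 i, w i * centredForm ψ P i)]

include hε1

omit hn in
lemma expect_mul_inner_sq_le {w : Fin n → ℝ} (hw : ∀ i, w i ∈ Set.Icc (0 : ℝ) 1)
    (hwε : 𝔼 i, w i ≤ 4 * ε) (v : EuclideanSpace ℝ (Fin d)) :
    𝔼 i, w i * inner ℝ (ψ i) v ^ 2 ≤ 324 * κ * ‖v‖ ^ 2 := by
  have h1 := h.expect_mul_quadForm_le hε0 hεκ hw hwε (outerSq_isSymm v)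
  simp_rw [quadForm_outerSq, frobNorm_outerSq] at h1
  have h2 := abs_le.1 (h.abs_expect_inner_sq_sub_le v)
  have h3 : |𝔼 i, inner ℝ (ψ i) v ^ 2| ≤ 3 / 2 * ‖v‖ ^ 2 := by
    rw [abs_of_nonneg (Finset.expect_nonneg fun i _ => sq_nonneg _)]
    nlinarith [h2.2, sq_nonneg ‖v‖]
  have h4 : 4 * ε * |𝔼 i, inner ℝ (ψ i) v ^ 2| ≤ 4 * κ * (3 / 2 * ‖v‖ ^ 2) := by
    have hκ0 : 0 ≤ κ := hε0.le.trans hεκ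
    gcongr
  linarith

omit hn in
lemma expect_mul_norm_matAct_sq_le {w : Fin n → ℝ} (hw : ∀ i, w i ∈ Set.Icc (0 : ℝ) 1)
    (hwε : 𝔼 i, w i ≤ 4 * ε) {P : Matrix (Fin d) (Fin d) ℝ} (hP : P.IsSymm) :
    𝔼 i, w i * ‖matAct P (ψ i)‖ ^ 2 ≤ 324 * κ * frobNorm P ^ 2 := by
  have h1 := h.expect_mul_quadForm_le hε0 hεκ hw hwε (isSymm_mul_self hP)
  simp_rw [quadForm_mul_self hP] at h1
  have hκ0 : 0 ≤ κ := hε0.le.trans hεκ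
  have h2 := abs_le.1 (h.abs_expect_norm_matAct_sq_sub_le hP hε0)
  have h3 : |𝔼 i, ‖matAct P (ψ i)‖ ^ 2| ≤ 3 / 2 * frobNorm P ^ 2 := by
    rw [abs_of_nonneg (Finset.expect_nonneg fun i _ => sq_nonneg _)]
    nlinarith [h2.2, sq_nonneg (frobNorm P)]
  have h4 : 4 * ε * |𝔼 i, ‖matAct P (ψ i)‖ ^ 2| ≤ 4 * κ * (3 / 2 * frobNorm P ^ 2) := by
    gcongr
  have h5 : 318 * κ * frobNorm (P * P) ≤ 318 * κ * frobNorm P ^ 2 := by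
    rw [sq]
    gcongr
    exact frobNorm_mul_le P P
  linarith

variable {a : Fin n → ℝ} {b : Fin n → Fin n → ℝ} (hab : AdmissibleWeights ε a b)

include hab

/-- The full average vanishes, so only the removed weights 1 - a_i contribute; 36² = 4 · 324. -/
lemma abs_expect_mul_inner_le (v : EuclideanSpace ℝ (Fin d)) :
    |𝔼 i, a i * inner ℝ (ψ i) v| ≤ 36 * κ * ‖v‖ := by
  have h1 := abs_expect_mul_le (fun i => (hab.one_sub_mem i).1) hε0.le hεκ
    (hab.expect_one_sub_le hn) (h.expect_mul_inner_sq_le hε0 hε1 hεκ hab.one_sub_mem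
      (hab.expect_one_sub_le hn) v) (by norm_num) (norm_nonneg v) (by norm_num : (0 : ℝ) ≤ 36)
    (by norm_num)
  have h2 : 𝔼 i, (1 - a i) * inner ℝ (ψ i) v = -𝔼 i, a i * inner ℝ (ψ i) v := by
    simp_rw [sub_mul, one_mul]
    rw [Finset.expect_sub_distrib, h.mean_zero, zero_sub]
  rwa [h2, abs_neg] at h1

lemma abs_expect_mul_inner_sq_sub_le (v : EuclideanSpace ℝ (Fin d)) :
    |𝔼 i, a i * (inner ℝ (ψ i) v ^ 2 - 𝔼 j, inner ℝ (ψ j) v ^ 2)| ≤ 330 * κ * ‖v‖ ^ 2 := by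
  set V := 𝔼 j, inner ℝ (ψ j) v ^ 2 with hV
  have hκ0 : 0 ≤ κ := hε0.le.trans hεκ
  have hV0 : 0 ≤ V := Finset.expect_nonneg fun i _ => sq_nonneg _
  have hV1 : V ≤ 3 / 2 * ‖v‖ ^ 2 := by
    nlinarith [(abs_le.1 (h.abs_expect_inner_sq_sub_le v)).2, sq_nonneg ‖v‖]
  have h1 := h.expect_mul_inner_sq_le hε0 hε1 hεκ hab.one_sub_mem (hab.expect_one_sub_le hn) v
  have h1' : 0 ≤ 𝔼 i, (1 - a i) * inner ℝ (ψ i) v ^ 2 :=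
    Finset.expect_nonneg fun i _ => mul_nonneg (hab.one_sub_mem i).1 (sq_nonneg _)
  have h2 : 𝔼 i, a i * (inner ℝ (ψ i) v ^ 2 - V) =
      (𝔼 i, (1 - a i)) * V - 𝔼 i, (1 - a i) * inner ℝ (ψ i) v ^ 2 := by
    rw [Finset.expect_mul, ← Finset.expect_sub_distrib]
    have h3 : 𝔼 i, (inner ℝ (ψ i) v ^ 2 - V) = 0 := by
      rw [Finset.expect_sub_distrib, expect_const_fin hn, ← hV, sub_self]
    rw [← sub_zero (𝔼 i, a i * _), ← h3, ← Finset.expect_sub_distrib]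
    exact Finset.expect_congr rfl fun i _ => by ring
  have h4 : 0 ≤ 𝔼 i, (1 - a i) := Finset.expect_nonneg fun i _ => (hab.one_sub_mem i).1
  have h5 : (𝔼 i, (1 - a i)) * V ≤ (4 * κ) * (3 / 2 * ‖v‖ ^ 2) := by
    have := hab.expect_one_sub_le hn
    gcongr
    linarith
  have h6 : 0 ≤ (𝔼 i, (1 - a i)) * V := mul_nonneg h4 hV0
  have h7 : 0 ≤ κ * ‖v‖ ^ 2 := by positivity
  rw [h2, abs_le]
  constructor <;> linarith

omit hn hε0 hε1 hεκ hab in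
lemma expect_inner_matAct_sq (i : Fin n) {P : Matrix (Fin d) (Fin d) ℝ} (hP : P.IsSymm) :
    |𝔼 j, inner ℝ (ψ i) (matAct P (ψ j)) ^ 2 - ‖matAct P (ψ i)‖ ^ 2| ≤
      ε / 2 * ‖matAct P (ψ i)‖ ^ 2 := by
  have h1 := h.abs_expect_inner_sq_sub_le (matAct P (ψ i))
  have h2 : ∀ j, inner ℝ (ψ i) (matAct P (ψ j)) = inner ℝ (ψ j) (matAct P (ψ i)) := by
    intro j
    rw [inner_matAct_eq, hP.eq, real_inner_comm]
  simp_rw [h2]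
  exact h1

/-- Split 1 - b_ij as (1 - a_i) + (a_i - b_ij). For the first part the average over j is about
‖Pψ_i‖², and removal over i applies. For the second, i is fixed and removal over j is applied in the
direction Pψ_i. Each part contributes 486 κ. -/
lemma expect_pair_mul_inner_sq_le {P : Matrix (Fin d) (Fin d) ℝ} (hP : P.IsSymm) :
    𝔼 i, 𝔼 j, (1 - b i j) * inner ℝ (ψ i) (matAct P (ψ j)) ^ 2 ≤ 972 * κ * frobNorm P ^ 2 := by
  have hκ0 : 0 ≤ κ := hε0.le.trans hεκ
  have hi : ∀ i, 𝔼 j, (1 - b i j) * inner ℝ (ψ i) (matAct P (ψ j)) ^ 2 ≤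
      3 / 2 * ((1 - a i) * ‖matAct P (ψ i)‖ ^ 2) + 324 * κ * ‖matAct P (ψ i)‖ ^ 2 := by
    intro i
    have h1 : 𝔼 j, (1 - b i j) * inner ℝ (ψ i) (matAct P (ψ j)) ^ 2 =
        (1 - a i) * 𝔼 j, inner ℝ (ψ i) (matAct P (ψ j)) ^ 2 +
        𝔼 j, (a i - b i j) * inner ℝ (ψ i) (matAct P (ψ j)) ^ 2 := by
      rw [Finset.mul_expect, ← Finset.expect_add_distrib]
      exact Finset.expect_congr rfl fun j _ => by ring
    have h2 := (abs_le.1 (h.expect_inner_matAct_sq i hP)).2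
    have h3 : 𝔼 j, inner ℝ (ψ i) (matAct P (ψ j)) ^ 2 ≤ 3 / 2 * ‖matAct P (ψ i)‖ ^ 2 := by
      nlinarith [sq_nonneg ‖matAct P (ψ i)‖]
    have h4 := h.expect_mul_inner_sq_le hε0 hε1 hεκ (hab.gap_mem i)
      (hab.expect_gap_le hn hε0.le i) (matAct P (ψ i))
    have h5 : ∀ j, inner ℝ (ψ i) (matAct P (ψ j)) = inner ℝ (ψ j) (matAct P (ψ i)) := by
      intro j
      rw [inner_matAct_eq, hP.eq, real_inner_comm]
    have h6 := mul_le_mul_of_nonneg_left h3 (hab.one_sub_mem i).1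
    rw [h1]
    simp_rw [h5] at h6 ⊢
    linarith
  refine (Finset.expect_le_expect fun i _ => hi i).trans ?_
  rw [Finset.expect_add_distrib, ← Finset.mul_expect, ← Finset.mul_expect]
  have h1 := h.expect_mul_norm_matAct_sq_le hε0 hε1 hεκ hab.one_sub_mem
    (hab.expect_one_sub_le hn) hP
  have h2 := (abs_le.1 (h.abs_expect_norm_matAct_sq_sub_le hP hε0)).2
  have h3 : 𝔼 i, ‖matAct P (ψ i)‖ ^ 2 ≤ 3 / 2 * frobNorm P ^ 2 := by
    nlinarith [sq_nonneg (frobNorm P)]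
  have h4 : 324 * κ * 𝔼 i, ‖matAct P (ψ i)‖ ^ 2 ≤ 324 * κ * (3 / 2 * frobNorm P ^ 2) := by
    gcongr
  linarith

/-- The square of a three-term sum is at most three times the sum of squares. Symmetry of b makes
the two one-point terms equal, and their weights 𝔼_j (1 - b_ij) are again admissible for removal. -/
lemma expect_pair_mul_pairForm_sq_le {P : Matrix (Fin d) (Fin d) ℝ} (hP : P.IsSymm) :
    𝔼 i, 𝔼 j, (1 - b i j) * pairForm ψ P i j ^ 2 ≤ 41000 * κ * frobNorm P ^ 2 := by
  have hκ0 : 0 ≤ κ := hε0.le.trans hεκ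
  have h1 : ∀ i j, (1 - b i j) * pairForm ψ P i j ^ 2 ≤
      3 / 4 * ((1 - b i j) * centredForm ψ P i ^ 2) + 3 / 4 * ((1 - b i j) * centredForm ψ P j ^ 2) +
      3 * ((1 - b i j) * inner ℝ (ψ i) (matAct P (ψ j)) ^ 2) := by
    intro i j
    rw [pairForm_eq hP]
    set x := centredForm ψ P i
    set y := centredForm ψ P j
    set c : ℝ := inner ℝ (ψ i) (matAct P (ψ j))
    have h2 : (1 / 2 * x + 1 / 2 * y - c) ^ 2 ≤ 3 / 4 * x ^ 2 + 3 / 4 * y ^ 2 + 3 * c ^ 2 := by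
      nlinarith [sq_nonneg (1 / 2 * x - 1 / 2 * y), sq_nonneg (1 / 2 * x + c),
        sq_nonneg (1 / 2 * y + c)]
    have h3 : 0 ≤ 1 - b i j := by linarith [(hab.b_mem i j).2]
    nlinarith
  refine (Finset.expect_le_expect fun i _ => Finset.expect_le_expect fun j _ => h1 i j).trans ?_
  simp_rw [Finset.expect_add_distrib, ← Finset.mul_expect]
  have h2 : 𝔼 i, 𝔼 j, (1 - b i j) * centredForm ψ P i ^ 2 =
      𝔼 i, (𝔼 j, (1 - b i j)) * centredForm ψ P i ^ 2 :=
    Finset.expect_congr rfl fun i _ => by rw [Finset.expect_mul]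
  have h3 : 𝔼 i, 𝔼 j, (1 - b i j) * centredForm ψ P j ^ 2 =
      𝔼 i, (𝔼 j, (1 - b i j)) * centredForm ψ P i ^ 2 := by
    rw [Finset.expect_comm]
    refine Finset.expect_congr rfl fun i _ => ?_
    rw [Finset.expect_mul]
    exact Finset.expect_congr rfl fun j _ => by rw [hab.symm i j]
  have h4 := h.removal (fun i => 𝔼 j, (1 - b i j)) (hab.expect_pair_mem hn)
    (hab.expect_pair_le hn) P hP
  have h5 := h.expect_pair_mul_inner_sq_le hn hε0 hε1 hεκ hab hP
  rw [h2, h3]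
  have h7 : 0 ≤ κ * frobNorm P ^ 2 := by positivity
  have h6 : 𝔼 i, 𝔼 j, (1 - b i j) * centredForm ψ P i ^ 2 = _ := h2
  linarith

omit hab hεκ in
-- Mixed terms average to zero because both ψ and its centred forms have mean zero. The one-point
-- terms and the squared cross term then each contribute about ‖P‖_F², which gives the 2.
lemma abs_expect_pairForm_sq_sub_le {P : Matrix (Fin d) (Fin d) ℝ} (hP : P.IsSymm) :
    |𝔼 i, 𝔼 j, pairForm ψ P i j ^ 2 - 2 * frobNorm P ^ 2| ≤ 6 * ε * frobNorm P ^ 2 := by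
  set r := centredForm ψ P with hr
  have hr0 : 𝔼 i, r i = 0 := expect_centredForm hn P
  have hc0 : ∀ i, 𝔼 j, inner ℝ (ψ i) (matAct P (ψ j)) = 0 := by
    intro i
    have h1 := h.mean_zero (matAct P (ψ i))
    rw [← h1]
    refine Finset.expect_congr rfl fun j _ => ?_
    rw [inner_matAct_eq, hP.eq, real_inner_comm]
  have hc0' : ∀ j, 𝔼 i, inner ℝ (ψ i) (matAct P (ψ j)) = 0 := fun j => h.mean_zero _
  have h1 : ∀ i, 𝔼 j, pairForm ψ P i j ^ 2 = 1 / 4 * r i ^ 2 + 1 / 4 * 𝔼 j, r j ^ 2 +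
      𝔼 j, inner ℝ (ψ i) (matAct P (ψ j)) ^ 2 -
      𝔼 j, r j * inner ℝ (ψ i) (matAct P (ψ j)) := by
    intro i
    have h2 : ∀ j, pairForm ψ P i j ^ 2 = 1 / 4 * r i ^ 2 + 1 / 4 * r j ^ 2 +
        inner ℝ (ψ i) (matAct P (ψ j)) ^ 2 - r j * inner ℝ (ψ i) (matAct P (ψ j)) +
        1 / 2 * r i * r j - r i * inner ℝ (ψ i) (matAct P (ψ j)) := by
      intro j
      rw [pairForm_eq hP]
      ring
    simp_rw [h2]
    simp only [Finset.expect_add_distrib, Finset.expect_sub_distrib, ← Finset.mul_expect,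
      expect_const_fin hn, hr0, hc0 i]
    ring
  have h2 : 𝔼 i, 𝔼 j, r j * inner ℝ (ψ i) (matAct P (ψ j)) = 0 := by
    rw [Finset.expect_comm]
    apply Finset.expect_eq_zero
    intro j _
    rw [← Finset.mul_expect, hc0', mul_zero]
  have h3 : 𝔼 i, 𝔼 j, pairForm ψ P i j ^ 2 = 1 / 2 * 𝔼 i, r i ^ 2 +
      𝔼 i, 𝔼 j, inner ℝ (ψ i) (matAct P (ψ j)) ^ 2 := by
    simp_rw [h1]
    simp only [Finset.expect_add_distrib, Finset.expect_sub_distrib, ← Finset.mul_expect,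
      expect_const_fin hn, h2]
    ring
  have h4 := abs_le.1 (h.second P hP)
  have h5 := abs_le.1 (h.abs_expect_norm_matAct_sq_sub_le hP hε0)
  have h6 : |𝔼 i, 𝔼 j, inner ℝ (ψ i) (matAct P (ψ j)) ^ 2 - 𝔼 i, ‖matAct P (ψ i)‖ ^ 2| ≤
      ε / 2 * 𝔼 i, ‖matAct P (ψ i)‖ ^ 2 := by
    rw [← Finset.expect_sub_distrib]
    refine (Finset.abs_expect_le _ _).trans ?_
    rw [Finset.mul_expect]
    exact Finset.expect_le_expect fun i _ => h.expect_inner_matAct_sq i hP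
  have h7 := abs_le.1 h6
  have hf2 := sq_nonneg (frobNorm P)
  have h8 : ε / 2 * 𝔼 i, ‖matAct P (ψ i)‖ ^ 2 ≤ ε / 2 * (3 / 2 * frobNorm P ^ 2) := by
    gcongr
    nlinarith
  have h9 : 0 ≤ ε * frobNorm P ^ 2 := by positivity
  rw [h3, abs_le]
  constructor <;> linarith

lemma abs_expect_pair_mul_pairForm_sq_sub_le {P : Matrix (Fin d) (Fin d) ℝ} (hP : P.IsSymm) :
    |𝔼 i, 𝔼 j, b i j * (pairForm ψ P i j ^ 2 - 2 * frobNorm P ^ 2)| ≤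
      41014 * κ * frobNorm P ^ 2 := by
  have h1 := abs_le.1 (h.abs_expect_pairForm_sq_sub_le hn hε0 hε1 hP)
  have h2 := h.expect_pair_mul_pairForm_sq_le hn hε0 hε1 hεκ hab hP
  have h2' : 0 ≤ 𝔼 i, 𝔼 j, (1 - b i j) * pairForm ψ P i j ^ 2 :=
    Finset.expect_nonneg fun i _ => Finset.expect_nonneg fun j _ =>
      mul_nonneg (by linarith [(hab.b_mem i j).2]) (sq_nonneg _)
  have h3 : 𝔼 i, 𝔼 j, b i j * (pairForm ψ P i j ^ 2 - 2 * frobNorm P ^ 2) =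
      (𝔼 i, 𝔼 j, pairForm ψ P i j ^ 2 - 2 * frobNorm P ^ 2) -
      𝔼 i, 𝔼 j, (1 - b i j) * pairForm ψ P i j ^ 2 +
      (𝔼 i, 𝔼 j, (1 - b i j)) * (2 * frobNorm P ^ 2) := by
    have h4 : ∀ i j, b i j * (pairForm ψ P i j ^ 2 - 2 * frobNorm P ^ 2) =
        pairForm ψ P i j ^ 2 - 2 * frobNorm P ^ 2 - (1 - b i j) * pairForm ψ P i j ^ 2 +
        (1 - b i j) * (2 * frobNorm P ^ 2) := fun i j => by ring
    simp_rw [h4]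
    rw [Finset.expect_mul]
    simp_rw [Finset.expect_mul]
    simp only [Finset.expect_add_distrib, Finset.expect_sub_distrib, expect_const_fin hn]
  have h5 := hab.expect_pair_le hn
  have h6 : 0 ≤ 𝔼 i, 𝔼 j, (1 - b i j) := Finset.expect_nonneg fun i _ =>
    (hab.expect_pair_mem hn i).1
  have hf2 := sq_nonneg (frobNorm P)
  have h7 : (𝔼 i, 𝔼 j, (1 - b i j)) * (2 * frobNorm P ^ 2) ≤ 4 * ε * (2 * frobNorm P ^ 2) := by
    gcongr
  have h8 : 0 ≤ (𝔼 i, 𝔼 j, (1 - b i j)) * (2 * frobNorm P ^ 2) := by positivity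
  have h9 : ε * frobNorm P ^ 2 ≤ κ * frobNorm P ^ 2 := by gcongr
  rw [h3, abs_le]
  constructor <;> linarith

/-- The full pair average vanishes, so Cauchy–Schwarz over pairs with weights 1 - b_ij suffices; 4 ·
41000 ≤ 405². -/
lemma abs_expect_pair_mul_pairForm_le {P : Matrix (Fin d) (Fin d) ℝ} (hP : P.IsSymm) :
    |𝔼 i, 𝔼 j, b i j * pairForm ψ P i j| ≤ 405 * κ * frobNorm P := by
  have h0 : 𝔼 i, 𝔼 j, pairForm ψ P i j = 0 := by
    simp_rw [pairForm_eq hP]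
    simp only [Finset.expect_add_distrib, Finset.expect_sub_distrib, ← Finset.mul_expect,
      expect_const_fin hn, expect_centredForm hn]
    rw [Finset.expect_comm]
    simp [h.mean_zero]
  have h1 : 𝔼 i, 𝔼 j, b i j * pairForm ψ P i j = -𝔼 i, 𝔼 j, (1 - b i j) * pairForm ψ P i j := by
    simp_rw [sub_mul, one_mul, Finset.expect_sub_distrib]
    rw [h0]
    ring
  have h2 := h.expect_pair_mul_pairForm_sq_le hn hε0 hε1 hεκ hab hP
  have h3 := hab.expect_pair_le hn
  rw [← expect_prod_eq fun i j => (1 - b i j) * pairForm ψ P i j ^ 2] at h2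
  rw [← expect_prod_eq fun i j => 1 - b i j] at h3
  rw [h1, abs_neg, ← expect_prod_eq fun i j => (1 - b i j) * pairForm ψ P i j]
  exact abs_expect_mul_le (fun p => by linarith [(hab.b_mem p.1 p.2).2]) hε0.le hεκ h3 h2
    (by norm_num) (frobNorm_nonneg P) (by norm_num) (by norm_num)

end StableSample

end StableBounds

/-! ### Transfer to a general mean and covariance -/

section Whitening

variable {d n : ℕ} {S : Matrix (Fin d) (Fin d) ℝ}

lemma isSymm_sqrt (S : Matrix (Fin d) (Fin d) ℝ) : (CFC.sqrt S).IsSymm := by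
  have h := (Matrix.nonneg_iff_posSemidef.1 (CFC.sqrt_nonneg S)).isHermitian
  rwa [Matrix.IsHermitian, conjTranspose_eq_transpose_of_trivial] at h

lemma inner_matAct_of_isSymm {T : Matrix (Fin d) (Fin d) ℝ} (hT : T.IsSymm)
    (u v : EuclideanSpace ℝ (Fin d)) : inner ℝ (matAct T u) v = inner ℝ u (matAct T v) := by
  rw [inner_matAct_eq, hT.eq]

lemma quadForm_matAct {T : Matrix (Fin d) (Fin d) ℝ} (hT : T.IsSymm)
    (P : Matrix (Fin d) (Fin d) ℝ) (w : EuclideanSpace ℝ (Fin d)) :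
    quadForm P (matAct T w) = quadForm (T * P * T) w := by
  rw [quadForm_eq_inner, quadForm_eq_inner, inner_matAct_of_isSymm hT, matAct_mul, matAct_mul]

lemma isSymm_sandwich {T P : Matrix (Fin d) (Fin d) ℝ} (hT : T.IsSymm) (hP : P.IsSymm) :
    (T * P * T).IsSymm := by
  rw [Matrix.IsSymm, transpose_mul, transpose_mul, hT.eq, hP.eq, Matrix.mul_assoc]

lemma quadForm_eq_norm_sqrt (hS : S.PosSemidef) (v : EuclideanSpace ℝ (Fin d)) :
    quadForm S v = ‖matAct (CFC.sqrt S) v‖ ^ 2 := by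
  rw [← real_inner_self_eq_norm_sq, inner_matAct_of_isSymm (isSymm_sqrt S), ← matAct_mul,
    CFC.sqrt_mul_sqrt_self S hS.nonneg, quadForm_eq_inner]

lemma matInner_eq_trace_sqrt (hS : S.PosSemidef) (P : Matrix (Fin d) (Fin d) ℝ) :
    matInner S P = (CFC.sqrt S * P * CFC.sqrt S).trace := by
  have h : Sᵀ = CFC.sqrt S * CFC.sqrt S := by
    rw [CFC.sqrt_mul_sqrt_self S hS.nonneg, ← conjTranspose_eq_transpose_of_trivial]
    exact hS.isHermitian
  rw [matInner, h, Matrix.mul_assoc, Matrix.trace_mul_comm]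

lemma matInner_expect_left (A : Fin n → Matrix (Fin d) (Fin d) ℝ) (P : Matrix (Fin d) (Fin d) ℝ) :
    matInner (𝔼 i, A i) P = 𝔼 i, matInner (A i) P := by
  unfold matInner Finset.expect
  rw [transpose_smul, transpose_sum, smul_mul_assoc, Finset.sum_mul, trace_smul, trace_sum]

lemma matInner_sampleCov (x : Fin n → EuclideanSpace ℝ (Fin d)) (P : Matrix (Fin d) (Fin d) ℝ) :
    matInner (sampleCov x) P = 𝔼 i, quadForm P (x i - sampleMean x) := by
  rw [sampleCov, matInner_expect_left]
  simp_rw [matInner_outerSq]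

lemma quadForm_sampleCov (x : Fin n → EuclideanSpace ℝ (Fin d)) (v : EuclideanSpace ℝ (Fin d)) :
    quadForm (sampleCov x) v = 𝔼 i, inner ℝ (x i - sampleMean x) v ^ 2 := by
  have h : ∀ M : Matrix (Fin d) (Fin d) ℝ, quadForm M v = matInner M (outerSq v) := by
    intro M
    rw [matInner, outerSq, mul_vecMulVec, trace_vecMulVec, quadForm, mulVec_transpose,
      dotProduct_mulVec]
  rw [h, matInner_sampleCov]
  simp_rw [quadForm_outerSq]

lemma matInner_pairedMat (x : Fin n → EuclideanSpace ℝ (Fin d)) (P : Matrix (Fin d) (Fin d) ℝ)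
    (i j : Fin n) : matInner (pairedMat x i j) P = 1 / 2 * quadForm P (x i - x j) := by
  rw [← matInner_outerSq, matInner, pairedMat, transpose_smul, smul_mul_assoc, trace_smul,
    smul_eq_mul, matInner]

lemma sampleMean_add_matAct (hn : 0 < n) (μ : EuclideanSpace ℝ (Fin d))
    (T : Matrix (Fin d) (Fin d) ℝ) (z : Fin n → EuclideanSpace ℝ (Fin d)) :
    sampleMean (fun i => μ + matAct T (z i)) = μ + matAct T (sampleMean z) := by
  have : Nonempty (Fin n) := ⟨⟨0, hn⟩⟩
  have h : 𝔼 i, matAct T (z i) = matAct T (sampleMean z) := by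
    unfold sampleMean Finset.expect
    rw [map_nnrat_smul, map_sum]
  rw [sampleMean, Finset.expect_add_distrib, h, Finset.expect_const Finset.univ_nonempty]

lemma softO_sq_eq {ε : ℝ} (hε0 : 0 < ε) (hε1 : ε < 1) (C : ℝ) :
    softO C 2 ε = C * (ε * (1 + Real.log (1 / ε)) ^ 2) := by
  rw [softO, abs_of_neg (Real.log_neg hε0 hε1), one_div, Real.log_inv]
  ring

/-- The seven estimates for a sample that is the image of a good sample under the affine map
`z ↦ μ + S^{1/2} z`. -/
theorem estimates_of_goodSample (hn : 0 < n) {ε : ℝ} (hε0 : 0 < ε) (hε1 : ε < 1)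
    (hS : S.PosSemidef) {μ : EuclideanSpace ℝ (Fin d)} {x z : Fin n → EuclideanSpace ℝ (Fin d)}
    (hx : ∀ i, x i = μ + matAct (CFC.sqrt S) (z i))
    {Q : EuclideanSpace ℝ (Fin d) → ℝ} (hz : GoodSample z Q ε)
    (hφ : GoodSample (fun i => outerVec (z i)) (fun u => 2 * frobNorm (symPart u) ^ 2) ε)
    {a : Fin n → ℝ} {b : Fin n → Fin n → ℝ} (hab : AdmissibleWeights ε a b)
    (v : EuclideanSpace ℝ (Fin d)) {P : Matrix (Fin d) (Fin d) ℝ} (hP : P.IsSymm) :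
    |inner ℝ (μ - sampleMean x) v| ≤ softO 50000 2 ε * √(quadForm S v) ∧
    |𝔼 i, a i * inner ℝ (x i - sampleMean x) v| ≤
      softO 50000 2 ε * √(quadForm (sampleCov x) v) ∧
    |𝔼 i, a i * ((inner ℝ (x i - sampleMean x) v) ^ 2 - quadForm (sampleCov x) v)| ≤
      softO 50000 2 ε * quadForm (sampleCov x) v ∧
    |matInner (sampleCov x - S) P| ≤ softO 50000 2 ε * scaledFrob S P ∧
    |𝔼 i, ((matInner (outerSq (x i - sampleMean x) - sampleCov x) P) ^ 2 -
        2 * scaledFrob S P ^ 2)| ≤ softO 50000 2 ε * scaledFrob S P ^ 2 ∧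
    |𝔼 i, 𝔼 j, b i j * matInner (pairedMat x i j - sampleCov x) P| ≤
      softO 50000 2 ε * scaledFrob S P ∧
    |𝔼 i, 𝔼 j, b i j * ((matInner (pairedMat x i j - sampleCov x) P) ^ 2 -
        2 * scaledFrob S P ^ 2)| ≤ softO 50000 2 ε * scaledFrob S P ^ 2 := by
  obtain rfl : x = fun i => μ + matAct (CFC.sqrt S) (z i) := funext hx
  set T := CFC.sqrt S with hTdef
  have hT : T.IsSymm := isSymm_sqrt S
  set x : Fin n → EuclideanSpace ℝ (Fin d) := fun i => μ + matAct T (z i) with hxdef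
  set ψ : Fin n → EuclideanSpace ℝ (Fin d) := fun i => z i - sampleMean z with hψ
  have hmean : sampleMean x = μ + matAct T (sampleMean z) := sampleMean_add_matAct hn μ T z
  have hxψ : ∀ i, x i - sampleMean x = matAct T (ψ i) := by
    intro i
    rw [hmean, hxdef, hψ, map_sub, add_sub_add_left_eq_sub]
  have hxx : ∀ i j, x i - x j = matAct T (ψ i - ψ j) := by
    intro i j
    simp only [hxdef, hψ, map_sub, add_sub_add_left_eq_sub, sub_sub_sub_cancel_right]
  set κ := ε * (1 + Real.log (1 / ε)) ^ 2 with hκ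
  have hs : softO 50000 2 ε = 50000 * κ := softO_sq_eq hε0 hε1 _
  have hlog : 0 ≤ Real.log (1 / ε) := Real.log_nonneg (by rw [le_div_iff₀ hε0]; linarith)
  have hεκ : ε ≤ κ := le_mul_of_one_le_right hε0.le (one_le_pow₀ (by linarith))
  have hκ0 : 0 < κ := hε0.trans_le hεκ
  have h : StableSample ψ ε κ := stableSample_of_goodSample hn hε0 hε1 hκ hz hφ
  set R := T * P * T with hR
  have hRs : R.IsSymm := isSymm_sandwich hT hP
  have hF : scaledFrob S P = frobNorm R := rfl
  have hF0 := frobNorm_nonneg R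
  set u := matAct T v with hu
  have hin : ∀ i, inner ℝ (x i - sampleMean x) v = inner ℝ (ψ i) u := by
    intro i
    rw [hxψ, inner_matAct_of_isSymm hT]
  have hq : ∀ i, quadForm P (x i - sampleMean x) = quadForm R (ψ i) := by
    intro i
    rw [hxψ, quadForm_matAct hT]
  have hV : quadForm (sampleCov x) v = 𝔼 i, inner ℝ (ψ i) u ^ 2 := by
    rw [quadForm_sampleCov]
    simp_rw [hin]
  have hC : matInner (sampleCov x) P = 𝔼 i, quadForm R (ψ i) := by
    rw [matInner_sampleCov]
    simp_rw [hq]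
  have hpair : ∀ i j, matInner (pairedMat x i j - sampleCov x) P = pairForm ψ R i j := by
    intro i j
    rw [matInner_sub_left, matInner_pairedMat, hC, hxx, quadForm_matAct hT, pairForm]
  have hcen : ∀ i, matInner (outerSq (x i - sampleMean x) - sampleCov x) P =
      centredForm ψ R i := by
    intro i
    rw [matInner_sub_left, matInner_outerSq, hC, hq, centredForm]
  set V := 𝔼 i, inner ℝ (ψ i) u ^ 2 with hVdef
  -- Items 2 and 3 are measured against the sample covariance, so the true norm of u is exchanged
  -- for V.
  have hVu : ‖u‖ ^ 2 ≤ 2 * V := by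
    nlinarith [(abs_le.1 (h.abs_expect_inner_sq_sub_le u)).1, sq_nonneg ‖u‖]
  have hV0 : 0 ≤ V := Finset.expect_nonneg fun i _ => sq_nonneg _
  rw [hs, hF, hV]
  simp_rw [hin, hpair, hcen]
  refine ⟨?_, ?_, ?_, ?_, ?_, ?_, ?_⟩
  · rw [quadForm_eq_norm_sqrt hS, Real.sqrt_sq (norm_nonneg _), hmean, sub_add_cancel_left,
      inner_neg_left, abs_neg, inner_matAct_of_isSymm hT, inner_sampleMean]
    refine (hz.mean _).trans ?_
    gcongr
    linarith
  · refine (h.abs_expect_mul_inner_le hn hε0 hε1 hεκ hab u).trans ?_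
    have h1 : ‖u‖ ≤ 2 * √V := by
      apply le_of_sq_le_sq _ (by positivity)
      rw [mul_pow, Real.sq_sqrt hV0]
      linarith
    calc 36 * κ * ‖u‖ ≤ 36 * κ * (2 * √V) := by gcongr
      _ = 72 * κ * √V := by ring
      _ ≤ 50000 * κ * √V := by
        gcongr
        norm_num
  · refine (h.abs_expect_mul_inner_sq_sub_le hn hε0 hε1 hεκ hab u).trans ?_
    calc 330 * κ * ‖u‖ ^ 2 ≤ 330 * κ * (2 * V) := by gcongr
      _ = 660 * κ * V := by ring
      _ ≤ 50000 * κ * V := by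
        gcongr
        norm_num
  · rw [matInner_sub_left, hC, matInner_eq_trace_sqrt hS]
    refine (h.trace_close R hRs).trans ?_
    gcongr
    linarith
  · rw [Finset.expect_sub_distrib, expect_const_fin hn]
    refine (h.second R hRs).trans ?_
    gcongr
    linarith
  · refine (h.abs_expect_pair_mul_pairForm_le hn hε0 hε1 hεκ hab hRs).trans ?_
    gcongr
    norm_num
  · refine (h.abs_expect_pair_mul_pairForm_sq_sub_le hn hε0 hε1 hεκ hab hRs).trans ?_
    gcongr
    norm_num

end Whitening

/-! ### Unwinding the sample size condition -/

section SampleSize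

/-- Let n = t s with s ≥ (1000 l)^10 and l = 1 + log t; the constant 10^30 is 1000^10. With r the
tenth root of s, one factor r⁵ absorbs the powers of l, and the other dominates the fifth power of
log n, since log r ≤ r - 1. -/
lemma size_of_softO {D L ε n : ℝ} (hD : 1 ≤ D) (hL : 1 ≤ L) (hε0 : 0 < ε) (hε1 : ε < 1)
    (hn : softO (10 ^ 30) 10 (D ^ 2 * L ^ 5 / ε ^ 2) ≤ n) :
    10 ^ 8 * D ^ 2 * (1 + Real.log n + L) ^ 5 ≤ n * ε ^ 2 := by
  obtain ⟨t, ht⟩ : ∃ t, t = D ^ 2 * L ^ 5 / ε ^ 2 := ⟨_, rfl⟩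
  have htε : t * ε ^ 2 = D ^ 2 * L ^ 5 := by
    rw [ht]
    field_simp
  have ht1 : 1 ≤ t := by
    rw [ht, le_div_iff₀ (by positivity), one_mul]
    exact (pow_le_one₀ hε0.le hε1.le).trans
      (one_le_mul_of_one_le_of_one_le (one_le_pow₀ hD) (one_le_pow₀ hL))
  have ht0 : 0 < t := by linarith
  have hlogt : 0 ≤ Real.log t := Real.log_nonneg ht1
  rw [← ht, softO, abs_of_nonneg hlogt] at hn
  obtain ⟨l, hl⟩ : ∃ l, l = 1 + Real.log t := ⟨_, rfl⟩
  have hl1 : 1 ≤ l := by linarith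
  rw [← hl] at hn
  obtain ⟨s, hs⟩ : ∃ s, s = n / t := ⟨_, rfl⟩
  have hns : n = t * s := by
    rw [hs]
    field_simp
  have hsl : (1000 * l) ^ 10 ≤ s := by
    rw [hs, le_div_iff₀ ht0]
    refine le_trans (le_of_eq ?_) hn
    ring
  have hs0 : 0 < s := lt_of_lt_of_le (by positivity) hsl
  obtain ⟨r, hr⟩ : ∃ r, r = s ^ (1 / 10 : ℝ) := ⟨_, rfl⟩
  have hr0 : 0 < r := by
    rw [hr]
    positivity
  have hr10 : r ^ 10 = s := by
    rw [hr, ← Real.rpow_natCast, ← Real.rpow_mul hs0.le]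
    norm_num
  have hrl : 1000 * l ≤ r := by
    rw [← hr10] at hsl
    exact le_of_pow_le_pow_left₀ (by norm_num) hr0.le hsl
  have hlogs : Real.log s = 10 * Real.log r := by
    rw [← hr10, Real.log_pow]
    norm_num
  have hlogr := Real.log_le_sub_one_of_pos hr0
  have hlogr0 : 0 ≤ Real.log r := Real.log_nonneg (by linarith)
  have hlogn : Real.log n = Real.log t + 10 * Real.log r := by
    rw [hns, Real.log_mul ht0.ne' hs0.ne', hlogs]
  have h1 : 1 + Real.log n ≤ l * (10 * r) := by
    rw [hlogn]
    nlinarith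
  have h0 : 0 ≤ Real.log n := by
    rw [hlogn]
    linarith
  have h2 : 1 + Real.log n + L ≤ 2 * L * (l * (10 * r)) := by nlinarith
  have h3 : (1000 * l) ^ 5 ≤ r ^ 5 := by gcongr
  calc 10 ^ 8 * D ^ 2 * (1 + Real.log n + L) ^ 5
      ≤ 10 ^ 8 * D ^ 2 * (2 * L * (l * (10 * r))) ^ 5 := by gcongr
    _ = (D ^ 2 * L ^ 5) * (32 / 100 * (1000 * l) ^ 5) * r ^ 5 := by ring
    _ ≤ (D ^ 2 * L ^ 5) * r ^ 5 * r ^ 5 := by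
      gcongr
      have : 0 ≤ (1000 * l) ^ 5 := by positivity
      linarith
    _ = n * ε ^ 2 := by
      rw [← htε, hns, ← hr10]
      ring

end SampleSize

/-! ### The Gaussian sample and its standardization -/

section GaussianSample

variable {d n : ℕ}

lemma isSubexpFamily_eval {H : Type*} [MeasurableSpace H] {ν : Measure H} [IsProbabilityMeasure ν]
    {ι : Type*} [Fintype ι] {G : H → EuclideanSpace ℝ ι} (hG : Measurable G)
    (hexp : ∀ u, ‖u‖ ≤ 1 → ∫⁻ z, ENNReal.ofReal (Real.exp (|inner ℝ (G z) u| / 4)) ∂ν ≤ 3)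
    (hmean : ∀ u, ∫ z, inner ℝ (G z) u ∂ν = 0) :
    IsSubexpFamily (fun (i : Fin n) (ω : Fin n → H) => G (ω i)) (Measure.pi fun _ => ν) where
  meas i := hG.comp (measurable_pi_apply i)
  indep := iIndepFun_pi fun _ => hG.aemeasurable
  exp_le i u hu := by
    rw [(measurePreserving_eval (fun _ : Fin n => ν) i).lintegral_comp
      (f := fun z => ENNReal.ofReal (Real.exp (|inner ℝ (G z) u| / 4))) (by fun_prop)]
    exact hexp u hu
  mean i u := by
    rw [integral_comp_eval (μ := fun _ : Fin n => ν) (i := i)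
      (f := fun z => inner ℝ (G z) u) (Measurable.aestronglyMeasurable (by fun_prop))]
    exact hmean u

/-- A standard Gaussian sample and its outer products are good samples with high probability. -/
lemma measureReal_pi_not_goodSample_le (hd : 0 < d) {ε δ : ℝ} (hε0 : 0 < ε) (hε1 : ε < 1)
    (hδ0 : 0 < δ) (hδ1 : δ < 1)
    (hsize : 10 ^ 8 * (d : ℝ) ^ 2 * (1 + Real.log n + Real.log (1 / δ)) ^ 5 ≤ n * ε ^ 2) :
    (Measure.pi fun _ : Fin n => stdGaussian (EuclideanSpace ℝ (Fin d))).real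
      {z | ¬ (GoodSample z (fun u => ∫ y, inner ℝ y u ^ 2 ∂stdGaussian (EuclideanSpace ℝ (Fin d)))
          ε ∧
        GoodSample (fun i => outerVec (z i)) (fun u => 2 * frobNorm (symPart u) ^ 2) ε)} ≤
      10 * δ := by
  have hz := isSubexpFamily_eval (n := n) (G := fun z : EuclideanSpace ℝ (Fin d) => z)
    measurable_id lintegral_exp_inner_stdGaussian_le integral_inner_stdGaussian
  have hφ := isSubexpFamily_eval (n := n) (measurable_outerVec (d := d)) lintegral_exp_outerVec_le
    integral_outerVec
  have h1 := hz.measureReal_not_goodSample_le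
    (Q := fun u => ∫ y, inner ℝ y u ^ 2 ∂stdGaussian (EuclideanSpace ℝ (Fin d)))
    (fun i u => integral_comp_eval (i := i)
      (μ := fun _ : Fin n => stdGaussian (EuclideanSpace ℝ (Fin d)))
      (f := fun y => inner ℝ y u ^ 2) (Measurable.aestronglyMeasurable (by fun_prop)))
    (by simpa using hd) hε0 hε1 hδ0 hδ1 (by
      refine le_trans ?_ hsize
      have hd1 : (1 : ℝ) ≤ d := by exact_mod_cast hd
      have hlog : 0 ≤ Real.log n := Real.log_natCast_nonneg n
      have hlogδ : 0 ≤ Real.log (1 / δ) := Real.log_nonneg (by rw [le_div_iff₀ hδ0]; linarith)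
      rw [Fintype.card_fin]
      gcongr
      nlinarith)
  have h2 := hφ.measureReal_not_goodSample_le (Q := fun u => 2 * frobNorm (symPart u) ^ 2)
    (fun i u => by
      rw [integral_comp_eval (i := i)
        (μ := fun _ : Fin n => stdGaussian (EuclideanSpace ℝ (Fin d)))
        (f := fun y => inner ℝ (outerVec y) u ^ 2)
        (((measurable_outerVec.inner_const).pow_const 2).aestronglyMeasurable)]
      exact integral_outerVec_sq u)
    (by simpa using hd.ne') hε0 hε1 hδ0 hδ1 (by
      rw [Fintype.card_prod, Fintype.card_fin, Nat.cast_mul, ← sq]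
      exact hsize)
  simp_rw [not_and_or, Set.ofPred_or]
  exact (measureReal_union_le _ _).trans (by linarith)

/-- The bad set is an uncountable union over directions and is not shown to be measurable; its
preimage is replaced by a measurable hull of equal measure. -/
lemma exists_measurableSet_of_map {Ω β : Type*} [MeasurableSpace Ω] [MeasurableSpace β]
    {Pr : Measure Ω} [IsProbabilityMeasure Pr] {f : Ω → β} (hf : AEMeasurable f Pr) {p : β → Prop}
    {c : ℝ} (hc : (Pr.map f).real {y | ¬ p y} ≤ c) :
    ∃ E : Set Ω, MeasurableSet E ∧ 1 - c ≤ Pr.real E ∧ ∀ ω ∈ E, p (f ω) := by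
  have := Measure.isProbabilityMeasure_map hf
  set B := f ⁻¹' {y | ¬ p y}
  refine ⟨(toMeasurable Pr B)ᶜ, (measurableSet_toMeasurable _ _).compl, ?_, fun ω hω => ?_⟩
  · rw [probReal_compl_eq_one_sub (measurableSet_toMeasurable _ _), measureReal_def,
      measure_toMeasurable]
    have h : Pr.real B ≤ (Pr.map f).real {y | ¬ p y} :=
      ENNReal.toReal_mono (measure_ne_top _ _) (Measure.le_map_apply hf _)
    rw [measureReal_def] at h
    linarith
  · by_contra hp
    exact hω (subset_toMeasurable Pr B hp)

lemma isUnit_det_sqrt {S : Matrix (Fin d) (Fin d) ℝ} (hS : S.PosDef) :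
    IsUnit (CFC.sqrt S).det := by
  have h : (CFC.sqrt S).det * (CFC.sqrt S).det = S.det := by
    rw [← Matrix.det_mul, CFC.sqrt_mul_sqrt_self S hS.posSemidef.nonneg]
  rw [isUnit_iff_ne_zero]
  intro h0
  rw [h0, zero_mul] at h
  exact hS.det_pos.ne h

/-- The standardized sample of independent Gaussian vectors is a standard Gaussian sample. -/
lemma map_standardize_eq_pi {S : Matrix (Fin d) (Fin d) ℝ} (hS : S.PosDef)
    {μ : EuclideanSpace ℝ (Fin d)} {Ω : Type*} [MeasurableSpace Ω] {Pr : Measure Ω}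
    [IsProbabilityMeasure Pr] {X : Fin n → Ω → EuclideanSpace ℝ (Fin d)}
    (hX : ∀ i, HasLaw (X i) (multivariateGaussian μ S) Pr) (hind : iIndepFun X Pr) :
    AEMeasurable (fun ω i => matAct (CFC.sqrt S)⁻¹ (X i ω - μ)) Pr ∧
    Pr.map (fun ω i => matAct (CFC.sqrt S)⁻¹ (X i ω - μ)) =
      Measure.pi fun _ => stdGaussian (EuclideanSpace ℝ (Fin d)) := by
  set g : EuclideanSpace ℝ (Fin d) → EuclideanSpace ℝ (Fin d) :=
    fun y => matAct (CFC.sqrt S)⁻¹ (y - μ) with hg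
  have hgm : Measurable g := by fun_prop
  have hm : ∀ i, AEMeasurable (fun ω => g (X i ω)) Pr := fun i =>
    hgm.comp_aemeasurable (hX i).aemeasurable
  refine ⟨aemeasurable_pi_lambda _ hm, ?_⟩
  have hind' : iIndepFun (fun i ω => g (X i ω)) Pr := hind.comp (fun _ => g) fun _ => hgm
  rw [(iIndepFun_iff_map_fun_eq_pi_map hm).1 hind']
  congr 1
  ext1 i
  have h1 : Pr.map (fun ω => g (X i ω)) = (Pr.map (X i)).map g :=
    (AEMeasurable.map_map_of_aemeasurable hgm.aemeasurable (hX i).aemeasurable).symm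
  -- `multivariateGaussian` is by definition the image of the standard Gaussian under y ↦ μ +
  -- S^{1/2} y, which standardization inverts.
  rw [h1, (hX i).map_eq, multivariateGaussian, Measure.map_map hgm (by fun_prop)]
  have h2 : g ∘ (fun y => μ + matAct (CFC.sqrt S) y) = id := by
    ext1 y
    simp only [hg, Function.comp_apply, add_sub_cancel_left, id_eq]
    rw [← matAct_mul, Matrix.nonsing_inv_mul _ (isUnit_det_sqrt hS), matAct, map_one]
    rfl
  rw [h2, Measure.map_id]

end GaussianSample

/-! ### The theorem -/

theorem mainTheorem5 :
    ∃ C₁ C₂ C₃ : ℝ, ∃ k₁ k₂ : ℕ, 0 < C₁ ∧ 0 < C₂ ∧ 0 < C₃ ∧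
      ∀ (d n : ℕ) (μ : EuclideanSpace ℝ (Fin d)) (S : Matrix (Fin d) (Fin d) ℝ) (ε δ : ℝ),
        S.PosDef → 0 < ε → ε < 1 → 0 < δ → δ < 1 →
        softO C₁ k₁ ((d : ℝ) ^ 2 * Real.log (1 / δ) ^ 5 / ε ^ 2) ≤ (n : ℝ) →
        ∀ (Ω : Type*) [MeasurableSpace Ω] (Pr : Measure Ω) [IsProbabilityMeasure Pr]
          (X : Fin n → Ω → EuclideanSpace ℝ (Fin d)),
          (∀ i, HasLaw (X i) (multivariateGaussian μ S) Pr) → iIndepFun X Pr →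
          ∃ E : Set Ω, MeasurableSet E ∧ 1 - C₃ * δ ≤ Pr.real E ∧
            ∀ ω ∈ E, ∀ x : Fin n → EuclideanSpace ℝ (Fin d), (∀ i, x i = X i ω) →
            ∀ (a : Fin n → ℝ) (b : Fin n → Fin n → ℝ), AdmissibleWeights ε a b →
            ∀ (v : EuclideanSpace ℝ (Fin d)) (P : Matrix (Fin d) (Fin d) ℝ), P.IsSymm →
              |inner ℝ (μ - sampleMean x) v| ≤ softO C₂ k₂ ε * √(quadForm S v) ∧
              |𝔼 i, a i * inner ℝ (x i - sampleMean x) v| ≤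
                softO C₂ k₂ ε * √(quadForm (sampleCov x) v) ∧
              |𝔼 i, a i * ((inner ℝ (x i - sampleMean x) v) ^ 2 - quadForm (sampleCov x) v)| ≤
                softO C₂ k₂ ε * quadForm (sampleCov x) v ∧
              |matInner (sampleCov x - S) P| ≤ softO C₂ k₂ ε * scaledFrob S P ∧
              |𝔼 i, ((matInner (outerSq (x i - sampleMean x) - sampleCov x) P) ^ 2 -
                  2 * scaledFrob S P ^ 2)| ≤ softO C₂ k₂ ε * scaledFrob S P ^ 2 ∧
              |𝔼 i, 𝔼 j, b i j * matInner (pairedMat x i j - sampleCov x) P| ≤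
                softO C₂ k₂ ε * scaledFrob S P ∧
              |𝔼 i, 𝔼 j, b i j * ((matInner (pairedMat x i j - sampleCov x) P) ^ 2 -
                  2 * scaledFrob S P ^ 2)| ≤ softO C₂ k₂ ε * scaledFrob S P ^ 2 := by
  refine ⟨10 ^ 30, 50000, 100, 10, 2, by norm_num, by norm_num, by norm_num, ?_⟩
  intro d n μ S ε δ hS hε0 hε1 hδ0 hδ1 hn Ω _ Pr _ X hX hind
  -- With C₃ = 100 the claim is empty for δ ≥ 1/100; below that, log(1/δ) ≥ 1, as the sample size
  -- lemma requires.
  rcases le_or_gt (1 / 100) δ with hδ | hδ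
  · exact ⟨∅, MeasurableSet.empty, by rw [measureReal_empty]; linarith, fun ω hω => hω.elim⟩
  -- In dimension 0 the size condition permits n = 0, but both sides of every estimate vanish.
  rcases Nat.eq_zero_or_pos d with rfl | hd
  · refine ⟨Set.univ, MeasurableSet.univ, by rw [probReal_univ]; linarith, ?_⟩
    intro ω _ x _ a b _ v P _
    obtain rfl : v = 0 := Subsingleton.elim _ _
    have h1 : ∀ M N : Matrix (Fin 0) (Fin 0) ℝ, matInner M N = 0 := fun M N => by
      rw [matInner, Matrix.trace_fin_zero]
    have h2 : scaledFrob S P = 0 := by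
      rw [scaledFrob, ← sq_eq_zero_iff, frobNorm_sq, Fin.sum_univ_zero]
    have h3 : ∀ M : Matrix (Fin 0) (Fin 0) ℝ, quadForm M 0 = 0 := fun M => by simp [quadForm]
    simp [h1, h2, h3]
  have hd1 : (1 : ℝ) ≤ d := by exact_mod_cast hd
  have hL : 1 ≤ Real.log (1 / δ) := by
    rw [Real.le_log_iff_exp_le (by positivity), le_div_iff₀ hδ0]
    nlinarith [Real.exp_one_lt_d9, Real.exp_pos 1]
  have hsize := size_of_softO hd1 hL hε0 hε1 hn
  -- For n = 0 the logarithm takes its default value 0, so the left side of the size condition stays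
  -- positive while the right side is 0.
  have hn0 : 0 < n := by
    rcases Nat.eq_zero_or_pos n with rfl | h
    · have : (0 : ℝ) < 10 ^ 8 * (d : ℝ) ^ 2 * (1 + Real.log (0 : ℕ) + Real.log (1 / δ)) ^ 5 := by
        simp only [Nat.cast_zero, Real.log_zero]
        positivity
      rw [Nat.cast_zero, zero_mul, ← Nat.cast_zero] at hsize
      simp only [Nat.cast_zero] at hsize this
      linarith
    · exact h
  obtain ⟨hm, hlaw⟩ := map_standardize_eq_pi hS hX hind
  have hprob := measureReal_pi_not_goodSample_le hd hε0 hε1 hδ0 hδ1 hsize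
  rw [← hlaw] at hprob
  obtain ⟨E, hE, hPE, hgood⟩ := exists_measurableSet_of_map hm hprob
  refine ⟨E, hE, by linarith, fun ω hω x hx a b hab v P hP => ?_⟩
  refine estimates_of_goodSample hn0 hε0 hε1 hS.posSemidef (fun i => ?_) (hgood ω hω).1
    (hgood ω hω).2 hab v hP
  rw [← matAct_mul, Matrix.mul_nonsing_inv _ (isUnit_det_sqrt hS), matAct, map_one, hx i]
  simp
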